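/- \textbf{Conventions.} All fields have characteristic $0$. An \emph{exponential field} is a field $F$ with a homomorphism $\exp:(F,+)\to(F^\times,\cdot)$; write $\ker(F)=\{x\in F:\exp(x)=1\}$ and $Z(F)=\{r\in F:\forall x\,(x\in\ker(F)\Rightarrow rx\in\ker(F))\}$, a subring of $F$. It is an \emph{ELA-field} if $F$ is algebraically closed and $\exp$ maps onto $F^\times$. For $X\subseteq F$ and a finite tuple $\bar a$ from $F$ put \[\delta(\bar a/X)=\operatorname{td}(\bar a,\exp(\bar a)/X,\exp(X))-\operatorname{ldim}_{\mathbb Q}(\bar a/X),\] where $\operatorname{td}(Y/X)$ is the transcendence degree of $\mathbb Q(X\cup Y)/\mathbb Q(X)$ and $\operatorname{ldim}_{\mathbb Q}(Y/X)$ is the dimension of $\operatorname{span}_{\mathbb Q}(X\cup Y)/\operatorname{span}_{\mathbb Q}(X)$. Call $X$ \emph{strong} in $F$ if $\delta(\bar a/X)\ge 0$ for all finite tuples $\bar a$ from $F$. Let $G=\mathbb G_a\times\mathbb G_m$, and let $V\subseteq G^n$ be an irreducible subvariety defined over an ELA-field $F$, with coordinates $(\bar x,\bar y)$. Integer matrices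 $M\in\mathrm{Mat}_{n\times n}(\mathbb Z)$ act on $G^n$ linearly on $\mathbb G_a^n$ and multiplicatively on $\mathbb G_m^n$. $V$ is \emph{rotund} if $\dim M\cdot V\ge\operatorname{rk}M$ for all such $M$; it is \emph{additively free} (resp. \emph{multiplicatively free}) if no equation $\sum_i m_ix_i=c$ (resp. $\prod_i y_i^{m_i}=c$) with $m\in\mathbb Z^n\setminus\{0\}$ and $c\in F$ holds on $V$. A point $p\in V$ is \emph{generic in $V$ over} $A\subseteq F$ if every polynomial over $\mathbb Q(A)$ vanishing at $p$ vanishes on $V$. For an infinite cardinal $\lambda$, $F$ satisfies \emph{$\lambda$-SEAC} if for every $n$, every irreducible, rotund, additively and multiplicatively free $V\subseteq G^n$ defined over $F$ with $\dim V=n$, and every $A\subseteq F$ with $|A|<\lambda$, there is $\bar x\in F^n$ such that $(\bar x,\exp(\bar x))\in V$ is generic in $V$ over $A$. \emph{SEAC} is the same property for finite $A$. For $C\subseteq F$, let $\operatorname{ecl}(C)$ be the set of $b\in F$ such that for some $n\ge 1$ there are $p_1,\dots,p_n\in\mathbb Q(C)[X_1,\dots,X_n,Y_1,\dots,Y_n]$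 and $\bar a\in F^n$ with $a_1=b$ such that the exponential polynomials $f_i(\bar X)=p_i(\bar X,e^{\bar X})$ satisfy $f_i(\bar a)=0$ for all $i$ and $\det(\partial f_i/\partial X_j)(\bar a)\ne 0$ (formal derivatives, with $\partial e^X/\partial X=e^X$). A set $B\subseteq F$ is exponentially algebraically independent if $b\notin\operatorname{ecl}(B\setminus\{b\})$ for all $b\in B$; the exponential transcendence degree $\operatorname{etd}(F)$ is the dimension of the pregeometry $\operatorname{ecl}$, i.e. the supremum of the cardinalities of such sets. An ELA-field $F$ is \emph{saturated over its kernel} if $\operatorname{etd}(F)\ge|F|$ and $F$ satisfies $|F|$-SEAC. Let $\mathrm{ECF}_{\mathrm{StrK}}$ be the class of exponential fields $F$ such that: (1) $F$ is an ELA-field; (2a) $\ker(F)$ is a cyclic $Z(F)$-module; (2b) every nonzero element of $\ker(F)$ is transcendental over $Z(F)$; (2c) the ring $Z(F)$ is a model of the complete first-order theory of $\langle\mathbb Z;+,\cdot\rangle$; (3) $\ker(F)$ is strong in $F$; (4) $F$ satisfies SEAC. \textbf{Proposition.} Let $F\in\mathrm{ECF}_{\mathrm{StrK}}$. Then there are $F'\in\mathrm{ECF}_{\mathrm{StrK}}$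 with $|F'|=|F|$ and an embedding of exponential fields $\theta:F\to F'$ such that $\theta(\ker(F))=\ker(F')$, $\theta(F)$ is strong in $F'$, and $F'$ is saturated over its kernel. -/

import Mathlib

universe u

/-!
Conventions. An exponential field of characteristic zero is a field `F` with `[CharZero F]` together
with a homomorphism `e` from the additive group of `F` to its multiplicative group, i.e. an
`AddChar F F` (its values are automatically nonzero). A point of the affine space of dimension
`2 n` is a function `p : Fin n ⊕ Fin n → F`, with additive coordinates `p (Sum.inl i)` and
multiplicative coordinates `p (Sum.inr i)`.
-/

namespace ExpFld

noncomputable section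

open MvPolynomial

section Predimension

variable {F : Type u} [Field F]

/-- The kernel of the exponential map. -/
def ker (e : AddChar F F) : Set F := {x | e x = 1}

/-- `F` is an ELA-field: algebraically closed, and every nonzero element has a logarithm
(characteristic zero is a separate class hypothesis wherever this is used). -/
def IsELA (e : AddChar F F) : Prop := IsAlgClosed F ∧ ∀ y : F, y ≠ 0 → ∃ x, e x = y

/-- The multiplicative stabilizer of the kernel, `Z(F) = {r | ∀ x, x ∈ ker → r x ∈ ker}`,
as a subring of `F`. -/
def zStab (e : AddChar F F) : Subring F where
  carrier := {r | ∀ x ∈ ker e, r * x ∈ ker e}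
  mul_mem' := by
    intro a b ha hb x hx
    rw [mul_assoc]
    exact ha _ (hb _ hx)
  one_mem' := by
    intro x hx
    rwa [one_mul]
  add_mem' := by
    intro a b ha hb x hx
    have h1 : e (a * x) = 1 := ha x hx
    have h2 : e (b * x) = 1 := hb x hx
    change e ((a + b) * x) = 1
    rw [add_mul, AddChar.map_add_eq_mul, h1, h2, one_mul]
  zero_mem' := by
    intro x _
    change e (0 * x) = 1
    rw [zero_mul, AddChar.map_zero_eq_one]
  neg_mem' := by
    intro a ha x hx
    have h1 : e (a * x) = 1 := ha x hx
    change e (-a * x) = 1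
    rw [neg_mul, AddChar.map_neg_eq_inv, h1, inv_one]

/-- The commutative ring `R` is a model of the complete first-order theory of the ring of integers
in the language of rings. -/
def ModelsTrueArithmetic (R : Type u) [CommRing R] : Prop :=
  letI := FirstOrder.Ring.compatibleRingOfRing R
  letI := FirstOrder.Ring.compatibleRingOfRing ℤ
  FirstOrder.Language.ElementarilyEquivalent FirstOrder.Language.ring ℤ R

variable [CharZero F]

/-- `td(Y / X)`: the transcendence degree of the field extension `ℚ(X ∪ Y) / ℚ(X)`. -/
def td (Y X : Set F) : Cardinal.{u} :=
  Algebra.trdeg (IntermediateField.adjoin ℚ X)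
    (IntermediateField.adjoin (IntermediateField.adjoin ℚ X) Y)

/-- `ldim_ℚ(Y / X)`: the dimension of the `ℚ`-space spanned by `X ∪ Y` modulo the one spanned by
`X`, computed as the span of the image of `Y` in `F / span X`. Only used for finite `Y`. -/
def ldim (Y X : Set F) : ℕ :=
  Module.finrank ℚ (Submodule.span ℚ ((Submodule.span ℚ X).mkQ '' Y))

/-- The relative predimension
`δ(a / X) = td(a, exp a / X, exp X) - ldim_ℚ(a / X)` of a finite tuple `a`. -/
def delta (e : AddChar F F) {n : ℕ} (a : Fin n → F) (X : Set F) : ℤ :=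
  ((td (Set.range a ∪ e '' Set.range a) (X ∪ e '' X)).toNat : ℤ) - (ldim (Set.range a) X : ℤ)

/-- The subset `X` is strong in `F`: `δ(a / X) ≥ 0` for every finite tuple `a` from `F`. -/
def IsStrong (e : AddChar F F) (X : Set F) : Prop :=
  ∀ (n : ℕ) (a : Fin n → F), 0 ≤ delta e a X

end Predimension

section Varieties

variable {F : Type u} [Field F]

/-- `V` is an irreducible (in particular nonempty) Zariski closed subset of `Gⁿ(F)`, where
`G = G_a × G_m`. (Over an algebraically closed `F` these are the irreducible subvarieties of `Gⁿ`
defined over `F`.) -/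
def IsIrredSubvariety {n : ℕ} (V : Set (Fin n ⊕ Fin n → F)) : Prop :=
  (∃ I : Ideal (MvPolynomial (Fin n ⊕ Fin n) F),
    V = {p | (∀ i, p (Sum.inr i) ≠ 0) ∧ p ∈ zeroLocus F I}) ∧
  (vanishingIdeal F V).IsPrime

/-- The dimension of (the Zariski closure of) a set `V` of points whose closure is irreducible:
the transcendence degree over `F` of the coordinate ring. -/
def dim {n : ℕ} (V : Set (Fin n ⊕ Fin n → F)) : Cardinal.{u} :=
  Algebra.trdeg F (MvPolynomial (Fin n ⊕ Fin n) F ⧸ vanishingIdeal F V)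

/-- The action of an integer matrix on `Gⁿ`: linear on additive coordinates, by monomials on
multiplicative ones. -/
def matAct {n : ℕ} (M : Matrix (Fin n) (Fin n) ℤ) (p : Fin n ⊕ Fin n → F) :
    Fin n ⊕ Fin n → F :=
  Sum.elim (fun i => ∑ j, (M i j : F) * p (Sum.inl j)) (fun i => ∏ j, p (Sum.inr j) ^ M i j)

/-- `V` is rotund: `dim (M · V) ≥ rk M` for every integer `n × n` matrix `M`. -/
def IsRotund {n : ℕ} (V : Set (Fin n ⊕ Fin n → F)) : Prop :=
  ∀ M : Matrix (Fin n) (Fin n) ℤ,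
    (((M.map (Int.cast : ℤ → ℚ)).rank : ℕ) : Cardinal.{u}) ≤ dim (matAct M '' V)

/-- No equation `∑ mᵢ xᵢ = c`, with integers `mᵢ` not all zero and `c` in `F`, holds on `V`. -/
def IsAddFree {n : ℕ} (V : Set (Fin n ⊕ Fin n → F)) : Prop :=
  ∀ m : Fin n → ℤ, m ≠ 0 → ∀ c : F, ¬ ∀ p ∈ V, ∑ i, (m i : F) * p (Sum.inl i) = c

/-- No equation `∏ yᵢ ^ mᵢ = c`, with integers `mᵢ` not all zero and `c` in `F`, holds on `V`. -/
def IsMulFree {n : ℕ} (V : Set (Fin n ⊕ Fin n → F)) : Prop :=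
  ∀ m : Fin n → ℤ, m ≠ 0 → ∀ c : F, ¬ ∀ p ∈ V, ∏ i, p (Sum.inr i) ^ m i = c

/-- The point `(x, exp x)`. -/
def expPoint (e : AddChar F F) {n : ℕ} (x : Fin n → F) : Fin n ⊕ Fin n → F :=
  Sum.elim x (fun i => e (x i))

variable [CharZero F]

/-- `p` is a generic point of the irreducible variety `V` over the set `A`: it lies in `V`, and
every polynomial over the field `ℚ(A)` which vanishes at `p` vanishes on all of `V`. -/
def IsGenericIn {n : ℕ} (p : Fin n ⊕ Fin n → F) (V : Set (Fin n ⊕ Fin n → F)) (A : Set F) : Prop :=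
  p ∈ V ∧ ∀ f : MvPolynomial (Fin n ⊕ Fin n) (IntermediateField.adjoin ℚ A),
    aeval p f = 0 → ∀ v ∈ V, aeval v f = 0

/-- Strong exponential-algebraic closedness. -/
def SEAC (e : AddChar F F) : Prop :=
  ∀ (n : ℕ) (V : Set (Fin n ⊕ Fin n → F)), IsIrredSubvariety V → IsRotund V → IsAddFree V →
    IsMulFree V → dim V = (n : Cardinal.{u}) → ∀ (r : ℕ) (a : Fin r → F),
      ∃ x : Fin n → F, IsGenericIn (expPoint e x) V (Set.range a)

/-- `κ`-SEAC: as `SEAC`, with generic points over any set of fewer than `κ` parameters. -/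
def CardSEAC (e : AddChar F F) (κ : Cardinal.{u}) : Prop :=
  ∀ (n : ℕ) (V : Set (Fin n ⊕ Fin n → F)), IsIrredSubvariety V → IsRotund V → IsAddFree V →
    IsMulFree V → dim V = (n : Cardinal.{u}) → ∀ A : Set F, Cardinal.mk A < κ →
      ∃ x : Fin n → F, IsGenericIn (expPoint e x) V A

end Varieties

section ExpTranscendence

variable {F : Type u} [Field F]

/-- The value at `a` of the formal partial derivative with respect to `X_j` of the exponential
polynomial `f(X) = p(X, exp X)`, namely of `∂p/∂X_j + Y_j ∂p/∂Y_j` at `Y = exp X`. -/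
def expPderiv (e : AddChar F F) {n : ℕ} {k : Type u} [Field k] [Algebra k F]
    (p : MvPolynomial (Fin n ⊕ Fin n) k) (j : Fin n) (a : Fin n → F) : F :=
  aeval (expPoint e a) (pderiv (Sum.inl j) p) +
    e (a j) * aeval (expPoint e a) (pderiv (Sum.inr j) p)

variable [CharZero F]

/-- The exponential algebraic closure of `C` in `F`: first coordinates of solutions of
Khovanskii systems of exponential polynomials with coefficients in `ℚ(C)`. -/
def ecl (e : AddChar F F) (C : Set F) : Set F :=
  {b | ∃ (n : ℕ) (a : Fin (n + 1) → F)
      (p : Fin (n + 1) → MvPolynomial (Fin (n + 1) ⊕ Fin (n + 1)) (IntermediateField.adjoin ℚ C)),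
      a 0 = b ∧ (∀ i, aeval (expPoint e a) (p i) = 0) ∧
      (Matrix.of fun i j => expPderiv e (p i) j a).det ≠ 0}

/-- The set `B` is exponentially algebraically independent. -/
def ExpIndep (e : AddChar F F) (B : Set F) : Prop := ∀ b ∈ B, b ∉ ecl e (B \ {b})

/-- The exponential transcendence degree: the supremum of the cardinalities of the exponentially
algebraically independent subsets. (As `ecl` is a pregeometry, this is its dimension.) -/
def etd (e : AddChar F F) : Cardinal.{u} :=
  ⨆ B : {B : Set F // ExpIndep e B}, Cardinal.mk B.1

/-- `κ`-saturation over the kernel (for ELA-fields). -/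
def CardSaturatedOverKernel (e : AddChar F F) (κ : Cardinal.{u}) : Prop :=
  κ ≤ etd e ∧ CardSEAC e κ

/-- Saturation over the kernel (for ELA-fields). -/
def SaturatedOverKernel (e : AddChar F F) : Prop :=
  CardSaturatedOverKernel e (Cardinal.mk F)

end ExpTranscendence

/-- The class of exponentially closed fields with strong kernel. -/
structure IsECFStrK {F : Type u} [Field F] [CharZero F] (e : AddChar F F) : Prop where
  ela : IsELA e
  cyclic_kernel : ∃ t ∈ ker e, ∀ k ∈ ker e, ∃ r ∈ zStab e, k = r * t
  kernel_transcendental : ∀ k ∈ ker e, k ≠ 0 → Transcendental (zStab e) k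
  true_arithmetic : ModelsTrueArithmetic (zStab e)
  strong_kernel : IsStrong e (ker e)
  seac : SEAC e

end

end ExpFld

/-! The extension is built in one step. Let `K` be an algebraic closure of `F(t_θ)` for `|F|` many
independent generators `t_θ`, so that `|K| = |F|`; every generator carries a level in ℕ. Only the
exponential of `K` remains to be chosen. Since `Kˣ` is divisible, a homomorphism extending `e` may
be prescribed freely on any family that is ℤ-independent modulo `F`. If arguments and values are
both maximal independent families, modulo `F` and modulo `Fˣ` respectively, then the result has no
new kernel elements and is surjective (`exists_addChar_extension`).

The generators are spent as follows. A slot `(n, s)` owns countably many generators of level `n`. If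
its code describes a rotund free variety `V` whose coefficients are algebraic over `F` and
generators of level below `n`, then the slot receives a point of `V` that is generic over the field
of all generators outside the slot, yet algebraic over those coefficients and its own generators
(`exists_generic_point`); the exponential sends its additive half to its multiplicative half. Each
code is repeated `|F|` times at every level, while fewer than `|F|` parameters involve fewer than
`|F|` generators, so some suitable slot avoids them all: this is `|F|`-SEAC
(`cardSEAC_of_slot_points`). The other generators serve as values for the elements completing the
additive family, and as arguments for those completing the multiplicative one. There remain `|F|`
pairs `(u, exp u)` of two independent generators.

All these blocks are ordered by level, and each satisfies the predimension inequality over a field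
containing every other block of at most its level. Removing blocks from the top shows that `F` is
strong in `K` (`isStrong_of_blocks`). The pairs `(u, exp u)` sit at level `0`, so `F` together with
all the `u` spans a strong subspace as well. A solution of a Khovanskii system has nonpositive
predimension (`exists_relRank_le_of_mem_ecl`), by an argument with derivations, whereas each `u`
adds transcendence degree `2` against linear dimension `1`. Hence the `u` are exponentially
independent and `etd ≥ |F|`.

Kernel and multiplicative stabilizer are those of `F`, which preserves the axioms about them; the
kernel is strong because strongness is transitive (`IsStrong.image_algebraMap`). -/

namespace ExpFld

open AlgebraicIndependent Set

/-! ### Transcendence degree as rank in a contracted algebraic matroid -/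

section RelativeRank

variable {K : Type*} [Field K] [CharZero K]

/-- The relative algebraic closure in `K` of the field generated by `X`. -/
noncomputable def acl (X : Set K) : IntermediateField ℚ K :=
  (algebraicClosure (IntermediateField.adjoin ℚ X) K).restrictScalars ℚ

theorem mem_acl {X : Set K} {x : K} :
    x ∈ acl X ↔ IsAlgebraic (IntermediateField.adjoin ℚ X) x := by
  rw [acl, IntermediateField.mem_restrictScalars, mem_algebraicClosure_iff]

theorem coe_acl (X : Set K) : (acl X : Set K) = (matroid ℚ K).closure X := by
  ext x
  rw [matroid_closure_eq, SetLike.mem_coe, SetLike.mem_coe, mem_acl,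
    IntermediateField.isAlgebraic_adjoin_iff, Subalgebra.mem_algebraicClosure]

theorem subset_acl (X : Set K) : X ⊆ acl X := by
  rw [coe_acl]
  exact (matroid ℚ K).subset_closure X (subset_univ _)

theorem acl_subset_acl_iff {X Y : Set K} : (acl X : Set K) ⊆ acl Y ↔ X ⊆ acl Y := by
  rw [coe_acl, coe_acl]
  exact (matroid ℚ K).closure_subset_closure_iff_subset_closure (subset_univ _)

theorem acl_mono {X Y : Set K} (h : X ⊆ Y) : (acl X : Set K) ⊆ acl Y :=
  acl_subset_acl_iff.2 (h.trans (subset_acl Y))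

theorem acl_acl (X : Set K) : acl (acl X : Set K) = acl X :=
  SetLike.coe_injective
    ((acl_subset_acl_iff.2 subset_rfl).antisymm (subset_acl _))

theorem adjoin_le_acl (X : Set K) : IntermediateField.adjoin ℚ X ≤ acl X :=
  IntermediateField.adjoin_le_iff.2 (subset_acl X)

theorem mem_acl_of_isAlgebraic_acl {X : Set K} {x : K} (h : IsAlgebraic (acl X) x) :
    x ∈ acl X := by
  have : x ∈ acl (acl X : Set K) := by
    rw [mem_acl]
    exact h.tower_top_of_subalgebra_le (A := (acl X).toSubalgebra)
      (B := (IntermediateField.adjoin ℚ (acl X : Set K)).toSubalgebra)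
      (IntermediateField.subset_adjoin ℚ _)
  rwa [acl_acl] at this

theorem mem_acl_of_pow_mem {X : Set K} {x : K} {n : ℕ} (hn : n ≠ 0) (h : x ^ n ∈ acl X) :
    x ∈ acl X := by
  apply mem_acl_of_isAlgebraic_acl
  refine IsAlgebraic.of_pow (Nat.pos_of_ne_zero hn) ?_
  exact isAlgebraic_algebraMap (⟨_, h⟩ : acl X)

/-- The rank of `Y` over `X`: the maximal size of a subset of `Y` which is algebraically
independent over `ℚ(X)`. -/
noncomputable def relRank (X Y : Set K) : ℕ∞ := ((matroid ℚ K).contract X).eRk Y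

/-- Take a transcendence basis `B` of `X`. Independence in the contraction says that `I ∪ B` is
independent over ℚ (and `I` is disjoint from `X`), hence that `I` is independent over `ℚ[B]`; since
`ℚ(X)` is algebraic over `ℚ[B]`, the base may be enlarged to it. -/
theorem contract_indep_iff {X I : Set K} :
    ((matroid ℚ K).contract X).Indep I ↔
      AlgebraicIndepOn (IntermediateField.adjoin ℚ X) id I := by
  obtain ⟨B, hB⟩ := (matroid ℚ K).exists_isBasis X (subset_univ _)
  have hB' := matroid_isBasis_iff.1 hB
  have key : Disjoint X I → ((matroid ℚ K).Indep (I ∪ B) ↔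
      AlgebraicIndepOn (IntermediateField.adjoin ℚ X) id I) := by
    intro hd
    have hinj : Function.Injective (Sum.elim (fun i : I => (i : K)) (fun b : B => (b : K))) := by
      refine Function.Injective.sumElim Subtype.val_injective Subtype.val_injective ?_
      intro i b h
      exact Set.disjoint_left.1 hd (hB'.2.1 b.2) (h ▸ i.2)
    have hr : range (Sum.elim (fun i : I => (i : K)) (fun b : B => (b : K))) = I ∪ B := by
      rw [Set.Sum.elim_range, Subtype.range_val, Subtype.range_val]
    rw [matroid_indep_iff, ← hr]
    have h1 := algebraicIndependent_subtype_range (R := ℚ) hinj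
    refine h1.trans ?_
    rw [sumElim_iff]
    rw [Subtype.range_val]
    have hle : (Algebra.adjoin ℚ B) ≤ (IntermediateField.adjoin ℚ X).toSubalgebra :=
      Algebra.adjoin_le (hB'.2.1.trans (IntermediateField.subset_adjoin ℚ X))
    let _ : Algebra (Algebra.adjoin ℚ B) (IntermediateField.adjoin ℚ X) :=
      (Subalgebra.inclusion hle).toAlgebra
    have : IsScalarTower (Algebra.adjoin ℚ B) (IntermediateField.adjoin ℚ X) K :=
      .of_algebraMap_eq fun _ => rfl
    have : FaithfulSMul (Algebra.adjoin ℚ B) (IntermediateField.adjoin ℚ X) :=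
      (faithfulSMul_iff_algebraMap_injective _ _).2 (Subalgebra.inclusion_injective hle)
    have : Algebra.IsAlgebraic (Algebra.adjoin ℚ B) (IntermediateField.adjoin ℚ X) := by
      constructor
      rintro ⟨x, hx⟩
      have hx' : x ∈ (matroid ℚ K).closure B := by
        rw [hB.closure_eq_closure, ← coe_acl]
        exact adjoin_le_acl X hx
      rw [matroid_closure_eq, SetLike.mem_coe, Subalgebra.mem_algebraicClosure] at hx'
      rw [← isAlgebraic_algebraMap_iff (A := K) Subtype.val_injective]
      exact hx'
    have h2 := Algebra.IsAlgebraic.algebraicIndependent_iff (Algebra.adjoin ℚ B)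
      (S := IntermediateField.adjoin ℚ X) (x := fun i : I => (i : K))
    exact ⟨fun h => h2.1 h.2, fun h => ⟨hB'.1, h2.2 h⟩⟩
  rw [hB.contract_indep_iff]
  constructor
  · rintro ⟨h1, h2⟩
    exact (key h2).1 h1
  · intro h
    have hd : Disjoint X I := by
      rw [Set.disjoint_left]
      intro x hx hI
      exact h.transcendental ⟨x, hI⟩
        (isAlgebraic_algebraMap (⟨x, IntermediateField.subset_adjoin ℚ X hx⟩ :
          IntermediateField.adjoin ℚ X))
    exact ⟨(key hd).2 h, hd⟩

theorem contract_indep_iff_notMem_acl {X I : Set K} :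
    ((matroid ℚ K).contract X).Indep I ↔ ∀ i ∈ I, i ∉ acl (X ∪ (I \ {i})) := by
  by_cases hd : Disjoint I X
  · rw [Matroid.indep_iff_forall_notMem_closure_sdiff' , Matroid.contract_ground, matroid_e]
    constructor
    · rintro ⟨-, h⟩ i hi hm
      refine h i hi ?_
      rw [Matroid.contract_closure_eq]
      refine ⟨?_, Set.disjoint_left.1 hd hi⟩
      rw [union_comm, ← coe_acl]
      exact hm
    · intro h
      refine ⟨fun i hi => ⟨mem_univ _, Set.disjoint_left.1 hd hi⟩, fun i hi hm => h i hi ?_⟩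
      rw [Matroid.contract_closure_eq, union_comm, ← coe_acl] at hm
      exact hm.1
  · refine iff_of_false (fun h => hd ?_) (fun h => hd ?_)
    · exact (subset_sdiff.1 h.subset_ground).2
    · rw [Set.disjoint_left]
      intro i hi hX
      exact h i hi (subset_acl _ (Or.inl hX))

theorem contract_indep_mono {X X' I : Set K} (h : X ⊆ acl X')
    (hI : ((matroid ℚ K).contract X').Indep I) : ((matroid ℚ K).contract X).Indep I := by
  rw [contract_indep_iff_notMem_acl] at hI ⊢
  intro i hi hm
  refine hI i hi (acl_subset_acl_iff.2 ?_ hm)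
  exact union_subset (h.trans (acl_mono subset_union_left))
    (subset_union_right.trans (subset_acl _))

theorem relRank_anti {X X' : Set K} (h : X ⊆ acl X') (Y : Set K) :
    relRank X' Y ≤ relRank X Y := by
  obtain ⟨I, hIY, hI, hc⟩ := Matroid.le_eRk_iff.1 (le_refl (relRank X' Y))
  exact Matroid.le_eRk_iff.2 ⟨I, hIY, contract_indep_mono h hI, hc⟩

theorem relRank_mono {X Y Y' : Set K} (h : Y ⊆ acl (X ∪ Y')) : relRank X Y ≤ relRank X Y' := by
  unfold relRank
  rw [← Matroid.eRk_inter_ground, ← Matroid.eRk_closure_eq _ Y']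
  refine Matroid.eRk_mono _ ?_
  rintro y ⟨hy, hyE⟩
  rw [Matroid.contract_closure_eq, union_comm, ← coe_acl]
  exact ⟨h hy, hyE.2⟩

/-- One half of the additivity of transcendence degree, with slack: computing the second summand
over any `X'` whose closure contains `X ∪ Y` can only lower it. This slack lets each block be
measured over a field much larger than the one it is added to. -/
theorem relRank_add_le {X X' Y Y' : Set K} (h : X ∪ Y ⊆ acl X') :
    relRank X Y + relRank X' Y' ≤ relRank X (Y ∪ Y') := by
  have h1 : relRank X' Y' ≤ relRank (X ∪ Y) Y' := relRank_anti h _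
  refine (add_le_add_right h1 _).trans ?_
  obtain ⟨I, hI⟩ := ((matroid ℚ K).contract X).exists_isBasis' Y
  obtain ⟨J, hJY, hJ, hc⟩ := Matroid.le_eRk_iff.1 (le_refl (relRank (X ∪ Y) Y'))
  rw [← Matroid.contract_contract, hI.contract_indep_iff] at hJ
  have hd : Disjoint J I := hJ.2.symm.mono_right hI.subset
  unfold relRank
  rw [hI.eRk_eq_encard]
  unfold relRank at hc
  rw [← hc, add_comm, ← Set.encard_union_eq hd]
  exact hJ.1.encard_le_eRk_of_subset
    (union_subset (hJY.trans subset_union_right) (hI.subset.trans subset_union_left))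

theorem le_relRank_of_algebraicIndependent {ι : Type*} [Finite ι] {X Y : Set K} {x : ι → K}
    (hx : AlgebraicIndependent (IntermediateField.adjoin ℚ X) x) (hY : ∀ i, x i ∈ Y) :
    (Nat.card ι : ℕ∞) ≤ relRank X Y := by
  refine Matroid.le_eRk_iff.2 ⟨range x, range_subset_iff.2 hY, ?_, ?_⟩
  · rw [contract_indep_iff]
    exact hx.to_subtype_range
  · rw [← image_univ, hx.injective.encard_image, encard_univ, ENat.card_eq_coe_natCard]

theorem one_le_relRank {X Y : Set K} {y : K} (hy : y ∈ Y) (h : y ∉ acl X) :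
    1 ≤ relRank X Y := by
  refine Matroid.le_eRk_iff.2 ⟨{y}, by simpa using hy, ?_, by simp⟩
  rw [contract_indep_iff_notMem_acl]
  simpa using h

theorem relRank_lt_top {X Y : Set K} (hY : Y.Finite) : relRank X Y < ⊤ :=
  (Matroid.eRk_le_encard _ _).trans_lt hY.encard_lt_top

end RelativeRank

/-- A basis of `Y` in the contraction by `X` is a transcendence basis of `ℚ(X)(Y)` over `ℚ(X)`. From
here on the predimension can be handled by matroid ranks. -/
theorem td_toNat {K : Type u} [Field K] [CharZero K] (X : Set K) {Y : Set K} (hY : Y.Finite) :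
    (td Y X).toNat = (relRank X Y).toNat := by
  obtain ⟨I, hI⟩ := ((matroid ℚ K).contract X).exists_isBasis' Y
  have hind := contract_indep_iff.1 hI.indep
  set k := IntermediateField.adjoin ℚ X with hk
  set E := IntermediateField.adjoin k Y with hE
  let v : I → E := fun i => ⟨i, IntermediateField.subset_adjoin k Y (hI.subset i.2)⟩
  have hv : AlgebraicIndependent k v := by
    refine AlgebraicIndependent.of_comp (IsScalarTower.toAlgHom k E K) ?_
    exact hind
  have htb : IsTranscendenceBasis k v := by
    rw [hv.isTranscendenceBasis_iff_isAlgebraic]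
    have hYsub : ∀ y ∈ Y, IsAlgebraic (IntermediateField.adjoin k I) y := by
      intro y hy
      have h1 : y ∈ acl (X ∪ I) := by
        rw [← SetLike.mem_coe, coe_acl]
        by_cases hyX : y ∈ X
        · exact (matroid ℚ K).subset_closure (X ∪ I) (subset_univ _) (Or.inl hyX)
        · have := hI.isBasis_inter_ground.subset_closure ⟨hy, mem_univ _, hyX⟩
          rw [Matroid.contract_closure_eq, union_comm] at this
          exact this.1
      rw [mem_acl] at h1
      refine h1.tower_top_of_subalgebra_le (A := (IntermediateField.adjoin ℚ (X ∪ I)).toSubalgebra)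
        (B := ((IntermediateField.adjoin k I).restrictScalars ℚ).toSubalgebra) ?_
      refine IntermediateField.adjoin_le_iff.2 (union_subset ?_ ?_)
      · intro x hx
        exact (IntermediateField.adjoin k I).algebraMap_mem
          ⟨x, IntermediateField.subset_adjoin ℚ X hx⟩
      · exact IntermediateField.subset_adjoin k I
    have hE' : E ≤ (algebraicClosure (IntermediateField.adjoin k I) K).restrictScalars k := by
      refine IntermediateField.adjoin_le_iff.2 fun y hy => ?_
      exact mem_algebraicClosure_iff.2 (hYsub y hy)
    constructor
    intro x
    have hx := mem_algebraicClosure_iff.1 (hE' x.2)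
    rw [IntermediateField.isAlgebraic_adjoin_iff] at hx
    have hS : Algebra.adjoin k I = (Algebra.adjoin k (range v)).map E.val := by
      rw [AlgHom.map_adjoin, ← range_comp]
      congr 1
      exact Subtype.range_val.symm
    rw [hS] at hx
    let f := (Algebra.adjoin k (range v)).equivMapOfInjective E.val Subtype.val_injective
    exact IsAlgebraic.of_ringHom_of_comp_eq (f := (f : _ →+* _)) (g := (E.val : E →+* K)) hx
      f.surjective Subtype.val_injective rfl
  rw [td, ← htb.cardinalMk_eq_trdeg, relRank, hI.eRk_eq_encard]
  have hIf := hY.subset hI.subset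
  rw [← hIf.cast_ncard_eq]
  rfl

end ExpFld

namespace ExpFld

open AlgebraicIndependent Set Module

/-! ### Strongness of subspaces, and a criterion by blocks -/

section Strong

variable {K : Type u} [Field K]

/-- The elements of `Y` together with their exponentials. -/
def expHull (e : AddChar K K) (Y : Set K) : Set K := Y ∪ e '' Y

theorem expHull_mono (e : AddChar K K) {Y Y' : Set K} (h : Y ⊆ Y') : expHull e Y ⊆ expHull e Y' :=
  union_subset_union h (image_mono h)

theorem addChar_intCast_mul (e : AddChar K K) (n : ℤ) (x : K) : e (n * x) = e x ^ n := by
  rw [← zsmul_eq_mul, AddChar.map_zsmul_eq_zpow]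

theorem addChar_ne_zero (e : AddChar K K) (x : K) : e x ≠ 0 := (e.val_isUnit x).ne_zero

variable [CharZero K]

/-- The elements of the relative algebraic closure of `L` whose exponential is there too. -/
def expCore (e : AddChar K K) (L : Set K) : Submodule ℚ K where
  carrier := {x | x ∈ acl L ∧ e x ∈ acl L}
  zero_mem' := ⟨zero_mem _, by simp [one_mem]⟩
  add_mem' := by
    rintro x y ⟨hx, hx'⟩ ⟨hy, hy'⟩
    exact ⟨add_mem hx hy, by rw [AddChar.map_add_eq_mul]; exact mul_mem hx' hy'⟩
  smul_mem' := by
    rintro q x ⟨hx, hx'⟩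
    -- The power of `e (q x)` with exponent `q.den` equals `e x ^ q.num`, and a relatively
    -- algebraically closed field contains the roots of its elements.
    refine ⟨(acl L).smul_mem hx, mem_acl_of_pow_mem q.den_nz ?_⟩
    rw [← AddChar.map_nsmul_eq_pow]
    have : q.den • q • x = (q.num : K) * x := by
      rw [Rat.smul_def, nsmul_eq_mul, ← mul_assoc]
      congr 1
      exact_mod_cast Rat.den_mul_eq_num q
    rw [this, addChar_intCast_mul]
    exact zpow_mem hx' _

theorem mem_expCore {e : AddChar K K} {L : Set K} {x : K} :
    x ∈ expCore e L ↔ x ∈ acl L ∧ e x ∈ acl L := Iff.rfl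

theorem expHull_subset_acl_iff {e : AddChar K K} {L : Set K} {D : Set K} :
    expHull e D ⊆ acl L ↔ D ⊆ expCore e L := by
  constructor
  · intro h x hx
    exact ⟨h (Or.inl hx), h (Or.inr ⟨x, hx, rfl⟩)⟩
  · rintro h x (hx | ⟨y, hy, rfl⟩)
    · exact (h hx).1
    · exact (h hy).2

theorem expHull_span_subset_acl (e : AddChar K K) (X : Set K) :
    expHull e (Submodule.span ℚ X) ⊆ acl (expHull e X) := by
  rw [expHull_subset_acl_iff]
  refine Submodule.span_le.2 ?_
  rw [← expHull_subset_acl_iff]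
  exact subset_acl _

theorem relRank_expHull_span (e : AddChar K K) (X Y : Set K) :
    relRank (expHull e (Submodule.span ℚ X)) (expHull e (Submodule.span ℚ Y)) =
      relRank (expHull e X) (expHull e Y) := by
  apply le_antisymm
  · refine (relRank_anti (X := expHull e X) ?_ _).trans (relRank_mono ?_)
    · exact (expHull_mono e Submodule.subset_span).trans (subset_acl _)
    · exact (expHull_span_subset_acl e Y).trans (acl_mono subset_union_right)
  · refine (relRank_anti (X' := expHull e X) ?_ _).trans' (relRank_mono ?_)
    · exact expHull_span_subset_acl e X
    · exact (expHull_mono e Submodule.subset_span).trans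
        ((subset_acl _).trans (acl_mono subset_union_right))

theorem zero_le_delta_iff (e : AddChar K K) {n : ℕ} (a : Fin n → K) (X : Set K) :
    0 ≤ delta e a X ↔ (ldim (range a) X : ℕ∞) ≤ relRank (expHull e X) (expHull e (range a)) := by
  have hf : (range a ∪ e '' range a).Finite := (finite_range a).union ((finite_range a).image e)
  rw [delta, td_toNat _ hf]
  have := relRank_lt_top (X := expHull e X) hf
  lift relRank (expHull e X) (expHull e (range a)) to ℕ using this.ne with k hk
  have hk' : relRank (X ∪ e '' X) (range a ∪ e '' range a) = k := hk.symm
  rw [hk']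
  simp

/-- Both terms of the predimension depend only on ℚ-spans, so tuples may be replaced by
finite-dimensional subspaces, which can be intersected. -/
theorem isStrong_iff {e : AddChar K K} {X : Set K} :
    IsStrong e X ↔ ∀ A : Submodule ℚ K, A.FG →
      (finrank ℚ (A.map (Submodule.span ℚ X).mkQ) : ℕ∞) ≤
        relRank (expHull e (Submodule.span ℚ X)) (expHull e A) := by
  have key : ∀ (n : ℕ) (a : Fin n → K), (0 ≤ delta e a X ↔
      (finrank ℚ ((Submodule.span ℚ (range a)).map (Submodule.span ℚ X).mkQ) : ℕ∞) ≤
        relRank (expHull e (Submodule.span ℚ X)) (expHull e (Submodule.span ℚ (range a)))) := by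
    intro n a
    rw [zero_le_delta_iff, relRank_expHull_span, Submodule.map_span, ldim]
  constructor
  · rintro h A hA
    obtain ⟨n, a, rfl⟩ := Submodule.fg_iff_exists_fin_generating_family.1 hA
    exact (key n a).1 (h n a)
  · intro h n a
    exact (key n a).2 (h _ (Submodule.fg_span (finite_range a)))

/-- Rank-nullity for the projection of `A` modulo `D` onto `A` modulo `D'`, whose kernel comes from
`A ⊓ D'`. -/
theorem finrank_map_mkQ_le {A D D' : Submodule ℚ K} (hA : A.FG) (h : D ≤ D') :
    finrank ℚ (A.map D.mkQ) ≤
      finrank ℚ ((A ⊓ D').map D.mkQ) + finrank ℚ (A.map D'.mkQ) := by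
  have : FiniteDimensional ℚ A := Module.Finite.iff_fg.2 hA
  let g := (Submodule.factor h).domRestrict (A.map D.mkQ)
  rw [← LinearMap.finrank_range_add_finrank_ker g, add_comm]
  refine add_le_add ?_ ?_
  · refine LinearMap.finrank_le_finrank_of_injective
      (f := LinearMap.codRestrict _ ((A.map D.mkQ).subtype ∘ₗ (LinearMap.ker g).subtype) ?_) ?_
    · rintro ⟨⟨x, hx⟩, hg⟩
      obtain ⟨a, ha, rfl⟩ := hx
      refine ⟨a, ⟨ha, ?_⟩, rfl⟩
      have : D'.mkQ a = 0 := hg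
      simpa using this
    · intro x y hxy
      have := congrArg Subtype.val hxy
      exact Subtype.ext (Subtype.ext this)
  · have : LinearMap.range g = A.map D'.mkQ := by
      rw [LinearMap.range_domRestrict, ← Submodule.map_comp]
      rfl
    rw [this]

theorem exists_intCast_mul_eq {n : ℕ} (q : Fin n → ℚ) :
    ∃ (N : ℤ) (m : Fin n → ℤ), N ≠ 0 ∧ ∀ j, (m j : ℚ) = N * q j := by
  obtain ⟨N, hN⟩ := IsLocalization.exist_integer_multiples_of_finite (nonZeroDivisors ℤ) q
  choose m hm using hN
  refine ⟨N, m, nonZeroDivisors.coe_ne_zero N, fun j => ?_⟩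
  simpa [Submonoid.smul_def] using hm j

/-- Induction on the set of blocks, removing a block `i` of maximal level. With `D'` the span of `D`
and the remaining blocks, `A ⊓ D'` is covered by induction. What is left of `A` modulo `D'` is
spanned, up to denominators, by integer combinations of `b i`, whose rank over `L i` is bounded
below by `hind`. The two ranks add up because `D'` and its exponentials are algebraic over `L i`. -/
theorem finrank_map_mkQ_le_relRank_of_blocks {e : AddChar K K} {ι : Type*} {sz : ι → ℕ}
    {b : ∀ i, Fin (sz i) → K} {lvl : ι → ℕ} {L : ι → Set K} {D : Submodule ℚ K}
    (hD : ∀ i, D ≤ expCore e (L i))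
    (hb : ∀ i j, j ≠ i → lvl j ≤ lvl i → ∀ k, b j k ∈ expCore e (L i))
    (hind : ∀ (i : ι) (r : ℕ) (m : Fin r → Fin (sz i) → ℤ), LinearIndependent ℤ m →
      (r : ℕ∞) ≤ relRank (L i) (expHull e (range fun k => ∑ j, (m k j : K) * b i j)))
    (S : Finset ι) : ∀ A : Submodule ℚ K, A.FG →
      A ≤ D ⊔ ⨆ i ∈ S, Submodule.span ℚ (range (b i)) →
      (finrank ℚ (A.map D.mkQ) : ℕ∞) ≤ relRank (expHull e D) (expHull e A) := by
  classical
  induction S using Finset.induction_on_max_value lvl with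
  | empty =>
    intro A _ h
    have h : A ≤ D := by simpa using h
    have : A.map D.mkQ = ⊥ := by
      rw [eq_bot_iff, Submodule.map_le_iff_le_comap]
      intro x hx
      simpa using h hx
    rw [this, finrank_bot]
    exact zero_le
  | insert i S hi hmax ih =>
    intro A hA h
    set D' : Submodule ℚ K := D ⊔ ⨆ i ∈ S, Submodule.span ℚ (range (b i)) with hD'
    have hD'L : D' ≤ expCore e (L i) := by
      refine sup_le (hD i) (iSup₂_le fun j hj => Submodule.span_le.2 ?_)
      rintro _ ⟨k, rfl⟩
      exact hb i j (fun h => hi (h ▸ hj)) (hmax j hj) k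
    have hsup : D ⊔ ⨆ j ∈ insert i S, Submodule.span ℚ (range (b j)) =
        D' ⊔ Submodule.span ℚ (range (b i)) := by
      rw [Finset.iSup_insert, hD', sup_comm (Submodule.span ℚ (range (b i))), sup_assoc]
    rw [hsup] at h
    have hfd : FiniteDimensional ℚ A := Module.Finite.iff_fg.2 hA
    have hA' : (A ⊓ D').FG := by
      rw [← Module.Finite.iff_fg]
      exact Submodule.finiteDimensional_of_le inf_le_left
    have h1 := ih (A ⊓ D') hA' inf_le_right
    have h2 : (finrank ℚ (A.map D'.mkQ) : ℕ∞) ≤ relRank (L i) (expHull e A) := by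
      set r := finrank ℚ (A.map D'.mkQ)
      let v := finBasis ℚ (A.map D'.mkQ)
      have ha : ∀ k : Fin r, ∃ a ∈ A, D'.mkQ a = v k := fun k => (v k).2
      choose a haA hav using ha
      have hq : ∀ k, ∃ d ∈ D', ∃ q : Fin (sz i) → ℚ, d + ∑ j, q j • b i j = a k := by
        intro k
        obtain ⟨d, hd, s, hs, hds⟩ := Submodule.mem_sup.1 (h (haA k))
        obtain ⟨q, rfl⟩ := (Submodule.mem_span_range_iff_exists_fun ℚ).1 hs
        exact ⟨d, hd, q, hds⟩
      choose d hd q hq using hq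
      choose N m hN hm using fun k => exists_intCast_mul_eq (q k)
      -- The integers `N k` clear denominators, so that the exponential of the block part is a
      -- monomial in the `e (b i j)`, not a root of one.
      have hw : ∀ k, ∑ j, (m k j : K) * b i j = (N k : K) * a k - (N k : K) * d k := by
        intro k
        rw [← mul_sub, ← hq k, add_sub_cancel_left, Finset.mul_sum]
        refine Finset.sum_congr rfl fun j _ => ?_
        have := congrArg (Rat.cast : ℚ → K) (hm k j)
        push_cast at this
        rw [this, Rat.smul_def, mul_assoc]
      have hNA : ∀ k, (N k : K) * a k ∈ A := fun k => by
        rw [← zsmul_eq_mul]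
        exact zsmul_mem (haA k) _
      have hND : ∀ k, (N k : K) * d k ∈ D' := fun k => by
        rw [← zsmul_eq_mul]
        exact zsmul_mem (hd k) _
      -- A relation among the rows `m k` would put a combination of the `N k * a k` into `D'`,
      -- although the `a k` form a basis modulo `D'`.
      have hli : LinearIndependent ℤ m := by
        rw [Fintype.linearIndependent_iff]
        intro c hc k
        have hvi := Fintype.linearIndependent_iff.1 v.linearIndependent
          (fun k => (c k : ℚ) * N k) ?_ k
        · have := mul_eq_zero.1 hvi
          simpa [hN k] using this
        · apply Subtype.ext
          have h3 : ∑ k, (c k : K) * ((N k : K) * a k) ∈ D' := by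
            have h4 : ∑ k, (c k : K) * ((N k : K) * a k) =
                ∑ k, (c k : K) * ((N k : K) * d k) := by
              rw [← sub_eq_zero, ← Finset.sum_sub_distrib]
              have h5 : ∀ k, (c k : K) * ((N k : K) * a k) - (c k : K) * ((N k : K) * d k) =
                  ∑ j, ((c k * m k j : ℤ) : K) * b i j := by
                intro k
                rw [← mul_sub, ← hw, Finset.mul_sum]
                refine Finset.sum_congr rfl fun j _ => ?_
                push_cast
                ring
              simp_rw [h5]
              rw [Finset.sum_comm]
              refine Finset.sum_eq_zero fun j _ => ?_
              rw [← Finset.sum_mul, ← Int.cast_sum]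
              have := congrFun hc j
              simp only [Finset.sum_apply, Pi.smul_apply, smul_eq_mul, Pi.zero_apply] at this
              rw [this, Int.cast_zero, zero_mul]
            rw [h4]
            refine sum_mem fun k _ => ?_
            rw [← zsmul_eq_mul]
            exact zsmul_mem (hND k) _
          rw [← Submodule.Quotient.mk_eq_zero, ← Submodule.mkQ_apply, map_sum] at h3
          rw [Submodule.coe_sum, Submodule.coe_zero, ← h3]
          refine Finset.sum_congr rfl fun k _ => ?_
          rw [Submodule.coe_smul, ← hav, ← map_smul, Rat.smul_def]
          congr 1
          push_cast
          ring
      refine (hind i r m hli).trans (relRank_mono ?_)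
      rw [expHull_subset_acl_iff]
      rintro _ ⟨k, rfl⟩
      dsimp only
      rw [hw]
      refine sub_mem ?_ ?_
      · refine (expHull_subset_acl_iff.1 ?_ : (A : Set K) ⊆ _) (hNA k)
        exact subset_union_right.trans (subset_acl _)
      · have := hD'L (hND k)
        exact ⟨acl_mono subset_union_left this.1, acl_mono subset_union_left this.2⟩
    have h3 := finrank_map_mkQ_le hA (le_sup_left : D ≤ D')
    calc (finrank ℚ (A.map D.mkQ) : ℕ∞)
        ≤ (finrank ℚ ((A ⊓ D').map D.mkQ) : ℕ∞) + (finrank ℚ (A.map D'.mkQ) : ℕ∞) := by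
          exact_mod_cast h3
      _ ≤ relRank (expHull e D) (expHull e (A ⊓ D' : Submodule ℚ K)) +
          relRank (L i) (expHull e A) := add_le_add h1 h2
      _ ≤ relRank (expHull e D) (expHull e (A ⊓ D' : Submodule ℚ K) ∪ expHull e A) := by
          refine relRank_add_le (union_subset ?_ ?_)
          · exact expHull_subset_acl_iff.2 (hD i)
          · exact expHull_subset_acl_iff.2 fun x hx => hD'L hx.2
      _ ≤ relRank (expHull e D) (expHull e A) := by
          refine relRank_mono (union_subset ?_ ?_)
          · exact (expHull_mono e fun x hx => hx.1).trans
              ((subset_acl _).trans (acl_mono subset_union_right))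
          · exact (subset_acl _).trans (acl_mono subset_union_right)

/-- A finitely generated subspace is a compact element of the lattice, so it already lies in the
span of `D` and finitely many blocks. -/
theorem isStrong_of_blocks {e : AddChar K K} {ι : Type*} {sz : ι → ℕ}
    {b : ∀ i, Fin (sz i) → K} {lvl : ι → ℕ} {L : ι → Set K} {D : Submodule ℚ K}
    (hD : ∀ i, D ≤ expCore e (L i))
    (hb : ∀ i j, j ≠ i → lvl j ≤ lvl i → ∀ k, b j k ∈ expCore e (L i))
    (hind : ∀ (i : ι) (r : ℕ) (m : Fin r → Fin (sz i) → ℤ), LinearIndependent ℤ m →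
      (r : ℕ∞) ≤ relRank (L i) (expHull e (range fun k => ∑ j, (m k j : K) * b i j)))
    (htop : D ⊔ ⨆ i, Submodule.span ℚ (range (b i)) = ⊤) : IsStrong e (D : Set K) := by
  rw [isStrong_iff]
  intro A hA
  rw [Submodule.span_eq]
  have hc : (⊤ : Submodule ℚ K) = ⨆ S : Finset ι, (D ⊔ ⨆ i ∈ S, Submodule.span ℚ (range (b i))) := by
    rw [← htop, iSup_eq_iSup_finset, sup_iSup]
  have hA' : IsCompactElement A := (Submodule.fg_iff_compact A).1 hA
  have hle : A ≤ ⨆ S : Finset ι, (D ⊔ ⨆ i ∈ S, Submodule.span ℚ (range (b i))) := hc ▸ le_top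
  have hdir : Directed (· ≤ ·)
      fun S : Finset ι => (D ⊔ ⨆ i ∈ S, Submodule.span ℚ (range (b i))) := by
    refine Monotone.directed_le fun S T h => sup_le_sup_left ?_ _
    exact biSup_mono fun i hi => h hi
  obtain ⟨_, ⟨S, rfl⟩, hS⟩ :=
    (CompleteLattice.isCompactElement_iff_le_of_directed_sSup_le _ _).1 hA' (range _)
      (range_nonempty _) hdir.directedOn_range hle
  exact finrank_map_mkQ_le_relRank_of_blocks hD hb hind S A hA hS

end Strong

end ExpFld

namespace ExpFld

/-! ### Derivations and the predimension of Khovanskii solutions -/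

open AlgebraicIndependent Set Module

/-- Enlarge `x` to a transcendence basis `t`. A derivation of `k[t]` into `K` may take any values on
the variables, and it extends to `K` because `K` is formally étale over `k[t]`: first localize, then
pass to an algebraic extension in characteristic zero. -/
theorem exists_derivation {k K ι : Type*} [Field k] [Field K] [CharZero k] [Algebra k K]
    {x : ι → K} (hx : AlgebraicIndependent k x) (v : ι → K) :
    ∃ D : Derivation k K K, ∀ i, D (x i) = v i := by
  obtain ⟨t, hxt, ht⟩ := exists_isTranscendenceBasis_superset hx.to_subtype_range
  obtain ⟨w, hw⟩ : ∃ w : K → K, ∀ i, w (x i) = v i :=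
    ⟨Function.extend x v 0, fun i => hx.injective.extend_apply _ _ _⟩
  let S := MvPolynomial t k
  let _ : Algebra S K := (MvPolynomial.aeval (R := k) (Subtype.val : t → K)).toAlgebra
  have _ : IsScalarTower k S K := IsScalarTower.of_algebraMap_eq fun c =>
    ((MvPolynomial.aeval (R := k) (Subtype.val : t → K)).commutes c).symm
  have hinj : Function.Injective (algebraMap S K) := ht.1
  have _ : FaithfulSMul S K := (faithfulSMul_iff_algebraMap_injective S K).2 hinj
  have hX : ∀ i : t, algebraMap S K (MvPolynomial.X i) = i := fun i =>
    MvPolynomial.aeval_X (R := k) (Subtype.val : t → K) i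
  have halg : Algebra.IsAlgebraic S K := by
    have h1 := ht.isAlgebraic
    constructor
    intro a
    let f := ht.1.aevalEquiv
    refine IsAlgebraic.of_ringHom_of_comp_eq (f := (f : S →+* _)) (g := RingHom.id K)
      (h1.isAlgebraic a) f.surjective Function.injective_id ?_
    ext <;> simp [f, S, RingHom.algebraMap_toAlgebra]
  let Q := FractionRing S
  let _ : Algebra Q K := FractionRing.liftAlgebra S K
  have _ : IsScalarTower S Q K := FractionRing.isScalarTower_liftAlgebra S K
  have _ : Algebra.IsAlgebraic Q K := Algebra.IsAlgebraic.extendScalars (R := S)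
    (IsFractionRing.injective S Q)
  have _ : CharZero Q := charZero_of_injective_algebraMap (R := k)
    (FaithfulSMul.algebraMap_injective k Q)
  have _ : Algebra.FormallyEtale S Q := Algebra.FormallyEtale.of_isLocalization (nonZeroDivisors S)
  have _ : Algebra.FormallyEtale Q K := Algebra.FormallyEtale.of_isSeparable Q K
  have _ : Algebra.FormallyEtale S K := Algebra.FormallyEtale.comp S Q K
  let d : Derivation k S K := MvPolynomial.mkDerivation k fun i : t => w i
  have hbc := KaehlerDifferential.isBaseChange_of_formallyEtale k S K
  let l := hbc.lift d.liftKaehlerDifferential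
  refine ⟨l.compDer (KaehlerDifferential.D k K), fun i => ?_⟩
  let i' : t := ⟨x i, hxt ⟨i, rfl⟩⟩
  have h1 : KaehlerDifferential.map k k S K (KaehlerDifferential.D k S (MvPolynomial.X i')) =
      KaehlerDifferential.D k K (x i) := by
    rw [KaehlerDifferential.map_D, hX]
  have h2 := hbc.lift_eq d.liftKaehlerDifferential (KaehlerDifferential.D k S (MvPolynomial.X i'))
  rw [h1, Derivation.liftKaehlerDifferential_comp_D] at h2
  change l (KaehlerDifferential.D k K (x i)) = _
  rw [h2, MvPolynomial.mkDerivation_X]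
  exact hw i

section ExpDerivation

variable {K : Type u} [Field K] [CharZero K] {k : IntermediateField ℚ K}

/-- The defect `D(e x) / e x - D x` of a derivation `D` from being an exponential derivation. -/
noncomputable def expDefect (e : AddChar K K) (D : Derivation k K K) : K →ₗ[ℚ] K :=
  AddMonoidHom.toRatLinearMap
    { toFun := fun x => D (e x) / e x - D x
      map_zero' := by simp
      map_add' := by
        intro x y
        have hx := addChar_ne_zero e x
        have hy := addChar_ne_zero e y
        simp only [AddChar.map_add_eq_mul, Derivation.leibniz, map_add, smul_eq_mul]
        field_simp
        ring }

theorem expDefect_apply (e : AddChar K K) (D : Derivation k K K) (x : K) :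
    expDefect e D x = D (e x) / e x - D x := rfl

/-- The chain rule with `D (e a_j)` rewritten as `e a_j` times `D a_j` plus the defect: the first
sum is the Jacobian appearing in `ecl`, the second measures how far `D` is from respecting the
exponential. -/
theorem derivation_aeval_expPoint {e : AddChar K K} {n : ℕ} {k' : IntermediateField ℚ K}
    (D : Derivation k K K) (hD : ∀ c : k', D c = 0) (p : MvPolynomial (Fin n ⊕ Fin n) k')
    (a : Fin n → K) :
    D (MvPolynomial.aeval (expPoint e a) p) =
      ∑ j, expPderiv e p j a * D (a j) +
      ∑ j, e (a j) * MvPolynomial.aeval (expPoint e a) (MvPolynomial.pderiv (Sum.inr j) p) *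
        expDefect e D (a j) := by
  have h1 : D (MvPolynomial.aeval (expPoint e a) p) =
      ∑ i, MvPolynomial.aeval (expPoint e a) (MvPolynomial.pderiv i p) * D (expPoint e a i) := by
    induction p using MvPolynomial.induction_on with
    | C c => simp [hD c]
    | add p q hp hq => simp only [map_add, hp, hq, add_mul, Finset.sum_add_distrib]
    | mul_X p i hp =>
      simp only [map_mul, Derivation.leibniz, hp, MvPolynomial.aeval_X, smul_eq_mul,
        MvPolynomial.pderiv_X, map_add, add_mul, Finset.sum_add_distrib, Finset.mul_sum]
      congr 1
      · rw [Finset.sum_eq_single i]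
        · simp
        · intro j _ hj
          simp [hj.symm]
        · simp
      · exact Finset.sum_congr rfl fun j _ => by ring
  rw [h1, Fintype.sum_sum_type, ← Finset.sum_add_distrib, ← Finset.sum_add_distrib]
  refine Finset.sum_congr rfl fun j _ => ?_
  have := addChar_ne_zero e (a j)
  simp only [expPoint, Sum.elim_inl, Sum.elim_inr, expPderiv, expDefect_apply]
  field_simp
  ring

end ExpDerivation

/-- If `b` is in the exponential algebraic closure of `C` then `b` extends to a finite tuple of
nonpositive predimension over `C`. -/
theorem exists_relRank_le_of_mem_ecl {K : Type u} [Field K] [CharZero K] {e : AddChar K K}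
    {C : Set K} {b : K} (hb : b ∈ ecl e C) {X : Set K} (hCX : C ⊆ X) :
    ∃ A : Submodule ℚ K, A.FG ∧ b ∈ A ∧
      relRank (expHull e X) (expHull e A) ≤ finrank ℚ (A.map (Submodule.span ℚ X).mkQ) := by
  classical
  obtain ⟨n, a, p, rfl, hp, hdet⟩ := hb
  refine ⟨Submodule.span ℚ (range a), Submodule.fg_span (finite_range a),
    Submodule.subset_span ⟨0, rfl⟩, ?_⟩
  set A := Submodule.span ℚ (range a) with hA
  have h0 : relRank (expHull e X) (expHull e A) ≤ relRank (expHull e X) (expHull e (range a)) :=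
    relRank_mono ((expHull_span_subset_acl e _).trans (acl_mono subset_union_right))
  refine h0.trans (Matroid.eRk_le_iff.2 fun I hIa hI => ?_)
  rw [contract_indep_iff] at hI
  have hIf : I.Finite := ((finite_range a).union ((finite_range a).image e)).subset hIa
  have _ := hIf.fintype
  set k := IntermediateField.adjoin ℚ (expHull e X) with hk
  -- Derivations dual to the independent set `I`, all vanishing on `X` and on its exponentials.
  have hD : ∀ i : I, ∃ D : Derivation k K K, ∀ j : I, D j = if i = j then 1 else 0 := fun i =>
    exists_derivation hI fun j => if i = j then 1 else 0
  choose D hD using hD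
  have hfd : FiniteDimensional ℚ (A.map (Submodule.span ℚ X).mkQ) :=
    Module.Finite.iff_fg.2 ((Submodule.fg_span (finite_range a)).map _)
  set r := finrank ℚ (A.map (Submodule.span ℚ X).mkQ) with hr
  let v : Basis (Fin r) ℚ _ := finBasis ℚ (A.map (Submodule.span ℚ X).mkQ)
  have ht : ∀ l, ∃ t ∈ A, (Submodule.span ℚ X).mkQ t = v l := fun l => (v l).2
  choose t _ ht using ht
  -- A combination of the dual derivations is sent to its defects at a basis of `A` modulo the span
  -- of `X`. Injectivity of `Φ` bounds the size of `I` by `r`.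
  let Φ : (I → K) →ₗ[K] (Fin r → K) :=
    { toFun := fun c l => ∑ i, c i * expDefect e (D i) (t l)
      map_add' := fun c c' => by
        ext l
        simp [add_mul, Finset.sum_add_distrib]
      map_smul' := fun s c => by
        ext l
        simp [Finset.mul_sum, mul_assoc] }
  have hΦ : Function.Injective Φ := by
    rw [← LinearMap.ker_eq_bot, LinearMap.ker_eq_bot']
    intro c hc
    let E : Derivation k K K := ∑ i, c i • D i
    have hE : ∀ x, E x = ∑ i, c i * D i x := fun x => by
      have h1 : ⇑E = ∑ i, ⇑(c i • D i) := map_sum Derivation.coeFnAddMonoidHom _ _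
      simp [h1]
    have hEd : ∀ x, expDefect e E x = ∑ i, c i * expDefect e (D i) x := fun x => by
      simp only [expDefect_apply, hE, Finset.sum_div, ← Finset.sum_sub_distrib]
      exact Finset.sum_congr rfl fun i _ => by ring
    have hX0 : Submodule.span ℚ X ≤ LinearMap.ker (expDefect e E) := by
      refine Submodule.span_le.2 fun x hx => ?_
      have h1 : E x = 0 := E.map_algebraMap
        (⟨x, IntermediateField.subset_adjoin ℚ _ (Or.inl hx)⟩ : k)
      have h2 : E (e x) = 0 := E.map_algebraMap
        (⟨e x, IntermediateField.subset_adjoin ℚ _ (Or.inr ⟨x, hx, rfl⟩)⟩ : k)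
      simp [expDefect_apply, h1, h2]
    have ht0 : ∀ l, expDefect e E (t l) = 0 := fun l => by
      rw [hEd]
      exact congrFun hc l
    have ha0 : ∀ j, expDefect e E (a j) = 0 := by
      intro j
      let f := (Submodule.span ℚ X).liftQ (expDefect e E) hX0
      let g := f.domRestrict (A.map (Submodule.span ℚ X).mkQ)
      have hg : g = 0 := by
        refine v.ext fun l => ?_
        change f (v l) = 0
        rw [← ht]
        exact ht0 l
      have := LinearMap.congr_fun hg
        ⟨_, Submodule.mem_map_of_mem (Submodule.subset_span (mem_range_self j))⟩
      exact this
    -- With no defect at the `a j`, differentiating the system leaves the Jacobian matrix applied to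
    -- `(E (a j))`, and this matrix is invertible.
    have hEa : ∀ j, E (a j) = 0 := by
      have hmul : (Matrix.of fun i j => expPderiv e (p i) j a).mulVec (fun j => E (a j)) = 0 := by
        ext i
        have h1 := derivation_aeval_expPoint (e := e) E (k' := IntermediateField.adjoin ℚ C)
          (fun c => ?_) (p i) a
        · rw [hp i, map_zero] at h1
          simp only [ha0, mul_zero, Finset.sum_const_zero, add_zero] at h1
          simpa [Matrix.mulVec, dotProduct] using h1.symm
        · have hle : IntermediateField.adjoin ℚ C ≤ k :=
            IntermediateField.adjoin.mono _ _ _ (hCX.trans subset_union_left)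
          exact E.map_algebraMap (⟨c, hle c.2⟩ : k)
      exact congrFun (Matrix.eq_zero_of_mulVec_eq_zero hdet hmul)
    have hEe : ∀ j, E (e (a j)) = 0 := by
      intro j
      have := ha0 j
      rw [expDefect_apply, hEa, sub_zero, div_eq_zero_iff] at this
      exact this.resolve_right (addChar_ne_zero e _)
    ext i
    have h1 : E i = 0 := by
      rcases hIa i.2 with ⟨j, hj⟩ | ⟨_, ⟨j, rfl⟩, hj⟩
      · rw [← hj]
        exact hEa j
      · rw [← hj]
        exact hEe j
    rw [hE] at h1
    simpa [hD] using h1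
  have := LinearMap.finrank_le_finrank_of_injective hΦ
  rw [finrank_fintype_fun_eq_card, finrank_fintype_fun_eq_card, Fintype.card_fin] at this
  rw [← hIf.cast_ncard_eq, ← Nat.card_coe_set_eq, Nat.card_eq_fintype_card]
  exact_mod_cast this

end ExpFld

namespace ExpFld

open AlgebraicIndependent Set Module

/-! ### Generic points with coordinates in a small field -/

section GenericPoint

variable {k K : Type*} [Field k] [Field K] [Algebra k K] {σ : Type*}

/-- A `k`-linear functional on `K`, applied to the coefficients of a polynomial over `K`. -/
noncomputable def mapFunctional (l : K →ₗ[k] k) : MvPolynomial σ K →+ MvPolynomial σ k where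
  toFun p := ∑ d ∈ p.support, MvPolynomial.monomial d (l (p.coeff d))
  map_zero' := by simp
  map_add' p q := by
    classical
    have h : ∀ p : MvPolynomial σ K, ∀ d, MvPolynomial.coeff d
        (∑ d ∈ p.support, MvPolynomial.monomial d (l (p.coeff d))) = l (p.coeff d) := by
      intro p d
      simp only [MvPolynomial.coeff_sum, MvPolynomial.coeff_monomial, Finset.sum_ite_eq',
        MvPolynomial.mem_support_iff]
      split_ifs with h
      · rfl
      · rw [not_not.1 h, map_zero]
    ext d
    rw [MvPolynomial.coeff_add, h, h, h, MvPolynomial.coeff_add, map_add]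

theorem coeff_mapFunctional (l : K →ₗ[k] k) (p : MvPolynomial σ K) (d : σ →₀ ℕ) :
    (mapFunctional l p).coeff d = l (p.coeff d) := by
  classical
  change MvPolynomial.coeff d (∑ d ∈ p.support, MvPolynomial.monomial d (l (p.coeff d))) = _
  simp only [MvPolynomial.coeff_sum, MvPolynomial.coeff_monomial, Finset.sum_ite_eq',
    MvPolynomial.mem_support_iff]
  split_ifs with h
  · rfl
  · rw [not_not.1 h, map_zero]

theorem mapFunctional_monomial (l : K →ₗ[k] k) (d : σ →₀ ℕ) (c : K) :
    mapFunctional l (MvPolynomial.monomial d c) = MvPolynomial.monomial d (l c) := by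
  classical
  ext d'
  simp only [coeff_mapFunctional, MvPolynomial.coeff_monomial]
  split_ifs <;> simp

theorem mapFunctional_mul_map (l : K →ₗ[k] k) (p : MvPolynomial σ K) (q : MvPolynomial σ k) :
    mapFunctional l (p * MvPolynomial.map (algebraMap k K) q) = mapFunctional l p * q := by
  classical
  ext d
  simp only [coeff_mapFunctional, MvPolynomial.coeff_mul, map_sum, MvPolynomial.coeff_map]
  refine Finset.sum_congr rfl fun x _ => ?_
  rw [mul_comm, ← Algebra.smul_def, map_smul, smul_eq_mul, mul_comm]

theorem mapFunctional_rename {τ : Type*} (l : K →ₗ[k] k) (g : τ → σ) (p : MvPolynomial τ K) :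
    mapFunctional l (MvPolynomial.rename g p) = MvPolynomial.rename g (mapFunctional l p) := by
  induction p using MvPolynomial.induction_on' with
  | monomial d c =>
    rw [MvPolynomial.rename_monomial, mapFunctional_monomial, mapFunctional_monomial,
      MvPolynomial.rename_monomial]
  | add p q hp hq => simp only [map_add, hp, hq]

/-- On a product `q * g` with `g` over `k`, the functional acts on the coefficients of `q` only.
Hence it carries the extension to `K` of an ideal over `k` back into that ideal, which replaces an
argument by linear disjointness. -/
theorem mapFunctional_mem_span (l : K →ₗ[k] k) {S : Set (MvPolynomial σ k)} {p : MvPolynomial σ K}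
    (hp : p ∈ Ideal.span (MvPolynomial.map (algebraMap k K) '' S)) :
    mapFunctional l p ∈ Ideal.span S := by
  have : ∀ q, mapFunctional l (q * p) ∈ Ideal.span S := by
    induction hp using Submodule.span_induction with
    | mem p hp =>
      obtain ⟨g, hg, rfl⟩ := hp
      intro q
      rw [mapFunctional_mul_map]
      exact Ideal.mul_mem_left _ _ (Ideal.subset_span hg)
    | zero => simp
    | add p p' _ _ h h' =>
      intro q
      rw [mul_add, map_add]
      exact add_mem (h q) (h' q)
    | smul a p _ h =>
      intro q
      rw [smul_eq_mul, ← mul_assoc]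
      exact h _
  simpa using this 1

/-- Generic points over a large subfield `L` of irreducible affine varieties defined over a small
subfield `k`, with coordinates algebraic over `k` and given elements independent over `L`. -/
theorem exists_generic_point {L : Type*} [Field L] [Algebra k L] [Algebra L K]
    [IsScalarTower k L K] [IsAlgClosed K] [Finite σ] {P : Ideal (MvPolynomial σ K)} [P.IsPrime]
    {S : Set (MvPolynomial σ k)} (hP : P = Ideal.span (MvPolynomial.map (algebraMap k K) '' S))
    {τ : ℕ → K} (hτ : AlgebraicIndependent L τ) :
    ∃ p : σ → K, (∀ i, IsAlgebraic (Algebra.adjoin k (range τ)) (p i)) ∧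
      (∀ f : MvPolynomial σ L, MvPolynomial.aeval p f = 0 →
        MvPolynomial.map (algebraMap L K) f ∈ P) ∧
      ∀ f ∈ P, MvPolynomial.aeval p f = 0 := by
  let PL := P.comap (MvPolynomial.map (σ := σ) (algebraMap L K))
  let R := MvPolynomial σ L ⧸ PL
  have _ : IsDomain R := Ideal.Quotient.isDomain PL
  let x : σ → R := fun i => Ideal.Quotient.mk PL (MvPolynomial.X i)
  have hxL : ∀ f : MvPolynomial σ L, MvPolynomial.aeval x f = Ideal.Quotient.mk PL f := by
    intro f
    have : MvPolynomial.aeval x = Ideal.Quotient.mkₐ L PL := by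
      ext i
      rw [MvPolynomial.aeval_X]
      rfl
    rw [this]
    rfl
  have hxk : ∀ f : MvPolynomial σ k, MvPolynomial.aeval x f =
      Ideal.Quotient.mk PL (MvPolynomial.map (algebraMap k L) f) := by
    intro f
    rw [← hxL, MvPolynomial.aeval_map_algebraMap]
  -- A basis over the small field `k`, chosen among the coordinates, so that all coordinates are
  -- algebraic over `k[B]` and not merely over `L[B]`.
  obtain ⟨B, hB⟩ := (matroid k R).exists_isBasis (range x) (subset_univ _)
  obtain ⟨hBk, hBx, hBalg⟩ := matroid_isBasis_iff.1 hB
  have hBx' : ∀ b : B, ∃ i, x i = b := fun b => hBx b.2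
  choose ν hν using hBx'
  have hνB : (Subtype.val : B → R) = x ∘ ν := funext fun b => (hν b).symm
  -- Apply `k`-linear functionals of `K` to the coefficients of a relation over `L`. As `P` is
  -- generated over `k`, each image is a relation over `k`, hence trivial, and functionals separate
  -- the coefficients.
  have hBL : AlgebraicIndependent L (Subtype.val : B → R) := by
    rw [algebraicIndependent_iff]
    intro f hf
    rw [hνB, ← MvPolynomial.aeval_rename, hxL, Ideal.Quotient.eq_zero_iff_mem, Ideal.mem_comap,
      MvPolynomial.map_rename] at hf
    have hzero : ∀ l : K →ₗ[k] k, mapFunctional l (MvPolynomial.map (algebraMap L K) f) = 0 := by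
      intro l
      have h1 := mapFunctional_mem_span l (hP ▸ hf)
      rw [mapFunctional_rename] at h1
      have h2 : ∀ g ∈ Ideal.span S, MvPolynomial.aeval x g = 0 := by
        intro g hg
        rw [hxk, Ideal.Quotient.eq_zero_iff_mem, Ideal.mem_comap, MvPolynomial.map_map,
          ← IsScalarTower.algebraMap_eq, hP, ← Ideal.map_span]
        exact Ideal.mem_map_of_mem _ hg
      have h3 := h2 _ h1
      rw [MvPolynomial.aeval_rename, ← hνB] at h3
      exact (algebraicIndependent_iff.1 hBk) _ h3
    have hmap : MvPolynomial.map (algebraMap L K) f = 0 := by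
      ext d
      rw [MvPolynomial.coeff_zero, ← Module.forall_dual_apply_eq_zero_iff k]
      intro l
      rw [← coeff_mapFunctional, hzero, MvPolynomial.coeff_zero]
    exact MvPolynomial.map_injective _ (algebraMap L K).injective (by rw [hmap, map_zero])
  have _ : Finite B := (finite_range x).subset hBx
  obtain ⟨ε, hε⟩ := exists_injective_nat B
  have hτ' : AlgebraicIndependent L (τ ∘ ε) := hτ.comp ε hε
  let Q := MvPolynomial B L
  let _ : Algebra Q R := (MvPolynomial.aeval (R := L) (Subtype.val : B → R)).toAlgebra
  let _ : Algebra Q K := (MvPolynomial.aeval (R := L) (τ ∘ ε)).toAlgebra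
  have _ : IsScalarTower L Q R := IsScalarTower.of_algebraMap_eq fun c =>
    ((MvPolynomial.aeval (R := L) (Subtype.val : B → R)).commutes c).symm
  have _ : IsScalarTower L Q K := IsScalarTower.of_algebraMap_eq fun c =>
    ((MvPolynomial.aeval (R := L) (τ ∘ ε)).commutes c).symm
  have _ : FaithfulSMul Q R := (faithfulSMul_iff_algebraMap_injective Q R).2 hBL
  have _ : FaithfulSMul Q K := (faithfulSMul_iff_algebraMap_injective Q K).2 hτ'
  have hQR : ∀ b : B, algebraMap Q R (MvPolynomial.X b) = b := fun b =>
    MvPolynomial.aeval_X (R := L) (Subtype.val : B → R) b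
  have hQK : ∀ b : B, algebraMap Q K (MvPolynomial.X b) = τ (ε b) := fun b =>
    MvPolynomial.aeval_X (R := L) (τ ∘ ε) b
  have hadj : ∀ y ∈ Algebra.adjoin k B, y ∈ (IsScalarTower.toAlgHom L Q R).range := by
    intro y hy
    induction hy using Algebra.adjoin_induction with
    | mem y hy => exact ⟨MvPolynomial.X ⟨y, hy⟩, hQR ⟨y, hy⟩⟩
    | algebraMap c =>
      rw [IsScalarTower.algebraMap_apply k L R]
      exact Subalgebra.algebraMap_mem _ _
    | add _ _ _ _ h h' => exact add_mem h h'
    | mul _ _ _ _ h h' => exact mul_mem h h'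
  have hxalg : ∀ i, IsAlgebraic Q (x i) := by
    intro i
    have h1 := hBalg (x i) ⟨i, rfl⟩
    let f : Algebra.adjoin k B →+* (IsScalarTower.toAlgHom L Q R).range :=
      { toFun := fun y => ⟨y, hadj y y.2⟩
        map_one' := rfl
        map_mul' := fun _ _ => rfl
        map_zero' := rfl
        map_add' := fun _ _ => rfl }
    have hf : Function.Injective f := by
      intro a b h
      have := congrArg Subtype.val h
      exact Subtype.ext this
    have h2 : IsAlgebraic (IsScalarTower.toAlgHom L Q R).range (x i) :=
      h1.ringHom_of_comp_eq f (RingHom.id R) hf rfl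
    let e := (AlgEquiv.ofInjective (IsScalarTower.toAlgHom L Q R) hBL)
    exact IsAlgebraic.of_ringHom_of_comp_eq (f := (e : Q →+* _)) (g := RingHom.id R) h2
      e.surjective Function.injective_id rfl
  have _ : Algebra.IsAlgebraic Q R := by
    constructor
    intro y
    obtain ⟨f, rfl⟩ := Ideal.Quotient.mk_surjective y
    rw [← hxL, ← Subalgebra.mem_algebraicClosure]
    have : Algebra.adjoin L (range x) ≤ (Subalgebra.algebraicClosure Q R).restrictScalars L := by
      refine Algebra.adjoin_le ?_
      rintro _ ⟨i, rfl⟩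
      exact hxalg i
    refine this ?_
    rw [Algebra.adjoin_range_eq_range_aeval]
    exact ⟨f, rfl⟩
  -- The basis `B` is sent to distinct members of `τ`, and `R` is algebraic over `L[B]`. Injectivity
  -- follows since a nonzero algebraic element divides a nonzero element of `Q`.
  let φ : R →ₐ[Q] K := IsAlgClosed.lift
  have hφ : Function.Injective φ := by
    rw [injective_iff_map_eq_zero]
    intro y hy
    by_contra hne
    obtain ⟨r, hr, s, hs⟩ := (Algebra.IsAlgebraic.isAlgebraic (R := Q) y).exists_nonzero_dvd
      (mem_nonZeroDivisors_of_ne_zero hne)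
    refine hr (FaithfulSMul.algebraMap_injective Q K ?_)
    rw [← φ.commutes, hs, map_mul, hy, zero_mul, map_zero]
  let φL : R →ₐ[L] K := φ.restrictScalars L
  have hφL : ∀ f : MvPolynomial σ L, MvPolynomial.aeval (fun i => φ (x i)) f =
      φ (Ideal.Quotient.mk PL f) := by
    intro f
    rw [← hxL]
    exact (MvPolynomial.comp_aeval_apply (φ := φL) x f).symm
  refine ⟨fun i => φ (x i), fun i => ?_, fun f hf => ?_, fun f hf => ?_⟩
  · let φk : R →ₐ[k] K := φL.restrictScalars k
    have hsub : ∀ y ∈ Algebra.adjoin k B, φ y ∈ Algebra.adjoin k (range τ) := by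
      intro y hy
      have : φk y ∈ (Algebra.adjoin k B).map φk := ⟨y, hy, rfl⟩
      rw [AlgHom.map_adjoin] at this
      refine Algebra.adjoin_mono ?_ this
      rintro _ ⟨b, hb, rfl⟩
      refine ⟨ε ⟨b, hb⟩, ?_⟩
      rw [← hQK, ← φ.commutes, hQR]
      rfl
    let f : Algebra.adjoin k B →+* Algebra.adjoin k (range τ) :=
      { toFun := fun y => ⟨φ y, hsub y y.2⟩
        map_one' := Subtype.ext (map_one φ)
        map_mul' := fun _ _ => Subtype.ext (map_mul φ _ _)
        map_zero' := Subtype.ext (map_zero φ)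
        map_add' := fun _ _ => Subtype.ext (map_add φ _ _) }
    exact (hBalg (x i) ⟨i, rfl⟩).ringHom_of_comp_eq f (φ : R →+* K)
      (fun a b h => Subtype.ext (hφ (congrArg Subtype.val h))) rfl
  · rw [hφL] at hf
    have h1 : Ideal.Quotient.mk PL f = 0 := hφ (hf.trans (map_zero φ).symm)
    exact Ideal.mem_comap.1 (Ideal.Quotient.eq_zero_iff_mem.1 h1)
  · rw [hP] at hf
    induction hf using Submodule.span_induction with
    | mem f hf =>
      obtain ⟨g, hg, rfl⟩ := hf
      rw [MvPolynomial.aeval_map_algebraMap, ← MvPolynomial.aeval_map_algebraMap L, hφL]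
      rw [Ideal.Quotient.eq_zero_iff_mem.2, map_zero]
      rw [Ideal.mem_comap, MvPolynomial.map_map, ← IsScalarTower.algebraMap_eq, hP]
      exact Ideal.subset_span ⟨g, hg, rfl⟩
    | zero => simp
    | add _ _ _ _ h h' => rw [map_add, h, h', add_zero]
    | smul a _ _ h => rw [smul_eq_mul, map_mul, h, mul_zero]

end GenericPoint

end ExpFld

namespace ExpFld

open AlgebraicIndependent Set Module

/-! ### Generic points of rotund and free subvarieties -/

section Varieties

variable {K : Type u} [Field K]

theorem IsIrredSubvariety.nonempty {n : ℕ} {V : Set (Fin n ⊕ Fin n → K)}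
    (hV : IsIrredSubvariety V) : V.Nonempty := by
  by_contra h
  rw [not_nonempty_iff_eq_empty] at h
  subst h
  exact hV.2.ne_top (by rw [eq_top_iff]; intro f _ p hp; exact hp.elim)

theorem IsIrredSubvariety.inr_ne_zero {n : ℕ} {V : Set (Fin n ⊕ Fin n → K)}
    (hV : IsIrredSubvariety V) {p : Fin n ⊕ Fin n → K} (hp : p ∈ V) (i : Fin n) :
    p (Sum.inr i) ≠ 0 := by
  obtain ⟨⟨I, rfl⟩, -⟩ := hV
  exact hp.1 i

theorem IsIrredSubvariety.mem_iff {n : ℕ} {V : Set (Fin n ⊕ Fin n → K)}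
    (hV : IsIrredSubvariety V) {p : Fin n ⊕ Fin n → K} :
    p ∈ V ↔ (∀ i, p (Sum.inr i) ≠ 0) ∧
      ∀ f ∈ MvPolynomial.vanishingIdeal K V, MvPolynomial.aeval p f = 0 := by
  constructor
  · intro h
    exact ⟨hV.inr_ne_zero h, fun f hf => hf p h⟩
  · rintro ⟨h1, h2⟩
    obtain ⟨⟨I, hI⟩, -⟩ := id hV
    rw [hI]
    refine ⟨h1, fun f hf => h2 f fun q hq => ?_⟩
    rw [hI] at hq
    exact hq.2 f hf

theorem zpow_eq_pow_toNat_div {y : K} (hy : y ≠ 0) (m : ℤ) :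
    y ^ m = y ^ m.toNat / y ^ (-m).toNat := by
  rw [← zpow_natCast, ← zpow_natCast, ← zpow_sub₀ hy]
  congr 1
  omega

/-- Composition of a polynomial with the action of an integer matrix on `Gⁿ`, after clearing
denominators. -/
theorem exists_aeval_matAct_eq {k : Type*} [Field k] [Algebra k K] {n : ℕ}
    (M : Matrix (Fin n) (Fin n) ℤ) (g : MvPolynomial (Fin n ⊕ Fin n) k) :
    ∃ f h : MvPolynomial (Fin n ⊕ Fin n) k, ∀ v : Fin n ⊕ Fin n → K,
      (∀ i, v (Sum.inr i) ≠ 0) → MvPolynomial.aeval v h ≠ 0 ∧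
        MvPolynomial.aeval v f = MvPolynomial.aeval v h * MvPolynomial.aeval (matAct M v) g := by
  induction g using MvPolynomial.induction_on with
  | C c => exact ⟨MvPolynomial.C c, 1, fun v _ => by simp⟩
  | add g g' hg hg' =>
    obtain ⟨f, h, hf⟩ := hg
    obtain ⟨f', h', hf'⟩ := hg'
    refine ⟨f * h' + f' * h, h * h', fun v hv => ⟨?_, ?_⟩⟩
    · rw [map_mul]
      exact mul_ne_zero (hf v hv).1 (hf' v hv).1
    · simp only [map_add, map_mul, (hf v hv).2, (hf' v hv).2]
      ring
  | mul_X g i hg =>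
    obtain ⟨f, h, hf⟩ := hg
    rcases i with i | i
    · refine ⟨f * ∑ j, MvPolynomial.C (M i j : k) * MvPolynomial.X (Sum.inl j), h,
        fun v hv => ⟨(hf v hv).1, ?_⟩⟩
      simp only [map_mul, (hf v hv).2, map_sum, MvPolynomial.aeval_X, matAct, Sum.elim_inl,
        map_intCast]
      ring
    · refine ⟨f * ∏ j, MvPolynomial.X (Sum.inr j) ^ (M i j).toNat,
        h * ∏ j, MvPolynomial.X (Sum.inr j) ^ (-M i j).toNat, fun v hv => ?_⟩
      have h1 : ∏ j, v (Sum.inr j) ^ (-M i j).toNat ≠ 0 :=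
        Finset.prod_ne_zero_iff.2 fun j _ => pow_ne_zero _ (hv j)
      constructor
      · simp only [map_mul, map_prod, map_pow, MvPolynomial.aeval_X]
        exact mul_ne_zero (hf v hv).1 h1
      · simp only [map_mul, (hf v hv).2, map_prod, map_pow, MvPolynomial.aeval_X, matAct,
          Sum.elim_inr]
        have h2 : ∏ j, v (Sum.inr j) ^ M i j =
            (∏ j, v (Sum.inr j) ^ (M i j).toNat) / ∏ j, v (Sum.inr j) ^ (-M i j).toNat := by
          rw [← Finset.prod_div_distrib]
          exact Finset.prod_congr rfl fun j _ => zpow_eq_pow_toNat_div (hv j) _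
        rw [h2]
        field_simp

/-- After clearing denominators that vanish nowhere on `V`, a polynomial vanishes on `M · V` exactly
when its pullback vanishes on `V`; primality is thus inherited. -/
theorem IsIrredSubvariety.isPrime_vanishingIdeal_matAct {n : ℕ} {V : Set (Fin n ⊕ Fin n → K)}
    (hV : IsIrredSubvariety V) (M : Matrix (Fin n) (Fin n) ℤ) :
    (MvPolynomial.vanishingIdeal K (matAct M '' V)).IsPrime := by
  have key : ∀ g f h : MvPolynomial (Fin n ⊕ Fin n) K, (∀ v : Fin n ⊕ Fin n → K,
      (∀ i, v (Sum.inr i) ≠ 0) → MvPolynomial.aeval v h ≠ 0 ∧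
        MvPolynomial.aeval v f = MvPolynomial.aeval v h * MvPolynomial.aeval (matAct M v) g) →
      (g ∈ MvPolynomial.vanishingIdeal K (matAct M '' V) ↔
        f ∈ MvPolynomial.vanishingIdeal K V) := by
    intro g f h hfh
    constructor
    · intro hg v hv
      rw [(hfh v (hV.inr_ne_zero hv)).2, hg _ ⟨v, hv, rfl⟩, mul_zero]
    · rintro hf _ ⟨v, hv, rfl⟩
      have h1 := hf v hv
      have h2 := hfh v (hV.inr_ne_zero hv)
      rw [h2.2] at h1
      exact (mul_eq_zero.1 h1).resolve_left h2.1
  constructor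
  · intro h
    obtain ⟨v, hv⟩ := hV.nonempty
    have h1 : (1 : MvPolynomial (Fin n ⊕ Fin n) K) ∈
        MvPolynomial.vanishingIdeal K (matAct M '' V) := h ▸ Submodule.mem_top
    simpa using h1 _ ⟨v, hv, rfl⟩
  · intro g g' hgg
    obtain ⟨f, h, hf⟩ := exists_aeval_matAct_eq (K := K) M g
    obtain ⟨f', h', hf'⟩ := exists_aeval_matAct_eq (K := K) M g'
    have h1 := (key (g * g') (f * f') (h * h') fun v hv => ⟨?_, ?_⟩).1 hgg
    · rcases hV.2.mem_or_mem h1 with h2 | h2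
      · exact Or.inl ((key g f h hf).2 h2)
      · exact Or.inr ((key g' f' h' hf').2 h2)
    · rw [map_mul]
      exact mul_ne_zero (hf v hv).1 (hf' v hv).1
    · rw [map_mul, map_mul, map_mul, (hf v hv).2, (hf' v hv).2]
      ring

variable [CharZero K]

theorem IsGenericIn.mono {n : ℕ} {p : Fin n ⊕ Fin n → K} {V : Set (Fin n ⊕ Fin n → K)}
    {A A' : Set K} (h : IsGenericIn p V A')
    (hA : A ⊆ IntermediateField.adjoin ℚ A') : IsGenericIn p V A := by
  refine ⟨h.1, fun f hf v hv => ?_⟩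
  have hle : IntermediateField.adjoin ℚ A ≤ IntermediateField.adjoin ℚ A' :=
    IntermediateField.adjoin_le_iff.2 hA
  let _ : Algebra (IntermediateField.adjoin ℚ A) (IntermediateField.adjoin ℚ A') :=
    (IntermediateField.inclusion hle).toAlgebra
  have _ : IsScalarTower (IntermediateField.adjoin ℚ A) (IntermediateField.adjoin ℚ A') K :=
    .of_algebraMap_eq fun _ => rfl
  have h1 := h.2 (MvPolynomial.map (algebraMap _ _) f)
    (by rw [MvPolynomial.aeval_map_algebraMap, hf]) v hv
  rwa [MvPolynomial.aeval_map_algebraMap] at h1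

theorem mem_acl_of_isAlgebraic_adjoin {k : IntermediateField ℚ K} {T : Set K} {y : K}
    (h : IsAlgebraic (Algebra.adjoin k T) y) : y ∈ acl (k ∪ T) := by
  have hsub : ∀ x ∈ Algebra.adjoin k T, x ∈ IntermediateField.adjoin ℚ (k ∪ T : Set K) := by
    intro x hx
    induction hx using Algebra.adjoin_induction with
    | mem x hx => exact IntermediateField.subset_adjoin ℚ _ (Or.inr hx)
    | algebraMap c => exact IntermediateField.subset_adjoin ℚ _ (Or.inl c.2)
    | add _ _ _ _ h h' => exact add_mem h h'
    | mul _ _ _ _ h h' => exact mul_mem h h'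
  let f : Algebra.adjoin k T →+* IntermediateField.adjoin ℚ (k ∪ T : Set K) :=
    { toFun := fun x => ⟨x, hsub x x.2⟩
      map_one' := rfl
      map_mul' := fun _ _ => rfl
      map_zero' := rfl
      map_add' := fun _ _ => rfl }
  have hf : Function.Injective f := by
    intro a b h
    have := congrArg Subtype.val h
    exact Subtype.ext this
  rw [mem_acl]
  exact h.ringHom_of_comp_eq f (RingHom.id K) hf rfl

theorem exists_isGenericIn [IsAlgClosed K] {n : ℕ} {V : Set (Fin n ⊕ Fin n → K)}
    (hV : IsIrredSubvariety V) {k L : IntermediateField ℚ K} (hkL : k ≤ L)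
    {S : Set (MvPolynomial (Fin n ⊕ Fin n) k)}
    (hS : MvPolynomial.vanishingIdeal K V = Ideal.span (MvPolynomial.map (algebraMap k K) '' S))
    {τ : ℕ → K} (hτ : AlgebraicIndependent L τ) :
    ∃ p, IsGenericIn p V (L : Set K) ∧ ∀ i, p i ∈ acl (k ∪ range τ) := by
  let _ : Algebra k L := (IntermediateField.inclusion hkL).toAlgebra
  have _ : IsScalarTower k L K := .of_algebraMap_eq fun _ => rfl
  have _ := hV.2
  obtain ⟨p, hp1, hp2, hp3⟩ := exists_generic_point hS hτ
  have hgen : ∀ f : MvPolynomial (Fin n ⊕ Fin n) L, MvPolynomial.aeval p f = 0 →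
      ∀ v ∈ V, MvPolynomial.aeval v f = 0 := by
    intro f hf v hv
    have := hp2 f hf v hv
    rwa [MvPolynomial.aeval_map_algebraMap] at this
  -- A multiplicative coordinate cannot vanish at `p`: by genericity it would then vanish on all of
  -- `V`.
  have hpV : p ∈ V := by
    refine hV.mem_iff.2 ⟨fun i hi => ?_, hp3⟩
    obtain ⟨v, hv⟩ := hV.nonempty
    refine hV.inr_ne_zero hv i ?_
    have := hgen (MvPolynomial.X (Sum.inr i)) (by rw [MvPolynomial.aeval_X, hi]) v hv
    rwa [MvPolynomial.aeval_X] at this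
  refine ⟨p, ⟨hpV, fun f hf v hv => ?_⟩, fun i => ?_⟩
  · have hle : IntermediateField.adjoin ℚ (L : Set K) ≤ L :=
      IntermediateField.adjoin_le_iff.2 subset_rfl
    let _ : Algebra (IntermediateField.adjoin ℚ (L : Set K)) L :=
      (IntermediateField.inclusion hle).toAlgebra
    have _ : IsScalarTower (IntermediateField.adjoin ℚ (L : Set K)) L K :=
      .of_algebraMap_eq fun _ => rfl
    have h1 := hgen (MvPolynomial.map (algebraMap _ _) f)
      (by rw [MvPolynomial.aeval_map_algebraMap, hf]) v hv
    rwa [MvPolynomial.aeval_map_algebraMap] at h1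
  · exact mem_acl_of_isAlgebraic_adjoin (hp1 i)

section Generic

variable {n : ℕ} {p : Fin n ⊕ Fin n → K} {V : Set (Fin n ⊕ Fin n → K)} {A : Set K}

theorem IsGenericIn.eq_zero_of_sum_mem (h : IsGenericIn p V A) (hV : IsAddFree V) {m : Fin n → ℤ}
    (hm : ∑ i, (m i : K) * p (Sum.inl i) ∈ IntermediateField.adjoin ℚ A) : m = 0 := by
  by_contra hne
  refine hV m hne (∑ i, (m i : K) * p (Sum.inl i)) fun v hv => ?_
  have h1 := h.2 (∑ i, (m i : MvPolynomial (Fin n ⊕ Fin n) (IntermediateField.adjoin ℚ A)) *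
    MvPolynomial.X (Sum.inl i) - MvPolynomial.C ⟨_, hm⟩)
    (by simp [IntermediateField.algebraMap_apply]) v hv
  simpa [IntermediateField.algebraMap_apply, sub_eq_zero] using h1

theorem IsGenericIn.eq_zero_of_prod_mem (h : IsGenericIn p V A) (hirr : IsIrredSubvariety V)
    (hV : IsMulFree V) {m : Fin n → ℤ}
    (hm : ∏ i, p (Sum.inr i) ^ m i ∈ IntermediateField.adjoin ℚ A) : m = 0 := by
  by_contra hne
  refine hV m hne (∏ i, p (Sum.inr i) ^ m i) fun v hv => ?_
  have key : ∀ v ∈ V, ∏ i, v (Sum.inr i) ^ m i =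
      (∏ j, v (Sum.inr j) ^ (m j).toNat) / ∏ j, v (Sum.inr j) ^ (-m j).toNat := by
    intro v hv
    rw [← Finset.prod_div_distrib]
    exact Finset.prod_congr rfl fun j _ => zpow_eq_pow_toNat_div (hirr.inr_ne_zero hv j) _
  have hden : ∀ v ∈ V, ∏ j, v (Sum.inr j) ^ (-m j).toNat ≠ 0 := fun v hv =>
    Finset.prod_ne_zero_iff.2 fun j _ => pow_ne_zero _ (hirr.inr_ne_zero hv j)
  have h1 := h.2 (∏ j, MvPolynomial.X (Sum.inr j) ^ (m j).toNat -
    MvPolynomial.C ⟨_, hm⟩ * ∏ j, MvPolynomial.X (Sum.inr j) ^ (-m j).toNat) ?_ v hv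
  · simp only [map_sub, map_mul, map_prod, map_pow, MvPolynomial.aeval_X, MvPolynomial.aeval_C,
      IntermediateField.algebraMap_apply, sub_eq_zero] at h1
    rw [key v hv, h1, mul_div_cancel_right₀ _ (hden v hv)]
  · simp only [map_sub, map_mul, map_prod, map_pow, MvPolynomial.aeval_X, MvPolynomial.aeval_C,
      IntermediateField.algebraMap_apply, sub_eq_zero]
    rw [key p h.1, div_mul_cancel₀ _ (hden p h.1)]

theorem IsGenericIn.matAct (h : IsGenericIn p V A) (hV : IsIrredSubvariety V)
    (M : Matrix (Fin n) (Fin n) ℤ) : IsGenericIn (matAct M p) (matAct M '' V) A := by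
  refine ⟨⟨p, h.1, rfl⟩, ?_⟩
  rintro g hg _ ⟨v, hv, rfl⟩
  obtain ⟨f, d, hfd⟩ := exists_aeval_matAct_eq (K := K) M g
  have h1 := h.2 f (by rw [(hfd p (hV.inr_ne_zero h.1)).2, hg, mul_zero]) v hv
  have h2 := hfd v (hV.inr_ne_zero hv)
  rw [h2.2] at h1
  exact (mul_eq_zero.1 h1).resolve_left h2.1

theorem exists_basis_relRank (X Y : Set K) :
    ∃ I ⊆ Y, I.encard = relRank X Y ∧ Y ⊆ acl (X ∪ I) := by
  obtain ⟨I, hI⟩ := ((matroid ℚ K).contract X).exists_isBasis' Y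
  refine ⟨I, hI.subset, hI.encard_eq_eRk, fun y hy => ?_⟩
  rw [SetLike.mem_coe, ← SetLike.mem_coe, coe_acl]
  by_cases hyX : y ∈ X
  · exact (matroid ℚ K).subset_closure (X ∪ I) (subset_univ _) (Or.inl hyX)
  · have := hI.isBasis_inter_ground.subset_closure ⟨hy, mem_univ _, hyX⟩
    rw [Matroid.contract_closure_eq, union_comm] at this
    exact this.1

theorem isAlgebraic_adjoin_of_mem_acl {X I : Set K} {y : K} (h : y ∈ acl (X ∪ I)) :
    IsAlgebraic (Algebra.adjoin (IntermediateField.adjoin ℚ X) I) y := by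
  rw [← IntermediateField.isAlgebraic_adjoin_iff]
  rw [mem_acl] at h
  refine h.tower_top_of_subalgebra_le (A := (IntermediateField.adjoin ℚ (X ∪ I)).toSubalgebra)
    (B := ((IntermediateField.adjoin (IntermediateField.adjoin ℚ X) I).restrictScalars
      ℚ).toSubalgebra) ?_
  refine IntermediateField.adjoin_le_iff.2 (union_subset ?_ ?_)
  · intro x hx
    exact (IntermediateField.adjoin (IntermediateField.adjoin ℚ X) I).algebraMap_mem
      ⟨x, IntermediateField.subset_adjoin ℚ X hx⟩
  · exact IntermediateField.subset_adjoin _ I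

/-- Over `ℚ(A)` the coordinates of `p` satisfy the same polynomials as the coordinate functions of
`V`. Coordinates over which the others are algebraic at `p` therefore have the same property in the
coordinate ring over `K`, and their number bounds the dimension. -/
theorem IsGenericIn.dim_le (h : IsGenericIn p V A)
    (hV : (MvPolynomial.vanishingIdeal K V).IsPrime) {r : ℕ} (hr : (r : Cardinal) ≤ dim V) :
    (r : ℕ∞) ≤ relRank A (range p) := by
  obtain ⟨B, hBp, hBc, hBalg⟩ := exists_basis_relRank A (range p)
  have hBf : B.Finite := (finite_range p).subset hBp
  set k := IntermediateField.adjoin ℚ A with hk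
  let R := MvPolynomial (Fin n ⊕ Fin n) K ⧸ MvPolynomial.vanishingIdeal K V
  have _ : IsDomain R := Ideal.Quotient.isDomain _
  let x : Fin n ⊕ Fin n → R := fun i => Ideal.Quotient.mk _ (MvPolynomial.X i)
  have hx : ∀ f : MvPolynomial (Fin n ⊕ Fin n) k, MvPolynomial.aeval x f =
      Ideal.Quotient.mk _ (MvPolynomial.map (algebraMap k K) f) := by
    intro f
    have : MvPolynomial.aeval x = Ideal.Quotient.mkₐ K (MvPolynomial.vanishingIdeal K V) := by
      ext i
      rw [MvPolynomial.aeval_X]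
      rfl
    rw [← MvPolynomial.aeval_map_algebraMap K, this]
    rfl
  have hx0 : ∀ f : MvPolynomial (Fin n ⊕ Fin n) k,
      MvPolynomial.aeval x f = 0 ↔ MvPolynomial.aeval p f = 0 := by
    intro f
    rw [hx, Ideal.Quotient.eq_zero_iff_mem]
    constructor
    · intro h1
      have := h1 p h.1
      rwa [MvPolynomial.aeval_map_algebraMap] at this
    · intro h1 v hv
      rw [MvPolynomial.aeval_map_algebraMap]
      exact h.2 f h1 v hv
  have hB' : ∀ b : B, ∃ i, p i = b := fun b => hBp b.2
  choose ν hν using hB'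
  have hνB : (Subtype.val : B → K) = p ∘ ν := funext fun b => (hν b).symm
  have halg : ∀ i, IsAlgebraic (Algebra.adjoin K (range (x ∘ ν))) (x i) := by
    intro i
    have h1 := isAlgebraic_adjoin_of_mem_acl (hBalg (mem_range_self i))
    rw [← hk] at h1
    obtain ⟨P, hP0, hP⟩ := h1
    have hlift : ∀ y : Algebra.adjoin k B, ∃ f : MvPolynomial B k,
        MvPolynomial.aeval (Subtype.val : B → K) f = y := by
      intro y
      have h2 : (y : K) ∈ Algebra.adjoin k (range (Subtype.val : B → K)) := by
        rw [Subtype.range_val]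
        exact y.2
      rw [Algebra.adjoin_range_eq_range_aeval] at h2
      exact h2
    choose lft hlft using hlift
    -- An algebraic equation for `p i`, lifted to a polynomial vanishing at `p`. Genericity moves it
    -- to the coordinate ring, where its coefficients that are nonzero at `p` stay nonzero.
    let F : MvPolynomial (Fin n ⊕ Fin n) k :=
      ∑ s ∈ P.support, MvPolynomial.rename ν (lft (P.coeff s)) * MvPolynomial.X i ^ s
    have hFp : MvPolynomial.aeval p F = 0 := by
      rw [← hP, Polynomial.aeval_def, Polynomial.eval₂_eq_sum, Polynomial.sum_def]
      simp only [F, map_sum, map_mul, map_pow, MvPolynomial.aeval_X, MvPolynomial.aeval_rename,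
        ← hνB, hlft]
      rfl
    have hd : ∀ f : MvPolynomial B k,
        MvPolynomial.aeval (x ∘ ν) f ∈ Algebra.adjoin K (range (x ∘ ν)) := by
      intro f
      rw [Algebra.adjoin_range_eq_range_aeval, ← MvPolynomial.aeval_map_algebraMap K]
      exact ⟨_, rfl⟩
    let G : Polynomial (Algebra.adjoin K (range (x ∘ ν))) :=
      ∑ s ∈ P.support, Polynomial.monomial s
        ⟨MvPolynomial.aeval (x ∘ ν) (lft (P.coeff s)), hd _⟩
    refine ⟨G, fun hG => ?_, ?_⟩
    · obtain ⟨s, hs⟩ := Polynomial.support_nonempty.2 hP0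
      have h2 : G.coeff s = ⟨MvPolynomial.aeval (x ∘ ν) (lft (P.coeff s)), hd _⟩ := by
        simp only [G, Polynomial.finsetSum_coeff, Polynomial.coeff_monomial, Finset.sum_ite_eq']
        rw [if_pos hs]
      rw [hG, Polynomial.coeff_zero] at h2
      have h3 := (congrArg Subtype.val h2).symm
      change MvPolynomial.aeval (x ∘ ν) (lft (P.coeff s)) = 0 at h3
      rw [← MvPolynomial.aeval_rename, hx0, MvPolynomial.aeval_rename, ← hνB, hlft] at h3
      exact Polynomial.mem_support_iff.1 hs (Subtype.ext h3)
    · have h2 := (hx0 F).2 hFp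
      simp only [F, map_sum, map_mul, map_pow, MvPolynomial.aeval_X,
        MvPolynomial.aeval_rename] at h2
      simp only [G, map_sum, Polynomial.aeval_monomial]
      exact h2
  have _ : Algebra.IsAlgebraic (Algebra.adjoin K (range (x ∘ ν))) R := by
    constructor
    intro y
    obtain ⟨f, rfl⟩ := Ideal.Quotient.mk_surjective y
    have : Algebra.adjoin K (range x) ≤ (Subalgebra.algebraicClosure
        (Algebra.adjoin K (range (x ∘ ν))) R).restrictScalars K := by
      refine Algebra.adjoin_le ?_
      rintro _ ⟨i, rfl⟩
      exact halg i
    refine (Subalgebra.mem_algebraicClosure _ _).1 (this ?_)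
    rw [Algebra.adjoin_range_eq_range_aeval]
    refine ⟨f, ?_⟩
    have : MvPolynomial.aeval x = Ideal.Quotient.mkₐ K (MvPolynomial.vanishingIdeal K V) := by
      ext i
      rw [MvPolynomial.aeval_X]
      rfl
    change MvPolynomial.aeval x f = _
    rw [this]
    rfl
  have h1 := Algebra.IsAlgebraic.trdeg_le_cardinalMk K (range (x ∘ ν))
  have h2 : (r : Cardinal) ≤ Cardinal.mk B := hr.trans (h1.trans Cardinal.mk_range_le)
  rw [← hBc, ← hBf.cast_ncard_eq]
  rw [← Set.cast_ncard hBf] at h2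
  exact_mod_cast h2

/-- Pad `m` with zero rows to a square matrix `M`. Then `M · p` is generic in `M · V`, whose
dimension is at least `r` by rotundity; the padding only adds the coordinates `0` and `1`. -/
theorem IsGenericIn.le_relRank (h : IsGenericIn p V A) (hV : IsIrredSubvariety V)
    (hrot : IsRotund V) {r : ℕ} {m : Fin r → Fin n → ℤ} (hm : LinearIndependent ℤ m) :
    (r : ℕ∞) ≤ relRank A (range (fun k => ∑ j, (m k j : K) * p (Sum.inl j)) ∪
      range fun k => ∏ j, p (Sum.inr j) ^ m k j) := by
  have hrn : r ≤ n := by simpa using hm.fintype_card_le_finrank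
  let M : Matrix (Fin n) (Fin n) ℤ := fun i => if hi : i.1 < r then m ⟨i, hi⟩ else 0
  have hM : ∀ k : Fin r, M (Fin.castLE hrn k) = m k := fun k => by simp [M]
  have hrank : r ≤ (M.map (Int.cast : ℤ → ℚ)).rank := by
    have h1 : LinearIndependent ℚ fun k j => (m k j : ℚ) := by
      rw [← LinearIndependent.iff_fractionRing ℤ ℚ]
      let f : (Fin n → ℤ) →ₗ[ℤ] (Fin n → ℚ) := (Int.castAddHom ℚ).toIntLinearMap.compLeft (Fin n)
      refine hm.map' f ?_
      rw [LinearMap.ker_eq_bot]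
      intro x y hxy
      ext j
      have := congrFun hxy j
      simpa [f] using this
    rw [Matrix.rank_eq_finrank_span_row]
    rw [← Fintype.card_fin r, ← finrank_span_eq_card h1]
    refine Submodule.finrank_mono (Submodule.span_mono ?_)
    rintro _ ⟨k, rfl⟩
    refine ⟨Fin.castLE hrn k, ?_⟩
    ext j
    change ((M (Fin.castLE hrn k) j : ℤ) : ℚ) = _
    rw [hM]
  have h1 := (h.matAct hV M).dim_le (hV.isPrime_vanishingIdeal_matAct M)
    ((Nat.cast_le.2 hrank).trans (hrot M))
  refine h1.trans (relRank_mono ?_)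
  rintro _ ⟨i | i, rfl⟩
  · change ∑ j, (M i j : K) * p (Sum.inl j) ∈ acl _
    by_cases hi : i.1 < r
    · refine subset_acl _ (Or.inr (Or.inl ⟨⟨i, hi⟩, ?_⟩))
      simp [M, hi]
    · simp [M, hi, zero_mem]
  · change ∏ j, p (Sum.inr j) ^ M i j ∈ acl _
    by_cases hi : i.1 < r
    · refine subset_acl _ (Or.inr (Or.inr ⟨⟨i, hi⟩, ?_⟩))
      simp [M, hi]
    · simp [M, hi, one_mem]

end Generic

end Varieties

end ExpFld

namespace ExpFld

open AlgebraicIndependent Set Module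

/-! ### Integral independence modulo a submodule, and maximal families -/

section IntegralIndependence

variable {G : Type*} [AddCommGroup G]

theorem linearIndependent_mkQ_iff {J : Type*} {D : Submodule ℤ G} {x : J → G} :
    LinearIndependent ℤ (fun j => D.mkQ (x j)) ↔
      ∀ c : J →₀ ℤ, Finsupp.linearCombination ℤ x c ∈ D → c = 0 := by
  rw [linearIndependent_iff]
  refine forall_congr' fun c => ?_
  rw [← Submodule.Quotient.mk_eq_zero D, ← Submodule.mkQ_apply, LinearMap.map_finsupp_linearCombination]
  rfl

theorem exists_eq_add_linearCombination {J : Type*} {D : Submodule ℤ G} {x : J → G} {y : G}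
    (hy : D.mkQ y ∈ Submodule.span ℤ (range fun j => D.mkQ (x j))) :
    ∃ d ∈ D, ∃ c : J →₀ ℤ, y = d + Finsupp.linearCombination ℤ x c := by
  obtain ⟨c, hc⟩ := Finsupp.mem_span_range_iff_exists_finsupp.1 hy
  refine ⟨y - Finsupp.linearCombination ℤ x c, ?_, c, by abel⟩
  rw [← Submodule.Quotient.mk_eq_zero D, ← Submodule.mkQ_apply, map_sub,
    LinearMap.map_finsupp_linearCombination, ← hc, Finsupp.linearCombination_apply]
  exact sub_self _

/-- A family indexed by blocks is independent if each block is independent modulo a submodule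
containing all the other blocks of at most its level. -/
theorem linearIndependent_of_blocks {ι : Type*} {sz : ι → ℕ} {D : Submodule ℤ G}
    {H : ι → Submodule ℤ G} {x : (Σ i, Fin (sz i)) → G} (lvl : ι → ℕ) (hD : ∀ i, D ≤ H i)
    (hx : ∀ i j, j ≠ i → lvl j ≤ lvl i → ∀ k, x ⟨j, k⟩ ∈ H i)
    (hind : ∀ i (m : Fin (sz i) → ℤ), ∑ k, m k • x ⟨i, k⟩ ∈ H i → m = 0) :
    LinearIndependent ℤ (fun a => D.mkQ (x a)) := by
  classical
  rw [linearIndependent_mkQ_iff]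
  intro c hc
  by_contra hne
  -- Pick a block of maximal level occurring in the relation; all other terms lie in its `H`, so its
  -- own part does too and must vanish.
  obtain ⟨i, hi, hmax⟩ := Finset.exists_max_image (c.support.image Sigma.fst) lvl
    ((Finsupp.support_nonempty_iff.2 hne).image _)
  obtain ⟨⟨i', k⟩, hk, rfl⟩ := Finset.mem_image.1 hi
  rw [Finsupp.linearCombination_apply, Finsupp.sum,
    ← Finset.sum_filter_add_sum_filter_not _ (fun a => a.1 = i')] at hc
  have hrest : ∑ a ∈ c.support.filter (fun a => ¬ a.1 = i'), c a • x a ∈ H i' := by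
    refine Submodule.sum_mem _ fun a ha => Submodule.smul_mem _ _ ?_
    obtain ⟨h1, h2⟩ := Finset.mem_filter.1 ha
    exact hx i' a.1 h2 (hmax _ (Finset.mem_image_of_mem _ h1)) a.2
  have hfib : ∑ a ∈ c.support.filter (fun a => a.1 = i'), c a • x a =
      ∑ k, c ⟨i', k⟩ • x ⟨i', k⟩ := by
    refine Eq.trans (Finset.sum_subset ?_ ?_)
      (Finset.sum_map Finset.univ (Function.Embedding.sigmaMk i') fun a => c a • x a)
    · rintro ⟨j, l⟩ ha
      obtain ⟨-, rfl⟩ := Finset.mem_filter.1 ha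
      simp
    · intro a ha ha'
      obtain ⟨l, -, rfl⟩ := Finset.mem_map.1 ha
      have : c ⟨i', l⟩ = 0 := by simpa using ha'
      simp [this]
  have hm := hind i' (fun k => c ⟨i', k⟩) (by
    rw [← hfib]
    exact (Submodule.add_mem_iff_left _ hrest).1 (hD _ hc))
  exact Finsupp.mem_support_iff.1 hk (congrFun hm k)

/-- Every independent family extends to a maximal one. -/
theorem exists_linearIndependent_completion {J : Type*} {v : J → G}
    (hv : LinearIndependent ℤ v) : ∃ s : Set G, LinearIndependent ℤ (Sum.elim v ((↑) : s → G)) ∧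
      ∀ y, ∃ N : ℤ, N ≠ 0 ∧ N • y ∈ Submodule.span ℤ (range (Sum.elim v ((↑) : s → G))) := by
  set S := Submodule.span ℤ (range v) with hS
  obtain ⟨T, hT, hmax⟩ := exists_maximal_linearIndepOn ℤ (id : G ⧸ S → G ⧸ S)
  let g : T → G := fun t => (S.mkQ_surjective t).choose
  have hg : ∀ t, S.mkQ (g t) = t := fun t => (S.mkQ_surjective t).choose_spec
  have hginj : Function.Injective g := fun a b hab => Subtype.ext (by rw [← hg, ← hg, hab])
  have hmem : ∀ j, v j ∈ S := fun j => Submodule.subset_span (mem_range_self j)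
  have h1 : LinearIndependent ℤ (fun j => (⟨v j, hmem j⟩ : S)) :=
    .of_comp S.subtype hv
  have h2 : LinearIndependent ℤ (Sum.elim v g) := by
    refine h1.sumElim_of_quotient g ?_
    have hmk : Submodule.Quotient.mk (p := S) ∘ g = fun t : T => id (t : G ⧸ S) := funext hg
    rw [hmk]
    exact hT
  let ψ : T ≃ range g := Equiv.ofInjective g hginj
  have hψ : Sum.elim v g = Sum.elim v ((↑) : range g → G) ∘ Sum.map id ψ := by
    ext (j | t) <;> rfl
  refine ⟨range g, ?_, fun y => ?_⟩
  · rw [← linearIndependent_equiv ((Equiv.refl J).sumCongr ψ)]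
    rwa [hψ] at h2
  · have key : ∀ z : G, S.mkQ z ∈ Submodule.span ℤ T →
        z ∈ Submodule.span ℤ (range (Sum.elim v ((↑) : range g → G))) := by
      intro z hz
      have hT' : T = S.mkQ '' range g := by
        ext t
        constructor
        · intro ht
          exact ⟨_, ⟨⟨t, ht⟩, rfl⟩, hg _⟩
        · rintro ⟨_, ⟨t, rfl⟩, rfl⟩
          rw [hg]
          exact t.2
      rw [hT', Submodule.span_image] at hz
      obtain ⟨w, hw, hwz⟩ := hz
      have hzw : z - w ∈ S := by
        rw [← Submodule.Quotient.mk_eq_zero, ← Submodule.mkQ_apply, map_sub, hwz, sub_self]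
      rw [Sum.elim_range, Subtype.range_coe, Submodule.span_union, ← sub_add_cancel z w]
      exact Submodule.add_mem_sup hzw hw
    by_cases hy : S.mkQ y ∈ T
    · exact ⟨1, one_ne_zero, key _ (by simpa using Submodule.subset_span hy)⟩
    · obtain ⟨N, hN, hNy⟩ := hmax _ hy
      exact ⟨N, hN, key _ (by simpa using hNy)⟩

end IntegralIndependence

/-! ### Extending the exponential map without enlarging the kernel -/

section Extension

variable (F K : Type*) [Field F] [Field K] [Algebra F K]

/-- The additive group of the subfield `F` of `K`. -/
def addPart : Submodule ℤ K := AddSubgroup.toIntSubmodule (algebraMap F K : F →+ K).range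

/-- The multiplicative group of the subfield `F` of `K`, written additively. -/
def mulPart : Submodule ℤ (Additive Kˣ) :=
  AddSubgroup.toIntSubmodule (Subgroup.toAddSubgroup (Units.map (algebraMap F K : F →* K)).range)

variable {F K}

theorem mem_addPart {x : K} : x ∈ addPart F K ↔ x ∈ range (algebraMap F K) := Iff.rfl

theorem mem_mulPart {y : Additive Kˣ} :
    y ∈ mulPart F K ↔ ((Additive.toMul y : Kˣ) : K) ∈ range (algebraMap F K) := by
  constructor
  · rintro ⟨u, hu⟩
    exact ⟨u, congrArg Units.val hu⟩
  · rintro ⟨x, hx⟩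
    have hx0 : x ≠ 0 := by
      rintro rfl
      rw [map_zero] at hx
      exact (Units.ne_zero _) hx.symm
    exact ⟨Units.mk0 x hx0, Units.ext hx⟩

theorem mem_range_of_pow_eq_one [IsAlgClosed F] {ζ : K} {N : ℕ} (hN : 0 < N) (h : ζ ^ N = 1) :
    ζ ∈ range (algebraMap F K) := by
  have hint : IsIntegral F ζ := ⟨Polynomial.X ^ N - 1, Polynomial.monic_X_pow_sub_C 1 hN.ne', by simp [h]⟩
  exact minpoly.mem_range_of_degree_eq_one F ζ
    (IsAlgClosed.degree_eq_one_of_irreducible F (minpoly.irreducible hint))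

theorem exists_pow_eq_units [IsAlgClosed K] {N : ℤ} (hN : N ≠ 0) (y : Kˣ) : ∃ z : Kˣ, z ^ N = y := by
  have hpos : 0 < N.natAbs := Int.natAbs_pos.2 hN
  obtain ⟨z, hz⟩ := IsAlgClosed.exists_pow_nat_eq (y : K) hpos
  have hz0 : z ≠ 0 := by
    rintro rfl
    rw [zero_pow hpos.ne'] at hz
    exact y.ne_zero hz.symm
  have hz' : Units.mk0 z hz0 ^ N.natAbs = y := Units.ext (by simpa using hz)
  rcases Int.natAbs_eq N with h | h
  · exact ⟨Units.mk0 z hz0, by rw [h, zpow_natCast, hz']⟩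
  · exact ⟨(Units.mk0 z hz0)⁻¹, by rw [h, zpow_neg, zpow_natCast, inv_pow, hz', inv_inv]⟩

/-- Extension of an exponential map with prescribed values at a maximal independent family. -/
theorem exists_addChar_extension [IsAlgClosed K] [CharZero K] {e : AddChar F F} (hF : IsELA e)
    {I : Type*} {b : I → K} {c : I → Kˣ}
    (hb : LinearIndependent ℤ (fun j => (addPart F K).mkQ (b j)))
    (hbs : ∀ x, ∃ N : ℤ, N ≠ 0 ∧
      N • x ∈ Submodule.span ℤ (range fun j => (addPart F K).mkQ (b j)))
    (hc : LinearIndependent ℤ (fun j => (mulPart F K).mkQ (Additive.ofMul (c j))))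
    (hcs : ∀ y, ∃ N : ℤ, N ≠ 0 ∧
      N • y ∈ Submodule.span ℤ (range fun j => (mulPart F K).mkQ (Additive.ofMul (c j)))) :
    ∃ e' : AddChar K K, (∀ x, e' (algebraMap F K x) = algebraMap F K (e x)) ∧
      (∀ j, e' (b j) = c j) ∧ (∀ x, e' x = 1 → x ∈ range (algebraMap F K)) ∧
      ∀ y, y ≠ 0 → ∃ x, e' x = y := by
  have _ : IsAlgClosed F := hF.1
  -- Divisibility makes `Kˣ` an injective abelian group, so a map given on `F` and on the family `b`
  -- extends to all of `K`.
  let _ : DivisibleBy (Additive Kˣ) ℤ := divisibleByOfSMulRightSurj _ _ fun hn y =>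
    (exists_pow_eq_units hn (Additive.toMul y)).imp fun z hz => hz
  let E : F →+ Additive Kˣ :=
    { toFun := fun x => Additive.ofMul
        (Units.mk0 (algebraMap F K (e x)) ((map_ne_zero _).2 (addChar_ne_zero e x)))
      map_zero' := Additive.toMul.injective (Units.ext (by simp))
      map_add' := fun x y => Additive.toMul.injective
        (Units.ext (by simp [AddChar.map_add_eq_mul])) }
  have hE : ∀ x, ((Additive.toMul (E x) : Kˣ) : K) = algebraMap F K (e x) := fun x => rfl
  let g : F × (I →₀ ℤ) →+ K := AddMonoidHom.coprod (algebraMap F K : F →+ K)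
    (Finsupp.linearCombination ℤ b).toAddMonoidHom
  let g' : F × (I →₀ ℤ) →+ Additive Kˣ := AddMonoidHom.coprod E
    (Finsupp.linearCombination ℤ fun j => Additive.ofMul (c j)).toAddMonoidHom
  have hg : ∀ x m, g (x, m) = algebraMap F K x + Finsupp.linearCombination ℤ b m := fun _ _ => rfl
  have hg' : ∀ x m, g' (x, m) = E x + Finsupp.linearCombination ℤ (fun j => Additive.ofMul (c j)) m :=
    fun _ _ => rfl
  rw [linearIndependent_mkQ_iff] at hb hc
  have hginj : Function.Injective g := by
    rw [injective_iff_map_eq_zero]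
    rintro ⟨x, m⟩ h
    rw [hg] at h
    have hm : m = 0 := hb m (mem_addPart.2 ⟨-x, by
      rw [map_neg]
      exact neg_eq_of_add_eq_zero_right h⟩)
    subst hm
    rw [map_zero, add_zero, map_eq_zero] at h
    rw [h]
    rfl
  obtain ⟨h, hh⟩ := (Module.Baer.of_divisible (Additive Kˣ)).extension_property_addMonoidHom g hginj g'
  have hh' : ∀ x m, h (g (x, m)) = g' (x, m) := fun x m => DFunLike.congr_fun hh (x, m)
  let e' : AddChar K K :=
    { toFun := fun x => ((Additive.toMul (h x) : Kˣ) : K)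
      map_zero_eq_one' := by simp
      map_add_eq_mul' := fun x y => by simp }
  have he' : ∀ x, e' x = ((Additive.toMul (h x) : Kˣ) : K) := fun _ => rfl
  have heF : ∀ x, e' (algebraMap F K x) = algebraMap F K (e x) := fun x => by
    have := hh' x 0
    rw [hg, hg', map_zero, map_zero, add_zero, add_zero] at this
    rw [he', this, hE]
  refine ⟨e', heF, fun j => ?_, fun x hx => ?_, fun y hy => ?_⟩
  · have := hh' 0 (Finsupp.single j 1)
    rw [hg, hg', map_zero, map_zero, zero_add, zero_add, Finsupp.linearCombination_single,
      Finsupp.linearCombination_single, one_smul, one_smul] at this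
    rw [he', this]
    rfl
  -- Some nonzero multiple of `x` is in `F` plus the span of `b`. Its value is `1`, so independence
  -- of the values removes the `b`-part, and `x` is in `F`.
  · obtain ⟨N, hN, hNx⟩ := hbs ((addPart F K).mkQ x)
    rw [← map_zsmul] at hNx
    obtain ⟨_, ⟨f, rfl⟩, m, hm⟩ := exists_eq_add_linearCombination hNx
    have hx0 : h x = 0 := by
      apply Additive.toMul.injective
      exact Units.ext hx
    have h1 : h (g (f, m)) = 0 := by
      rw [hg]
      erw [← hm]
      rw [map_zsmul, hx0, smul_zero]
    rw [hh', hg'] at h1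
    have hm0 : m = 0 := hc m (mem_mulPart.2 ⟨e (-f), by
      rw [← hE, map_neg, neg_eq_of_add_eq_zero_right h1]⟩)
    subst hm0
    rw [map_zero, add_zero] at hm
    have _ : CharZero F := (algebraMap F K).charZero
    have hN' : (N : K) ≠ 0 := Int.cast_ne_zero.2 hN
    refine ⟨f / N, ?_⟩
    rw [map_div₀, map_intCast, div_eq_iff hN', mul_comm, ← zsmul_eq_mul, hm]
    rfl
  -- A power of `y` is a value of `e'`, and dividing its logarithm by `N` gives `z`, whose
  -- exponential agrees with `y` up to a root of unity. That root lies in the algebraically closed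
  -- `F`, where it has a logarithm.
  · obtain ⟨N, hN, hNy⟩ := hcs ((mulPart F K).mkQ (Additive.ofMul (Units.mk0 y hy)))
    rw [← map_zsmul] at hNy
    obtain ⟨d, hd, m, hm⟩ := exists_eq_add_linearCombination hNy
    obtain ⟨w, hw⟩ := mem_mulPart.1 hd
    have hw0 : w ≠ 0 := by
      rintro rfl
      rw [map_zero] at hw
      exact (Units.ne_zero _) hw.symm
    obtain ⟨f, rfl⟩ := hF.2 w hw0
    have hdE : d = E f := Additive.toMul.injective (Units.ext (by rw [hE, hw]))
    have hN' : (N : K) ≠ 0 := Int.cast_ne_zero.2 hN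
    set z : K := g (f, m) / N with hz
    have hNz : N • z = g (f, m) := by rw [zsmul_eq_mul, hz, mul_div_cancel₀ _ hN']
    have h1 : N • h z = N • Additive.ofMul (Units.mk0 y hy) := by
      rw [← map_zsmul, hNz, hh', hg', hm, hdE]
    set ζ : Kˣ := Units.mk0 y hy * (Additive.toMul (h z))⁻¹ with hζ
    have hζN : ζ ^ N = 1 := by
      have h2 : (Additive.toMul (h z)) ^ N = Units.mk0 y hy ^ N := congrArg Additive.toMul h1
      rw [hζ, mul_zpow, inv_zpow, h2, mul_inv_cancel]
    have hζn : (ζ : K) ^ N.natAbs = 1 := by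
      rw [← Units.val_pow_eq_pow_val, pow_natAbs_eq_one.2 hζN, Units.val_one]
    obtain ⟨w', hw'⟩ := mem_range_of_pow_eq_one (F := F) (Int.natAbs_pos.2 hN) hζn
    have hw'0 : w' ≠ 0 := by
      rintro rfl
      rw [map_zero] at hw'
      exact ζ.ne_zero hw'.symm
    obtain ⟨f', rfl⟩ := hF.2 w' hw'0
    refine ⟨z + algebraMap F K f', ?_⟩
    rw [AddChar.map_add_eq_mul, heF, hw', he', hζ, Units.val_mul, Units.val_mk0,
      Units.val_inv_eq_inv_val, mul_left_comm, mul_inv_cancel₀ (Units.ne_zero _), mul_one]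

end Extension

end ExpFld

namespace ExpFld

open AlgebraicIndependent Set Module

theorem exists_field_extension (F : Type u) [Field F] [CharZero F] (Θ : Type u) [Nonempty Θ]
    (hΘ : Cardinal.mk Θ ≤ Cardinal.mk F) :
    ∃ (K : Type u) (_ : Field K) (_ : CharZero K) (_ : Algebra F K) (t : Θ → K),
      IsAlgClosed K ∧ IsTranscendenceBasis F t ∧ Cardinal.mk K = Cardinal.mk F := by
  let Q := FractionRing (MvPolynomial Θ F)
  let K := AlgebraicClosure Q
  have _ : Algebra.IsAlgebraic (MvPolynomial Θ F) Q :=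
    IsLocalization.isAlgebraic _ (nonZeroDivisors (MvPolynomial Θ F))
  have h1 : IsTranscendenceBasis F (algebraMap (MvPolynomial Θ F) Q ∘ MvPolynomial.X) :=
    (IsTranscendenceBasis.mvPolynomial Θ F).algebraMap_comp
  have h2 : IsTranscendenceBasis F
      (algebraMap Q K ∘ algebraMap (MvPolynomial Θ F) Q ∘ MvPolynomial.X) := h1.algebraMap_comp
  refine ⟨K, inferInstance, charZero_of_injective_algebraMap (algebraMap F K).injective,
    inferInstance, _, inferInstance, h2, ?_⟩
  have h3 := h2.lift_cardinalMk_eq_max_lift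
  have hinf : Cardinal.aleph0 ≤ Cardinal.mk F := Cardinal.infinite_iff.1
    (Infinite.of_injective ((↑) : ℕ → F) Nat.cast_injective)
  simp only [Cardinal.lift_id] at h3
  rw [h3, sup_eq_left.2 hΘ, sup_eq_left.2 hinf]

/-! ### Subfields generated by sets of generators -/

section FieldAt

variable (F : Type*) {K : Type u} [Field F] [Field K] [CharZero K] [Algebra F K] {Θ : Type*}

/-- The relative algebraic closure in `K` of the field generated over `F` by the elements `t θ`
with `θ ∈ S`. -/
noncomputable def fieldAt (t : Θ → K) (S : Set Θ) : IntermediateField ℚ K :=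
  acl (range (algebraMap F K) ∪ t '' S)

variable {F} {t : Θ → K}

theorem acl_fieldAt (S : Set Θ) : acl (fieldAt F t S : Set K) = fieldAt F t S := acl_acl _

theorem fieldAt_mono {S S' : Set Θ} (h : S ⊆ S') : fieldAt F t S ≤ fieldAt F t S' :=
  acl_mono (union_subset_union_right _ (image_mono h))

theorem algebraMap_mem_fieldAt (S : Set Θ) (x : F) : algebraMap F K x ∈ fieldAt F t S :=
  subset_acl _ (Or.inl (mem_range_self x))

theorem apply_mem_fieldAt {S : Set Θ} {θ : Θ} (h : θ ∈ S) : t θ ∈ fieldAt F t S :=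
  subset_acl _ (Or.inr (mem_image_of_mem t h))

theorem acl_union_le_fieldAt {S S' S'' : Set Θ} (h : S ⊆ S'') (h' : S' ⊆ S'') :
    acl (fieldAt F t S ∪ t '' S') ≤ fieldAt F t S'' := by
  refine acl_subset_acl_iff.2 (union_subset (fieldAt_mono h) ?_)
  rintro _ ⟨θ, hθ, rfl⟩
  exact apply_mem_fieldAt (h' hθ)

theorem adjoin_range_algebraMap (x : K) :
    x ∈ IntermediateField.adjoin ℚ (range (algebraMap F K)) ↔ x ∈ range (algebraMap F K) := by
  refine ⟨fun h => ?_, fun h => IntermediateField.subset_adjoin ℚ _ h⟩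
  induction h using IntermediateField.adjoin_induction with
  | mem x hx => exact hx
  | algebraMap q => exact ⟨(q.num : F) / (q.den : F), by simp [Rat.cast_def q]⟩
  | add x y _ _ hx hy => exact (algebraMap F K).fieldRange.add_mem hx hy
  | mul x y _ _ hx hy => exact (algebraMap F K).fieldRange.mul_mem hx hy
  | inv x _ hx => exact (algebraMap F K).fieldRange.inv_mem hx

theorem isAlgebraic_adjoin_range_iff {T : Set K} {x : K} :
    x ∈ acl (range (algebraMap F K) ∪ T) ↔ IsAlgebraic (Algebra.adjoin F T) x := by
  have hsub : ∀ x ∈ Algebra.adjoin F T,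
      x ∈ IntermediateField.adjoin ℚ (range (algebraMap F K) ∪ T) := by
    intro x hx
    induction hx using Algebra.adjoin_induction with
    | mem x hx => exact IntermediateField.subset_adjoin ℚ _ (Or.inr hx)
    | algebraMap c => exact IntermediateField.subset_adjoin ℚ _ (Or.inl ⟨c, rfl⟩)
    | add _ _ _ _ h h' => exact add_mem h h'
    | mul _ _ _ _ h h' => exact mul_mem h h'
  let f : Algebra.adjoin F T →+* IntermediateField.adjoin ℚ (range (algebraMap F K) ∪ T) :=
    { toFun := fun x => ⟨x, hsub x x.2⟩
      map_one' := rfl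
      map_mul' := fun _ _ => rfl
      map_zero' := rfl
      map_add' := fun _ _ => rfl }
  have hf : Function.Injective f := by
    intro a b h
    have := congrArg Subtype.val h
    exact Subtype.ext this
  constructor
  · intro h
    rw [← IntermediateField.isAlgebraic_adjoin_iff]
    rw [mem_acl] at h
    have hsub' : ∀ x ∈ IntermediateField.adjoin ℚ (range (algebraMap F K) ∪ T),
        x ∈ IntermediateField.adjoin F T := by
      intro x hx
      induction hx using IntermediateField.adjoin_induction with
      | mem x hx =>
        rcases hx with ⟨c, rfl⟩ | hx
        · exact (IntermediateField.adjoin F T).algebraMap_mem c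
        · exact IntermediateField.subset_adjoin F T hx
      | algebraMap q =>
        obtain ⟨c, hc⟩ := (adjoin_range_algebraMap (F := F) (algebraMap ℚ K q)).1
          (IntermediateField.algebraMap_mem _ q)
        rw [← hc]
        exact (IntermediateField.adjoin F T).algebraMap_mem c
      | add _ _ _ _ h h' => exact add_mem h h'
      | mul _ _ _ _ h h' => exact mul_mem h h'
      | inv _ _ h => exact inv_mem h
    let f' : IntermediateField.adjoin ℚ (range (algebraMap F K) ∪ T) →+*
        IntermediateField.adjoin F T :=
      { toFun := fun x => ⟨x, hsub' x x.2⟩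
        map_one' := rfl
        map_mul' := fun _ _ => rfl
        map_zero' := rfl
        map_add' := fun _ _ => rfl }
    exact h.ringHom_of_comp_eq f' (RingHom.id K) f'.injective rfl
  · intro h
    rw [mem_acl]
    exact h.ringHom_of_comp_eq f (RingHom.id K) hf rfl

theorem notMem_fieldAt (ht : AlgebraicIndependent F t) {S : Set Θ} {θ : Θ} (h : θ ∉ S) :
    t θ ∉ fieldAt F t S := fun hm =>
  ht.transcendental_adjoin h (isAlgebraic_adjoin_range_iff.1 hm)

theorem notMem_fieldAt_compl (ht : AlgebraicIndependent F t) {S : Set Θ} {θ : Θ} (h : θ ∈ S) :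
    t θ ∉ fieldAt F t Sᶜ := notMem_fieldAt ht (not_not.2 h)

theorem algebraicIndependent_fieldAt (ht : AlgebraicIndependent F t) {S : Set Θ} {J : Type*}
    {f : J → Θ} (hf : Function.Injective f) (h : ∀ j, f j ∉ S) :
    AlgebraicIndependent (fieldAt F t S) fun j => t (f j) := by
  have hinj : Function.Injective fun j => t (f j) := ht.injective.comp hf
  have key : ((matroid ℚ K).contract (fieldAt F t S : Set K)).Indep (range fun j => t (f j)) := by
    rw [contract_indep_iff_notMem_acl]
    rintro _ ⟨j, rfl⟩ hm
    have hsub : (fieldAt F t S : Set K) ∪ (range (fun j => t (f j)) \ {t (f j)}) ⊆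
        fieldAt F t (S ∪ f '' {j}ᶜ) := by
      refine union_subset (fieldAt_mono subset_union_left) ?_
      rintro _ ⟨⟨l, rfl⟩, hl⟩
      exact apply_mem_fieldAt (Or.inr ⟨l, fun hlj => hl (by rw [hlj]; rfl), rfl⟩)
    have hm' : t (f j) ∈ fieldAt F t (S ∪ f '' {j}ᶜ) := acl_subset_acl_iff.2 hsub hm
    refine notMem_fieldAt ht ?_ hm'
    rintro (hS | ⟨l, hl, hlj⟩)
    · exact h j hS
    · exact hl (hf hlj)
  rw [contract_indep_iff, IntermediateField.adjoin_self] at key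
  exact (algebraicIndependent_subtype_range hinj).1 key

theorem exists_finite_mem_fieldAt (ht : IsTranscendenceBasis F t) (x : K) :
    ∃ S : Set Θ, S.Finite ∧ x ∈ fieldAt F t S := by
  have hx : x ∈ acl (range (algebraMap F K) ∪ range t) := by
    rw [isAlgebraic_adjoin_range_iff]
    exact ht.isAlgebraic.isAlgebraic x
  rw [← SetLike.mem_coe, coe_acl] at hx
  obtain ⟨I, hI, hfin, -, hxI⟩ := Matroid.exists_mem_finite_closure_of_mem_closure hx
  rw [← coe_acl] at hxI
  refine ⟨t ⁻¹' I, hfin.preimage ht.1.injective.injOn, acl_mono ?_ hxI⟩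
  intro y hy
  rcases hI hy with h | ⟨θ, rfl⟩
  · exact Or.inl h
  · exact Or.inr ⟨θ, hy, rfl⟩

end FieldAt

end ExpFld

namespace ExpFld

open AlgebraicIndependent Set Module

section IntegralIndependence

variable {G : Type u} [AddCommGroup G] {D : Submodule ℤ G}

theorem linearIndependent_of_notMem {J : Type*} {y : J → G} (H : J → Submodule ℤ G)
    (hD : ∀ j, D ≤ H j) (hy : ∀ i j, j ≠ i → y j ∈ H i)
    (hn : ∀ (j : J) (N : ℤ), N • y j ∈ H j → N = 0) :
    LinearIndependent ℤ (fun j => D.mkQ (y j)) := by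
  classical
  rw [linearIndependent_mkQ_iff]
  intro c hc
  ext j
  by_contra hj
  refine hj (hn j (c j) ?_)
  rw [Finsupp.linearCombination_apply, Finsupp.sum,
    ← Finset.add_sum_erase _ _ (Finsupp.mem_support_iff.2 hj)] at hc
  refine (Submodule.add_mem_iff_left _ (Submodule.sum_mem _ fun l hl => ?_)).1 (hD j hc)
  exact Submodule.smul_mem _ _ (hy j l (Finset.ne_of_mem_erase hl))

theorem linearIndependent_sumElim_mkQ {J J' : Type*} {y : J → G} {x : J' → G}
    (hy : LinearIndependent ℤ (fun j => D.mkQ (y j)))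
    (hx : LinearIndependent ℤ (fun j => (D ⊔ Submodule.span ℤ (range y)).mkQ (x j))) :
    LinearIndependent ℤ (fun j => D.mkQ (Sum.elim y x j)) := by
  set M := Submodule.span ℤ (range fun j => D.mkQ (y j)) with hM
  have h1 : LinearIndependent ℤ
      (fun j => (⟨D.mkQ (y j), Submodule.subset_span (mem_range_self j)⟩ : M)) :=
    .of_comp M.subtype hy
  have h2 : LinearIndependent ℤ (fun j => M.mkQ (D.mkQ (x j))) := by
    rw [linearIndependent_mkQ_iff] at hx ⊢
    intro c hc
    refine hx c ?_
    have hlc : Finsupp.linearCombination ℤ (fun j => D.mkQ (x j)) c =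
        D.mkQ (Finsupp.linearCombination ℤ x c) :=
      (LinearMap.map_finsupp_linearCombination D.mkQ c).symm
    rw [hlc] at hc
    obtain ⟨d, hd, c', hc'⟩ := exists_eq_add_linearCombination hc
    rw [hc']
    refine Submodule.add_mem_sup hd ?_
    rw [Finsupp.linearCombination_apply]
    exact Submodule.sum_mem _ fun l _ =>
      Submodule.smul_mem _ _ (Submodule.subset_span (mem_range_self l))
  have h3 := h1.sumElim_of_quotient (fun j => D.mkQ (x j)) h2
  convert! h3 using 1
  ext (j | j) <;> rfl

theorem exists_completion_mkQ {J : Type*} {v : J → G}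
    (hv : LinearIndependent ℤ (fun j => D.mkQ (v j))) :
    ∃ (J' : Type u) (w : J' → G), LinearIndependent ℤ (fun j => D.mkQ (Sum.elim v w j)) ∧
      ∀ y, ∃ N : ℤ, N ≠ 0 ∧
        N • y ∈ Submodule.span ℤ (range fun j => D.mkQ (Sum.elim v w j)) := by
  obtain ⟨s, hs, hspan⟩ := exists_linearIndependent_completion hv
  choose w hw using fun z : s => D.mkQ_surjective z
  have heq : (fun j => D.mkQ (Sum.elim v w j)) =
      Sum.elim (fun j => D.mkQ (v j)) ((↑) : s → G ⧸ D) := by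
    ext (j | j)
    · rfl
    · exact hw j
  refine ⟨s, w, ?_, ?_⟩
  · rwa [heq]
  · rwa [heq]

end IntegralIndependence

/-! ### Torsion modulo the additive and multiplicative groups of a subfield -/

section SubfieldModules

variable {K : Type u} [Field K] [CharZero K]

/-- The additive group of a subfield, as a `ℤ`-module. -/
def addInt (L : IntermediateField ℚ K) : Submodule ℤ K :=
  AddSubgroup.toIntSubmodule L.toSubfield.toSubring.toAddSubgroup

theorem mem_addInt {L : IntermediateField ℚ K} {x : K} : x ∈ addInt L ↔ x ∈ L := Iff.rfl

/-- The multiplicative group of a subfield, as a `ℤ`-module. -/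
def mulInt (L : IntermediateField ℚ K) : Submodule ℤ (Additive Kˣ) where
  carrier := {y | ((Additive.toMul y : Kˣ) : K) ∈ L}
  add_mem' := fun {a b} ha hb => by
    change ((Additive.toMul a * Additive.toMul b : Kˣ) : K) ∈ L
    rw [Units.val_mul]
    exact mul_mem ha hb
  zero_mem' := one_mem L
  smul_mem' := fun n a ha => by
    change ((Additive.toMul a ^ n : Kˣ) : K) ∈ L
    rw [Units.val_zpow_eq_zpow_val]
    exact zpow_mem ha n

theorem mem_mulInt {L : IntermediateField ℚ K} {y : Additive Kˣ} :
    y ∈ mulInt L ↔ ((Additive.toMul y : Kˣ) : K) ∈ L := Iff.rfl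

theorem eq_zero_of_smul_mem_addInt {L : IntermediateField ℚ K} {x : K} (hx : x ∉ L) {N : ℤ}
    (h : N • x ∈ addInt L) : N = 0 := by
  by_contra hN
  have hN' : (N : K) ≠ 0 := Int.cast_ne_zero.2 hN
  rw [mem_addInt, zsmul_eq_mul] at h
  refine hx ?_
  rw [← mul_div_cancel_left₀ x hN']
  exact div_mem h (intCast_mem L N)

theorem eq_zero_of_smul_mem_mulInt {L : IntermediateField ℚ K} (hL : acl (L : Set K) = L)
    {y : Additive Kˣ} (hy : y ∉ mulInt L) {N : ℤ} (h : N • y ∈ mulInt L) : N = 0 := by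
  by_contra hN
  refine hy ?_
  rw [mem_mulInt, ← hL]
  refine mem_acl_of_pow_mem (n := N.natAbs) (Int.natAbs_ne_zero.2 hN) ?_
  have h1 : ((Additive.toMul y : Kˣ) : K) ^ N ∈ L := by
    rw [← Units.val_zpow_eq_zpow_val]
    exact h
  rw [hL]
  rcases Int.natAbs_eq N with h2 | h2
  · rwa [h2, zpow_natCast] at h1
  · rw [h2, zpow_neg, zpow_natCast] at h1
    simpa using inv_mem h1

end SubfieldModules

/-! ### Codes for varieties and the points attached to them -/

section FreePoints

variable {K : Type u} [Field K] [CharZero K]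

/-- A point of `Gⁿ(M)` which is additively and multiplicatively free over `L`, and whose images
under the quotient maps of `Gⁿ` have at least the transcendence degree required by rotundity. -/
structure IsFreePoint (L M : IntermediateField ℚ K) {n : ℕ} (p : Fin n ⊕ Fin n → K) : Prop where
  mem : ∀ i, p i ∈ M
  ne_zero : ∀ i, p (Sum.inr i) ≠ 0
  eq_zero_of_sum_mem : ∀ m : Fin n → ℤ, ∑ i, (m i : K) * p (Sum.inl i) ∈ L → m = 0
  eq_zero_of_prod_mem : ∀ m : Fin n → ℤ, ∏ i, p (Sum.inr i) ^ m i ∈ L → m = 0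
  le_relRank : ∀ (r : ℕ) (m : Fin r → Fin n → ℤ), LinearIndependent ℤ m →
    (r : ℕ∞) ≤ relRank L (range (fun k => ∑ j, (m k j : K) * p (Sum.inl j)) ∪
      range fun k => ∏ j, p (Sum.inr j) ^ m k j)

/-- `V` is rotund and free, and its ideal is generated by a given finite set of polynomials with
coefficients in `k`. -/
structure IsCodedBy (k : IntermediateField ℚ K) {n : ℕ}
    (T : Finset (MvPolynomial (Fin n ⊕ Fin n) K)) (V : Set (Fin n ⊕ Fin n → K)) : Prop where
  irred : IsIrredSubvariety V
  rotund : IsRotund V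
  addFree : IsAddFree V
  mulFree : IsMulFree V
  ideal_eq : MvPolynomial.vanishingIdeal K V = Ideal.span T
  coeff_mem : ∀ f ∈ T, ∀ d, f.coeff d ∈ k

/-- A code determines its variety, so the point chosen for one variety with that code serves for
every such variety. -/
theorem IsCodedBy.unique {k : IntermediateField ℚ K} {n : ℕ}
    {T : Finset (MvPolynomial (Fin n ⊕ Fin n) K)} {V W : Set (Fin n ⊕ Fin n → K)}
    (hV : IsCodedBy k T V) (hW : IsCodedBy k T W) : V = W := by
  ext p
  rw [hV.irred.mem_iff, hW.irred.mem_iff, hV.ideal_eq, hW.ideal_eq]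

theorem exists_map_eq {k : IntermediateField ℚ K} {σ : Type*} {f : MvPolynomial σ K}
    (hf : ∀ d, f.coeff d ∈ k) : ∃ g : MvPolynomial σ k, MvPolynomial.map (algebraMap k K) g = f := by
  have : f ∈ Set.range (MvPolynomial.map (σ := σ) (algebraMap k K)) := by
    rw [MvPolynomial.mem_range_map_iff_coeffs_subset]
    intro x hx
    obtain ⟨d, -, rfl⟩ := MvPolynomial.mem_coeffs_iff.1 hx
    exact ⟨⟨_, hf d⟩, rfl⟩
  exact this

theorem exists_isFreePoint_of_code [IsAlgClosed K] {k L M : IntermediateField ℚ K} (hkL : k ≤ L)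
    {τ : ℕ → K} (hτ : AlgebraicIndependent L τ) (hM : acl (k ∪ range τ) ≤ M)
    (T : Σ n, Finset (MvPolynomial (Fin n ⊕ Fin n) K)) :
    ∃ q : Σ n, (Fin n ⊕ Fin n → K), IsFreePoint L M q.2 ∧ ∀ V, IsCodedBy k T.2 V →
      ∃ p, q = ⟨T.1, p⟩ ∧ IsGenericIn p V (L : Set K) := by
  by_cases hex : ∃ V, IsCodedBy k T.2 V
  · obtain ⟨V, hV⟩ := hex
    have hS : MvPolynomial.vanishingIdeal K V = Ideal.span (MvPolynomial.map (algebraMap k K) ''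
        (MvPolynomial.map (algebraMap k K) ⁻¹' (T.2 : Set (MvPolynomial _ K)))) := by
      rw [hV.ideal_eq, image_preimage_eq_of_subset]
      intro f hf
      exact exists_map_eq (hV.coeff_mem f hf)
    obtain ⟨p, hp, hpM⟩ := exists_isGenericIn hV.irred hkL hS hτ
    refine ⟨⟨T.1, p⟩, ⟨fun i => hM (hpM i), hV.irred.inr_ne_zero hp.1, fun m hm => ?_,
      fun m hm => ?_, fun r m hm => hp.le_relRank hV.irred hV.rotund hm⟩, fun W hW =>
      ⟨p, rfl, hV.unique hW ▸ hp⟩⟩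
    · exact hp.eq_zero_of_sum_mem hV.addFree (by rwa [IntermediateField.adjoin_self])
    · exact hp.eq_zero_of_prod_mem hV.irred hV.mulFree (by rwa [IntermediateField.adjoin_self])
  -- A code without a variety receives the empty tuple, for which all conditions are void, so every
  -- slot carries a block.
  · refine ⟨⟨0, fun _ => 0⟩, ⟨fun _ => zero_mem M, fun i => i.elim0,
      fun m _ => Subsingleton.elim _ _, fun m _ => Subsingleton.elim _ _, fun r m hm => ?_⟩,
      fun V hV => (hex ⟨V, hV⟩).elim⟩
    have hr : r = 0 := by
      by_contra h
      exact hm.ne_zero (⟨0, Nat.pos_of_ne_zero h⟩ : Fin r) (Subsingleton.elim _ _)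
    subst hr
    simp

end FreePoints

/-! ### Cardinal arithmetic for matching elements with generators -/

section Matching

theorem mk_nat_prod_prod_bool (F : Type u) [Infinite F] :
    Cardinal.mk (ℕ × F × Bool) = Cardinal.mk F := by
  have h : Cardinal.aleph0 ≤ Cardinal.mk F := Cardinal.aleph0_le_mk F
  have h1 : Cardinal.mk (F × Bool) = Cardinal.mk F := by
    rw [Cardinal.mk_prod, Cardinal.lift_uzero, Cardinal.mk_bool, Cardinal.lift_ofNat]
    exact Cardinal.mul_eq_left h ((Cardinal.natCast_lt_aleph0 (n := 2)).le.trans h) two_ne_zero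
  rw [Cardinal.mk_prod, h1]
  simp

theorem exists_injective_with_fst {F B : Type u} [Infinite F]
    (f : B → F) (hf : Function.Injective f) (r : B → ℕ) :
    ∃ φ : B → ℕ × F × Bool, Function.Injective φ ∧ (∀ x, (φ x).1 = r x) ∧
      Cardinal.mk ((range φ)ᶜ : Set (ℕ × F × Bool)) = Cardinal.mk F := by
  -- The first coordinate will be the level; the Boolean leaves a complement of full size, from
  -- which the exponentially transcendental elements come.
  refine ⟨fun x => (r x, f x, true), fun x y h => hf (congrArg (fun a => a.2.1) h),
    fun _ => rfl, le_antisymm ?_ ?_⟩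
  · exact (Cardinal.mk_set_le _).trans (mk_nat_prod_prod_bool F).le
  · have hm : ∀ a : F, ((0, a, false) : ℕ × F × Bool) ∈ (range fun x => (r x, f x, true))ᶜ := by
      rintro a ⟨x, hx⟩
      exact Bool.noConfusion (congrArg (fun a => a.2.2) hx)
    refine Cardinal.mk_le_of_injective (f := fun a : F => (⟨_, hm a⟩ :
      ((range fun x => (r x, f x, true))ᶜ : Set (ℕ × F × Bool)))) fun a b h => ?_
    exact congrArg (fun a => a.1.2.1) h

end Matching

end ExpFld

namespace ExpFld

open AlgebraicIndependent Set Module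

/-! ### Block systems ordered by level -/

section BlockSystems

variable {F : Type*} {K : Type u} [Field F] [Field K] [CharZero K] [Algebra F K] {Θ : Type*}

/-- A family of finite tuples, together with `F` spanning `K`, each of which satisfies the
predimension inequalities over a field containing all the other tuples of at most its level. -/
structure IsBlockSystem (F : Type*) [Field F] [Algebra F K] (t : Θ → K) (lev : Θ → ℕ)
    (e : AddChar K K) {ι : Type*} (bl : ι → Σ n, (Fin n → K)) (supp : ι → Set Θ)
    (lvl : ι → ℕ) : Prop where
  eq_of_mem : ∀ i j θ, θ ∈ supp i → θ ∈ supp j → i = j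
  lvl_le : ∀ i, ∀ θ ∈ supp i, lvl i ≤ lev θ + 1
  mem : ∀ i k, (bl i).2 k ∈ fieldAt F t ({θ | lev θ + 1 < lvl i} ∪ supp i)
  exp_mem : ∀ i k, e ((bl i).2 k) ∈ fieldAt F t ({θ | lev θ + 1 < lvl i} ∪ supp i)
  le_relRank : ∀ i (r : ℕ) (m : Fin r → Fin (bl i).1 → ℤ), LinearIndependent ℤ m →
    (r : ℕ∞) ≤ relRank (fieldAt F t (supp i)ᶜ : Set K)
      (expHull e (range fun k => ∑ j, (m k j : K) * (bl i).2 j))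
  span_eq : Submodule.span ℚ (range (algebraMap F K) ∪ {x | ∃ i k, (bl i).2 k = x}) = ⊤

variable {t : Θ → K} {lev : Θ → ℕ} {e : AddChar K K} {ι : Type*} {bl : ι → Σ n, (Fin n → K)}
  {supp : ι → Set Θ} {lvl : ι → ℕ}

/-- Block `j` depends on its own support, disjoint from that of `i`, and on generators whose level
is too low to occur in the support of `i`. -/
theorem IsBlockSystem.mem_expCore (h : IsBlockSystem F t lev e bl supp lvl) {i j : ι}
    (hji : j ≠ i) (hl : lvl j ≤ lvl i) (k : Fin (bl j).1) :
    (bl j).2 k ∈ expCore e (fieldAt F t (supp i)ᶜ : Set K) := by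
  have hsub : {θ | lev θ + 1 < lvl j} ∪ supp j ⊆ (supp i)ᶜ := by
    rintro θ (hθ | hθ) hi
    · exact absurd (h.lvl_le i θ hi) (not_le.2 (lt_of_lt_of_le hθ hl))
    · exact hji (h.eq_of_mem _ _ _ hθ hi)
  rw [ExpFld.mem_expCore, acl_fieldAt]
  exact ⟨fieldAt_mono hsub (h.mem j k), fieldAt_mono hsub (h.exp_mem j k)⟩

/-- Blocks of level `0` lie in the field of every other block, so any set `P` of them may be moved
into the base. The case of empty `P` gives strongness of `F`; the pairs `(u, exp u)` give
exponential independence. -/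
theorem IsBlockSystem.isStrong (h : IsBlockSystem F t lev e bl supp lvl)
    (he : ∀ x : F, e (algebraMap F K x) ∈ range (algebraMap F K)) {P : Set ι}
    (hP : ∀ i ∈ P, lvl i = 0) :
    IsStrong e (Submodule.span ℚ
      (range (algebraMap F K) ∪ {x | ∃ i ∈ P, ∃ k, (bl i).2 k = x}) : Set K) := by
  refine isStrong_of_blocks (ι := {i // i ∉ P}) (sz := fun i => (bl i).1)
    (b := fun i => (bl i).2) (lvl := fun i => lvl i)
    (L := fun i => fieldAt F t (supp i)ᶜ) ?_ ?_ ?_ ?_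
  · rintro ⟨i, hi⟩
    refine Submodule.span_le.2 (union_subset ?_ ?_)
    · rintro _ ⟨x, rfl⟩
      obtain ⟨y, hy⟩ := he x
      rw [SetLike.mem_coe, ExpFld.mem_expCore, acl_fieldAt, ← hy]
      exact ⟨algebraMap_mem_fieldAt _ _, algebraMap_mem_fieldAt _ _⟩
    · rintro _ ⟨j, hj, k, rfl⟩
      exact h.mem_expCore (fun hji : j = i => hi (hji ▸ hj)) ((hP j hj).trans_le (Nat.zero_le _)) k
  · rintro i j hji hl k
    exact h.mem_expCore (fun hji' => hji (Subtype.ext hji')) hl k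
  · rintro i r m hm
    exact h.le_relRank i r m hm
  · rw [eq_top_iff, ← h.span_eq, Submodule.span_le]
    rintro x (hx | ⟨i, k, rfl⟩)
    · exact Submodule.mem_sup_left (Submodule.subset_span (Or.inl hx))
    · by_cases hi : i ∈ P
      · exact Submodule.mem_sup_left (Submodule.subset_span (Or.inr ⟨i, hi, k, rfl⟩))
      · exact Submodule.mem_sup_right (Submodule.mem_iSup_of_mem ⟨i, hi⟩
          (Submodule.subset_span (mem_range_self k)))

theorem le_relRank_expHull_of_notMem {L : IntermediateField ℚ K} (hL : acl (L : Set K) = L)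
    {u : K} (h : u ∉ L ∨ e u ∉ L) (r : ℕ) (m : Fin r → Fin 1 → ℤ) (hm : LinearIndependent ℤ m) :
    (r : ℕ∞) ≤ relRank (L : Set K) (expHull e (range fun k => ∑ j, (m k j : K) * u)) := by
  have hr : r ≤ 1 := by simpa using hm.fintype_card_le_finrank
  obtain rfl | rfl : r = 0 ∨ r = 1 := by omega
  · simp
  · have hm0 : m 0 0 ≠ 0 := fun h0 => hm.ne_zero 0 (by
      ext j
      rw [Subsingleton.elim j 0, h0]
      rfl)
    have hy : (m 0 0 : K) * u ∈ range fun k => ∑ j, (m k j : K) * u := ⟨0, by simp⟩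
    rw [Nat.cast_one]
    rcases h with h | h
    · refine one_le_relRank (Or.inl hy) ?_
      rw [hL]
      intro hmem
      refine h ?_
      rw [← mul_div_cancel_left₀ u (Int.cast_ne_zero.2 hm0 : (m 0 0 : K) ≠ 0)]
      exact div_mem hmem (intCast_mem _ _)
    · refine one_le_relRank (Or.inr ⟨_, hy, rfl⟩) ?_
      rw [hL, addChar_intCast_mul]
      intro hmem
      refine hm0 (eq_zero_of_smul_mem_mulInt hL
        (y := Additive.ofMul (Units.mk0 (e u) (addChar_ne_zero e u))) h ?_)
      rw [mem_mulInt]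
      change ((Units.mk0 (e u) (addChar_ne_zero e u) ^ m 0 0 : Kˣ) : K) ∈ L
      rwa [Units.val_zpow_eq_zpow_val]

end BlockSystems

/-! ### The generators and their levels -/

section Generators

variable {F : Type u}

/-- The index set of the transcendence basis: a countable stock for each of the variety slots, and
two families of auxiliary elements. Every index has a level. -/
abbrev Gens (F : Type u) : Type u := ((ℕ × F) × ℕ) ⊕ ((ℕ × F × Bool) ⊕ (ℕ × F × Bool))

/-- The level of a generator. -/
def Gens.level : Gens F → ℕ :=
  Sum.elim (fun a => a.1.1) (Sum.elim (fun a => a.1) (fun a => a.1))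

/-- The generators reserved for a variety slot. -/
def Gens.slot (v : ℕ × F) : Set (Gens F) := range fun n => Sum.inl (v, n)

theorem Gens.mk_eq [Infinite F] : Cardinal.mk (Gens F) = Cardinal.mk F := by
  have h := Cardinal.aleph0_le_mk F
  have h1 : Cardinal.mk ((ℕ × F) × ℕ) = Cardinal.mk F := by
    simp [Cardinal.mk_prod]
  rw [Cardinal.mk_sum, Cardinal.mk_sum, h1, mk_nat_prod_prod_bool]
  simp [Cardinal.add_eq_self h]

theorem Gens.eq_of_mem_slot {v w : ℕ × F} {θ : Gens F} (hv : θ ∈ Gens.slot v)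
    (hw : θ ∈ Gens.slot w) : v = w := by
  obtain ⟨n, rfl⟩ := hv
  obtain ⟨m, hm⟩ := hw
  exact (congrArg Prod.fst (Sum.inl_injective hm)).symm

theorem Gens.level_of_mem_slot {v : ℕ × F} {θ : Gens F} (hv : θ ∈ Gens.slot v) :
    θ.level = v.1 := by
  obtain ⟨n, rfl⟩ := hv
  rfl

end Generators

end ExpFld

namespace ExpFld

open AlgebraicIndependent Set Module

/-! ### Independence of the prescribed arguments and values -/

section Construction

variable {F K : Type u} [Field F] [Field K] [CharZero K] [Algebra F K] {t : Gens F → K}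

theorem exists_mem_fieldAt_level (ht : IsTranscendenceBasis F t) (x : K) :
    ∃ n, x ∈ fieldAt F t {θ | θ.level < n} := by
  obtain ⟨S, hS, hx⟩ := exists_finite_mem_fieldAt ht x
  obtain ⟨n, hn⟩ := (hS.image Gens.level).bddAbove
  exact ⟨n + 1, fieldAt_mono (fun θ hθ => Nat.lt_succ_of_le (hn (mem_image_of_mem _ hθ))) hx⟩

theorem fieldAt_slot_le {v w : ℕ × F} (hne : w ≠ v) (hl : w.1 ≤ v.1) :
    fieldAt F t ({θ | θ.level < w.1} ∪ Gens.slot w) ≤ fieldAt F t (Gens.slot v)ᶜ := by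
  refine fieldAt_mono ?_
  rintro θ (hθ | hθ) hv
  · exact absurd (hθ : θ.level < w.1) (not_lt.2 (hl.trans (Gens.level_of_mem_slot hv).ge))
  · exact hne (Gens.eq_of_mem_slot hθ hv)

theorem addPart_le_addInt (S : Set (Gens F)) : addPart F K ≤ addInt (fieldAt F t S) := by
  rintro _ ⟨x, rfl⟩
  exact algebraMap_mem_fieldAt S x

theorem mulPart_le_mulInt (S : Set (Gens F)) : mulPart F K ≤ mulInt (fieldAt F t S) := by
  intro y hy
  obtain ⟨x, hx⟩ := mem_mulPart.1 hy
  rw [mem_mulInt, ← hx]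
  exact algebraMap_mem_fieldAt S x

variable {q : ℕ × F → Σ n, (Fin n ⊕ Fin n → K)}

/-- The auxiliary generators lie outside every slot, so they can be absorbed into the base over
which the slots are compared. Slot points are then independent by additive freeness, block by block
in order of level. -/
theorem linearIndependent_add_family (ht : AlgebraicIndependent F t)
    (hq : ∀ v, IsFreePoint (fieldAt F t (Gens.slot v)ᶜ)
      (fieldAt F t ({θ | θ.level < v.1} ∪ Gens.slot v)) (q v).2) :
    LinearIndependent ℤ fun j => (addPart F K).mkQ
      (Sum.elim (fun α => t (.inr (.inr α)))
        (fun a : Σ v, Fin (q v).1 => (q a.1).2 (.inl a.2)) j) := by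
  refine linearIndependent_sumElim_mkQ ?_ ?_
  · refine linearIndependent_of_notMem
      (fun α => addInt (fieldAt F t ({.inr (.inr α)}ᶜ : Set (Gens F))))
      (fun α => addPart_le_addInt _) (fun α β hne => ?_) (fun α N hN => ?_)
    · refine apply_mem_fieldAt ?_
      simpa using hne
    · exact eq_zero_of_smul_mem_addInt (notMem_fieldAt ht (by simp)) hN
  · refine linearIndependent_of_blocks (sz := fun v => (q v).1)
      (H := fun v => addInt (fieldAt F t (Gens.slot v)ᶜ)) (fun v => v.1) (fun v => ?_)
      (fun v w hne hl k => fieldAt_slot_le hne hl ((hq w).mem _)) (fun v m hm => ?_)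
    · refine sup_le (addPart_le_addInt _) (Submodule.span_le.2 ?_)
      rintro _ ⟨α, rfl⟩
      refine apply_mem_fieldAt ?_
      simp [Gens.slot]
    · refine (hq v).eq_zero_of_sum_mem m ?_
      simpa only [zsmul_eq_mul] using mem_addInt.1 hm

theorem linearIndependent_mul_family (ht : AlgebraicIndependent F t) (ht0 : ∀ θ, t θ ≠ 0)
    (hq : ∀ v, IsFreePoint (fieldAt F t (Gens.slot v)ᶜ)
      (fieldAt F t ({θ | θ.level < v.1} ∪ Gens.slot v)) (q v).2) :
    LinearIndependent ℤ fun j => (mulPart F K).mkQ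
      (Sum.elim (fun α => Additive.ofMul (Units.mk0 (t (.inr (.inl α))) (ht0 _)))
        (fun a : Σ v, Fin (q v).1 => Additive.ofMul
          (Units.mk0 ((q a.1).2 (.inr a.2)) ((hq a.1).ne_zero a.2))) j) := by
  refine linearIndependent_sumElim_mkQ ?_ ?_
  · refine linearIndependent_of_notMem
      (fun α => mulInt (fieldAt F t ({.inr (.inl α)}ᶜ : Set (Gens F))))
      (fun α => mulPart_le_mulInt _) (fun α β hne => ?_) (fun α N hN => ?_)
    · refine apply_mem_fieldAt (F := F) ?_
      simpa using hne
    · refine eq_zero_of_smul_mem_mulInt (acl_fieldAt _) (fun hm => ?_) hN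
      exact notMem_fieldAt ht (by simp) (mem_mulInt.1 hm)
  · refine linearIndependent_of_blocks (sz := fun v => (q v).1)
      (H := fun v => mulInt (fieldAt F t (Gens.slot v)ᶜ)) (fun v => v.1) (fun v => ?_)
      (fun v w hne hl k => fieldAt_slot_le hne hl ((hq w).mem _)) (fun v m hm => ?_)
    · refine sup_le (mulPart_le_mulInt _) (Submodule.span_le.2 ?_)
      rintro _ ⟨α, rfl⟩
      refine apply_mem_fieldAt (F := F) ?_
      simp [Gens.slot]
    · refine (hq v).eq_zero_of_prod_mem m ?_
      have := mem_mulInt.1 hm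
      rw [toMul_sum, Units.coe_prod] at this
      simpa using this

theorem completion_comp_bijective {G J J' : Type*} [AddCommGroup G] {D : Submodule ℤ G}
    {x : J → G} {x' : J' → G} {ε : J' → J} (hε : Function.Bijective ε) (hx : ∀ j, x (ε j) = x' j)
    (hind : LinearIndependent ℤ fun j => D.mkQ (x j))
    (hspan : ∀ y, ∃ N : ℤ, N ≠ 0 ∧ N • y ∈ Submodule.span ℤ (range fun j => D.mkQ (x j))) :
    (LinearIndependent ℤ fun j => D.mkQ (x' j)) ∧
      ∀ y, ∃ N : ℤ, N ≠ 0 ∧ N • y ∈ Submodule.span ℤ (range fun j => D.mkQ (x' j)) := by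
  obtain rfl : x' = x ∘ ε := funext fun j => (hx j).symm
  refine ⟨hind.comp ε hε.injective, fun y => ?_⟩
  have : (range fun j => D.mkQ ((x ∘ ε) j)) = range fun j => D.mkQ (x j) :=
    hε.surjective.range_comp fun j => D.mkQ (x j)
  rw [this]
  exact hspan y

/-- On one side of the exponential, `A` indexes the slot coordinates, `C` the completing elements
and `N` the auxiliary generators. `B` indexes the completing elements of the other side, each paired
by `φ` with a generator of this side; `U` takes up the generators left over. -/
theorem bijective_matching {A B C N : Type*} {φ : B → N} (hφ : Function.Injective φ)
    {U : Type*} {σ : U → N} (hσ : Function.Injective σ) (hr : range σ = (range φ)ᶜ) :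
    Function.Bijective (Sum.elim (fun a => Sum.inl (Sum.inr a))
      (Sum.elim Sum.inr (Sum.elim (fun y => Sum.inl (Sum.inl (φ y)))
        (fun α => Sum.inl (Sum.inl (σ α))))) : A ⊕ (C ⊕ (B ⊕ U)) → (N ⊕ A) ⊕ C) := by
  have hd : ∀ y α, φ y ≠ σ α := fun y α h =>
    (hr ▸ mem_range_self α : σ α ∈ (range φ)ᶜ) ⟨y, h⟩
  constructor
  · rintro (a | c | y | α) (a' | c' | y' | α') h <;>
      simp [hφ.eq_iff, hσ.eq_iff, hd, (hd _ _).symm] at h ⊢ <;> exact h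
  · rintro ((n | a) | c)
    · by_cases hn : n ∈ range φ
      · obtain ⟨y, rfl⟩ := hn
        exact ⟨.inr (.inr (.inl y)), rfl⟩
      · obtain ⟨α, rfl⟩ : n ∈ range σ := hr ▸ hn
        exact ⟨.inr (.inr (.inr α)), rfl⟩
    · exact ⟨.inl a, rfl⟩
    · exact ⟨.inr (.inl c), rfl⟩

end Construction

end ExpFld

namespace ExpFld

open AlgebraicIndependent Set Module

/-! ### The exponential map of the extension and its block system -/

section Construction

theorem span_union_eq_top_of_torsion {F K : Type*} [Field F] [Field K] [CharZero K] [Algebra F K]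
    {J : Type*} {b : J → K} {T : Set K} (hb : ∀ j, b j ∈ T)
    (hbs : ∀ x, ∃ N : ℤ, N ≠ 0 ∧
      N • x ∈ Submodule.span ℤ (range fun j => (addPart F K).mkQ (b j))) :
    Submodule.span ℚ (range (algebraMap F K) ∪ T) = ⊤ := by
  rw [eq_top_iff]
  rintro x -
  obtain ⟨N, hN, hNx⟩ := hbs ((addPart F K).mkQ x)
  rw [← map_zsmul] at hNx
  obtain ⟨d, hd, m, hm⟩ := exists_eq_add_linearCombination hNx
  have hN' : (N : ℚ) ≠ 0 := Int.cast_ne_zero.2 hN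
  rw [← Submodule.smul_mem_iff _ hN']
  have h1 : (N : ℚ) • x = d + Finsupp.linearCombination ℤ b m := by
    rw [← hm, Int.cast_smul_eq_zsmul]
  rw [h1]
  refine add_mem (Submodule.subset_span (Or.inl (mem_addPart.1 hd))) ?_
  rw [Finsupp.linearCombination_apply]
  refine Submodule.sum_mem _ fun j _ => ?_
  change m j • b j ∈ _
  rw [← Int.cast_smul_eq_zsmul ℚ]
  exact Submodule.smul_mem _ _ (Submodule.subset_span (Or.inr (hb j)))

theorem addChar_sum_intCast_mul {K : Type*} [Field K] (e : AddChar K K) {ι : Type*} (s : Finset ι)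
    (m : ι → ℤ) (x : ι → K) : e (∑ j ∈ s, (m j : K) * x j) = ∏ j ∈ s, e (x j) ^ m j := by
  classical
  induction s using Finset.induction_on with
  | empty => simp
  | insert a s ha ih =>
    rw [Finset.sum_insert ha, Finset.prod_insert ha, AddChar.map_add_eq_mul, ih,
      addChar_intCast_mul]

variable {F K : Type u} [Field F] [Field K] [CharZero K] [Algebra F K] {t : Gens F → K}
  {q : ℕ × F → Σ n, (Fin n ⊕ Fin n → K)}

theorem eq_of_mem_supports {F B C U : Type*} {φ : B → ℕ × F × Bool} {ψ : C → ℕ × F × Bool}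
    {σ τ : U → ℕ × F × Bool} (hφ : Function.Injective φ) (hψ : Function.Injective ψ)
    (hσ : Function.Injective σ) (hτ : Function.Injective τ) (hφτ : ∀ x α, φ x ≠ τ α)
    (hψσ : ∀ y α, ψ y ≠ σ α) {supp : (ℕ × F) ⊕ (B ⊕ (C ⊕ U)) → Set (Gens F)}
    (hsupp : supp = Sum.elim Gens.slot (Sum.elim (fun x => {.inr (.inl (φ x))})
      (Sum.elim (fun y => {.inr (.inr (ψ y))}) fun α => {.inr (.inl (τ α)), .inr (.inr (σ α))})))
    (i j) (θ : Gens F) (h : θ ∈ supp i) (h' : θ ∈ supp j) : i = j := by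
  subst hsupp
  rcases i with v | x | y | α <;> rcases j with v' | x' | y' | α' <;>
    simp only [Gens.slot, Sum.elim_inl, Sum.elim_inr, mem_range, mem_singleton_iff,
      mem_insert_iff] at h h'
  on_goal 1 => exact congrArg _ (Gens.eq_of_mem_slot h h')
  all_goals grind [Function.Injective]

/-- Four kinds of pairs (argument, value) are prescribed: the two halves of a slot point; a
completing additive element with a fresh generator; a fresh generator with a completing
multiplicative element; and, indexed by `U`, two generators. They exhaust a maximal independent
family on either side. -/
theorem exists_exponential [IsAlgClosed K] (ht : IsTranscendenceBasis F t) {e : AddChar F F}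
    (hF : IsELA e) (hcard : Cardinal.mk K = Cardinal.mk F)
    (hq : ∀ v, IsFreePoint (fieldAt F t (Gens.slot v)ᶜ)
      (fieldAt F t ({θ | θ.level < v.1} ∪ Gens.slot v)) (q v).2) :
    ∃ e' : AddChar K K, (∀ x, e' (algebraMap F K x) = algebraMap F K (e x)) ∧
      (∀ x, e' x = 1 → x ∈ range (algebraMap F K)) ∧ (∀ y, y ≠ 0 → ∃ x, e' x = y) ∧
      (∀ v i, e' ((q v).2 (.inl i)) = (q v).2 (.inr i)) ∧
      ∃ (ι : Type u) (bl : ι → Σ n, (Fin n → K)) (supp : ι → Set (Gens F)) (lvl : ι → ℕ)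
        (U : Type u) (j : U → ι) (u : U → K), IsBlockSystem F t Gens.level e' bl supp lvl ∧
        Cardinal.mk U = Cardinal.mk F ∧ Function.Injective u ∧
        ∀ α, lvl (j α) = 0 ∧ bl (j α) = ⟨1, fun _ => u α⟩ ∧
          2 ≤ relRank (fieldAt F t (supp (j α))ᶜ : Set K) {u α, e' (u α)} := by
  have _ : CharZero F := (algebraMap F K).charZero
  have _ : Infinite F := Infinite.of_injective ((↑) : ℕ → F) Nat.cast_injective
  have ht0 : ∀ θ, t θ ≠ 0 := ht.1.ne_zero
  obtain ⟨B, wB, hB, hBs⟩ := exists_completion_mkQ (linearIndependent_add_family ht.1 hq)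
  obtain ⟨C, wC, hC, hCs⟩ := exists_completion_mkQ (linearIndependent_mul_family ht.1 ht0 hq)
  obtain ⟨κ⟩ := Cardinal.eq.1 hcard
  have hwB : Function.Injective wB := fun x y h =>
    Sum.inr_injective (hB.injective (by simp only [Sum.elim_inr, h]))
  have hwC : Function.Injective fun y => ((Additive.toMul (wC y) : Kˣ) : K) := fun x y h =>
    Sum.inr_injective (hC.injective (by
      have : wC x = wC y := Additive.toMul.injective (Units.ext h)
      simp only [Sum.elim_inr, this]))
  choose rk hrk using exists_mem_fieldAt_level (F := F) (K := K) ht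
  -- The generator paired with a completing element has level `rk` of that element, strictly above
  -- all generators the element needs.
  obtain ⟨φ, hφ, hφr, hφc⟩ := exists_injective_with_fst _ (κ.injective.comp hwB)
    fun x => rk (wB x)
  obtain ⟨ψ, hψ, hψr, hψc⟩ := exists_injective_with_fst _ (κ.injective.comp hwC)
    fun y => rk ((Additive.toMul (wC y) : Kˣ) : K)
  let U : Type u := ↥(range φ)ᶜ
  obtain ⟨σ'⟩ := Cardinal.eq.1 (hφc.trans hψc.symm)
  let σ : U → ℕ × F × Bool := fun α => σ' α
  have hσ : Function.Injective σ := Subtype.val_injective.comp σ'.injective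
  have hσr : range σ = (range ψ)ᶜ := by
    rw [show σ = Subtype.val ∘ σ' from rfl, σ'.surjective.range_comp, Subtype.range_coe]
  -- the two families on a common index set
  let V := Σ v, Fin (q v).1
  let I := V ⊕ (B ⊕ (C ⊕ U))
  let b : I → K := Sum.elim (fun a => (q a.1).2 (.inl a.2)) (Sum.elim wB
    (Sum.elim (fun y => t (.inr (.inr (ψ y)))) fun α => t (.inr (.inr (σ α)))))
  let c : I → Kˣ := Sum.elim (fun a => Units.mk0 ((q a.1).2 (.inr a.2)) ((hq a.1).ne_zero a.2))
    (Sum.elim (fun x => Units.mk0 (t (.inr (.inl (φ x)))) (ht0 _))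
    (Sum.elim (fun y => Additive.toMul (wC y))
      fun α => Units.mk0 (t (.inr (.inl α.1))) (ht0 _)))
  obtain ⟨hb, hbs⟩ := completion_comp_bijective (x' := b)
    (bijective_matching (A := V) (C := B) hψ hσ hσr)
    (by rintro (a | x | y | α) <;> rfl) hB hBs
  let swap : I ≃ V ⊕ (C ⊕ (B ⊕ U)) := (Equiv.refl V).sumCongr
    (((Equiv.sumAssoc B C U).symm.trans ((Equiv.sumComm B C).sumCongr (Equiv.refl U))).trans
      (Equiv.sumAssoc C B U))
  obtain ⟨hc, hcs⟩ := completion_comp_bijective (x' := fun j => Additive.ofMul (c j))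
    ((bijective_matching (A := V) (C := C) hφ
      (Subtype.val_injective (p := (· ∈ (range φ)ᶜ))) Subtype.range_coe).comp swap.bijective)
    (by rintro (a | x | y | α) <;> rfl) hC hCs
  obtain ⟨e', he'F, he'b, he'k, he's⟩ := exists_addChar_extension hF hb hbs hc hcs
  let bl : (ℕ × F) ⊕ (B ⊕ (C ⊕ U)) → Σ n, (Fin n → K) :=
    Sum.elim (fun v => ⟨(q v).1, fun k => (q v).2 (.inl k)⟩) (Sum.elim (fun x => ⟨1, fun _ => wB x⟩)
      (Sum.elim (fun y => ⟨1, fun _ => t (.inr (.inr (ψ y)))⟩)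
        fun α => ⟨1, fun _ => t (.inr (.inr (σ α)))⟩))
  let supp : (ℕ × F) ⊕ (B ⊕ (C ⊕ U)) → Set (Gens F) :=
    Sum.elim Gens.slot (Sum.elim (fun x => {.inr (.inl (φ x))})
      (Sum.elim (fun y => {.inr (.inr (ψ y))}) fun α => {.inr (.inl α.1), .inr (.inr (σ α))}))
  -- The shift by one frees level `0` for the `U`-blocks, which depend on nothing but their own two
  -- generators.
  let lvl : (ℕ × F) ⊕ (B ⊕ (C ⊕ U)) → ℕ := Sum.elim (fun v => v.1 + 1)
    (Sum.elim (fun x => (φ x).1 + 1) (Sum.elim (fun y => (ψ y).1 + 1) fun _ => 0))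
  have heV : ∀ v k, e' ((q v).2 (.inl k)) = (q v).2 (.inr k) := fun v k => he'b (.inl ⟨v, k⟩)
  have heVmem : ∀ v k, e' ((q v).2 (.inl k)) ∈
      fieldAt F t ({θ | θ.level < v.1} ∪ Gens.slot v) := fun v k => by
    rw [heV]
    exact (hq v).mem _
  have heB : ∀ x, e' (wB x) = t (.inr (.inl (φ x))) := fun x => he'b (.inr (.inl x))
  have heC : ∀ y, e' (t (.inr (.inr (ψ y)))) = ((Additive.toMul (wC y) : Kˣ) : K) :=
    fun y => he'b (.inr (.inr (.inl y)))
  have heU : ∀ α : U, e' (t (.inr (.inr (σ α)))) = t (.inr (.inl α.1)) :=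
    fun α => he'b (.inr (.inr (.inr α)))
  have hdφ : ∀ x (α : U), φ x ≠ α.1 := fun x α h => α.2 ⟨x, h⟩
  have hdψ : ∀ y α, ψ y ≠ σ α := fun y α h =>
    (hσr ▸ mem_range_self α : σ α ∈ (range ψ)ᶜ) ⟨y, h⟩
  have hindV : ∀ v (r : ℕ) (m : Fin r → Fin (q v).1 → ℤ), LinearIndependent ℤ m →
      (r : ℕ∞) ≤ relRank (fieldAt F t (Gens.slot v)ᶜ : Set K)
        (expHull e' (range fun k => ∑ j, (m k j : K) * (q v).2 (.inl j))) := fun v r m hm => by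
    refine ((hq v).le_relRank r m hm).trans (relRank_mono ?_)
    refine Subset.trans ?_ (subset_union_right.trans (subset_acl _))
    refine union_subset_union_right _ ?_
    rintro _ ⟨k, rfl⟩
    refine ⟨_, mem_range_self k, ?_⟩
    rw [addChar_sum_intCast_mul]
    exact Finset.prod_congr rfl fun j _ => by rw [heV]
  have hindB : ∀ x (r : ℕ) (m : Fin r → Fin 1 → ℤ), LinearIndependent ℤ m →
      (r : ℕ∞) ≤ relRank (fieldAt F t ({.inr (.inl (φ x))}ᶜ : Set (Gens F)) : Set K)
        (expHull e' (range fun k => ∑ j, (m k j : K) * wB x)) := fun x =>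
    le_relRank_expHull_of_notMem (acl_fieldAt _) (Or.inr (by
      rw [heB]
      exact notMem_fieldAt_compl ht.1 rfl))
  have hindC : ∀ y (r : ℕ) (m : Fin r → Fin 1 → ℤ), LinearIndependent ℤ m →
      (r : ℕ∞) ≤ relRank (fieldAt F t ({.inr (.inr (ψ y))}ᶜ : Set (Gens F)) : Set K)
        (expHull e' (range fun k => ∑ j, (m k j : K) * t (.inr (.inr (ψ y))))) := fun y =>
    le_relRank_expHull_of_notMem (acl_fieldAt _) (Or.inl (notMem_fieldAt_compl ht.1 rfl))
  have hindU : ∀ (α : U) (r : ℕ) (m : Fin r → Fin 1 → ℤ), LinearIndependent ℤ m →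
      (r : ℕ∞) ≤ relRank (fieldAt F t
          ({.inr (.inl α.1), .inr (.inr (σ α))}ᶜ : Set (Gens F)) : Set K)
        (expHull e' (range fun k => ∑ j, (m k j : K) * t (.inr (.inr (σ α))))) := fun α =>
    le_relRank_expHull_of_notMem (acl_fieldAt _)
      (Or.inl (notMem_fieldAt_compl ht.1 (Or.inr rfl)))
  have hsys : IsBlockSystem F t Gens.level e' bl supp lvl := by
    refine ⟨?_, ?_, ?_, ?_, ?_, ?_⟩
    · exact eq_of_mem_supports hφ hψ hσ Subtype.val_injective hdφ hdψ rfl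
    · rintro (v | x | y | α) θ h
      · exact (congrArg (· + 1) (Gens.level_of_mem_slot h).symm).le
      · rw [show θ = _ from h]
        rfl
      · rw [show θ = _ from h]
        rfl
      · exact Nat.zero_le _
    · rintro (v | x | y | α) k
      · exact fieldAt_mono (union_subset_union_left _ fun θ hθ => Nat.succ_lt_succ hθ)
          ((hq v).mem _)
      · refine fieldAt_mono (subset_union_of_subset_left (fun θ hθ => ?_) _) (hrk (wB x))
        rw [← hφr] at hθ
        exact Nat.succ_lt_succ hθ
      · exact apply_mem_fieldAt (Or.inr rfl)
      · exact apply_mem_fieldAt (Or.inr (Or.inr rfl))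
    · rintro (v | x | y | α) k
      · exact fieldAt_mono (union_subset_union_left _ fun θ hθ => Nat.succ_lt_succ hθ)
          (heVmem v k)
      · change e' (wB x) ∈ _
        rw [heB]
        exact apply_mem_fieldAt (Or.inr rfl)
      · change e' (t (.inr (.inr (ψ y)))) ∈ _
        rw [heC]
        refine fieldAt_mono (subset_union_of_subset_left (fun θ hθ => ?_) _) (hrk _)
        rw [← hψr] at hθ
        exact Nat.succ_lt_succ hθ
      · change e' (t (.inr (.inr (σ α)))) ∈ _
        rw [heU]
        exact apply_mem_fieldAt (Or.inr (Or.inl rfl))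
    · rintro (v | x | y | α) r m hm
      · exact hindV v r m hm
      · exact hindB x r m hm
      · exact hindC y r m hm
      · exact hindU α r m hm
    · refine span_union_eq_top_of_torsion (b := b) ?_ hbs
      rintro (a | x | y | α)
      · exact ⟨.inl a.1, a.2, rfl⟩
      · exact ⟨.inr (.inl x), (0 : Fin 1), rfl⟩
      · exact ⟨.inr (.inr (.inl y)), (0 : Fin 1), rfl⟩
      · exact ⟨.inr (.inr (.inr α)), (0 : Fin 1), rfl⟩
  refine ⟨e', he'F, he'k, he's, heV, _, bl, supp, lvl, U, fun α => .inr (.inr (.inr α)),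
    fun α => t (.inr (.inr (σ α))), hsys, hφc, ?_, fun α => ⟨rfl, rfl, ?_⟩⟩
  · exact fun α β h => hσ (Sum.inr_injective (Sum.inr_injective (ht.1.injective h)))
  · have hind := algebraicIndependent_fieldAt (S := (supp (.inr (.inr (.inr α))))ᶜ) ht.1
      (f := fun i : Bool => bif i then .inr (.inl α.1) else .inr (.inr (σ α))) (by
        rintro (_ | _) (_ | _) h <;> simp at h ⊢)
      (by rintro (_ | _) <;> simp [supp])
    have h2 := le_relRank_of_algebraicIndependent
      (X := (fieldAt F t (supp (.inr (.inr (.inr α))))ᶜ : Set K))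
      (Y := {t (.inr (.inr (σ α))), e' (t (.inr (.inr (σ α))))})
      (by rw [IntermediateField.adjoin_self]; exact hind) (by
        rintro (_ | _)
        · exact Or.inl rfl
        · exact Or.inr (heU α).symm)
    simpa using h2

end Construction

end ExpFld

namespace ExpFld

open AlgebraicIndependent Set Module

/-! ### Exponential independence from strongness -/

section ExpTranscendence

variable {K : Type u} [Field K] [CharZero K] {e : AddChar K K}

theorem finrank_span_singleton_le_one {M : Type*} [AddCommGroup M] [Module ℚ M] (x : M) :
    finrank ℚ (Submodule.span ℚ {x}) ≤ 1 := by
  by_cases hx : x = 0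
  · rw [hx, Submodule.span_zero_singleton, finrank_bot]
    exact zero_le_one
  · exact (finrank_span_singleton hx).le

/-- If `b` were in the closure of the others, it would lie in some `A` with rank at most linear
dimension over `Y`. Passing through `D`, the rank over `Y` is at least `2` plus that over `D`, while
the dimension grows by at most `1`; strongness of `D` makes this impossible. -/
theorem expIndep_of_isStrong {X B : Set K} (hs : IsStrong e (Submodule.span ℚ (X ∪ B) : Set K))
    (h2 : ∀ b ∈ B, 2 ≤ relRank (expHull e (X ∪ B \ {b})) {b, e b}) : ExpIndep e B := by
  intro b hb hecl
  set Y := X ∪ B \ {b} with hY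
  set D := Submodule.span ℚ (X ∪ B) with hD
  obtain ⟨A, hA, hbA, hr⟩ := exists_relRank_le_of_mem_ecl hecl (subset_union_right : _ ⊆ Y)
  have hYB : Y ⊆ X ∪ B := union_subset_union_right _ sdiff_subset
  have hYD : Submodule.span ℚ Y ≤ D := Submodule.span_mono hYB
  have hst := isStrong_iff.1 hs A hA
  rw [Submodule.span_eq] at hst
  have hbD : b ∈ D := Submodule.subset_span (Or.inr hb)
  have h1 : finrank ℚ ((A ⊓ D).map (Submodule.span ℚ Y).mkQ) ≤ 1 := by
    have hle : (A ⊓ D).map (Submodule.span ℚ Y).mkQ ≤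
        Submodule.span ℚ {(Submodule.span ℚ Y).mkQ b} := by
      refine (Submodule.map_mono inf_le_right).trans ?_
      rw [hD, Submodule.map_span, Submodule.span_le]
      rintro _ ⟨x, hx, rfl⟩
      by_cases hxb : x = b
      · rw [hxb]
        exact Submodule.mem_span_singleton_self _
      · have hxY : x ∈ Y := hx.imp_right fun h => ⟨h, hxb⟩
        have : (Submodule.span ℚ Y).mkQ x = 0 := by
          rw [Submodule.mkQ_apply, Submodule.Quotient.mk_eq_zero]
          exact Submodule.subset_span hxY
        rw [this]
        exact zero_mem _
    exact (Submodule.finrank_mono hle).trans (finrank_span_singleton_le_one _)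
  have h3 := finrank_map_mkQ_le hA hYD
  have h4 : relRank (expHull e Y) {b, e b} + relRank (expHull e D) (expHull e A) ≤
      relRank (expHull e Y) (expHull e A) := by
    have hsub : ({b, e b} : Set K) ⊆ expHull e A := by
      rintro x (rfl | rfl)
      · exact Or.inl hbA
      · exact Or.inr ⟨b, hbA, rfl⟩
    have := relRank_add_le (X := expHull e Y) (Y := {b, e b}) (X' := expHull e D)
      (Y' := expHull e A) (by
        refine Subset.trans (union_subset ?_ ?_) (subset_acl _)
        · exact expHull_mono e (Subset.trans Submodule.subset_span hYD)
        · rintro x (rfl | rfl)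
          · exact Or.inl hbD
          · exact Or.inr ⟨b, hbD, rfl⟩)
    rwa [union_eq_self_of_subset_left hsub] at this
  have h5 : 2 + relRank (expHull e D) (expHull e A) ≤
      ((1 + finrank ℚ (A.map D.mkQ) : ℕ) : ℕ∞) :=
    (add_le_add_left (h2 b hb) _).trans
      (h4.trans (hr.trans (Nat.cast_le.2 (h3.trans (Nat.add_le_add_right h1 _)))))
  have h6 := (add_le_add_right hst 2).trans h5
  have h7 : 2 + finrank ℚ (A.map D.mkQ) ≤ 1 + finrank ℚ (A.map D.mkQ) := by exact_mod_cast h6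
  omega

theorem mk_le_etd {B : Set K} (hB : ExpIndep e B) : Cardinal.mk B ≤ etd e :=
  le_ciSup (f := fun B : {B : Set K // ExpIndep e B} => Cardinal.mk B.1)
    Cardinal.bddAbove_of_small ⟨B, hB⟩

end ExpTranscendence

/-! ### Strong exponential-algebraic closedness and saturation -/

section Saturation

theorem mk_code_le (K : Type u) [Field K] [CharZero K] :
    Cardinal.mk (Σ n, Finset (MvPolynomial (Fin n ⊕ Fin n) K)) ≤ Cardinal.mk K := by
  have _ : Infinite K := Infinite.of_injective ((↑) : ℕ → K) Nat.cast_injective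
  have h0 := Cardinal.aleph0_le_mk K
  have h1 : ∀ n, Cardinal.mk (Finset (MvPolynomial (Fin n ⊕ Fin n) K)) ≤ Cardinal.mk K := by
    intro n
    rw [Cardinal.mk_finset_of_infinite]
    refine MvPolynomial.cardinalMk_le_max_lift.trans ?_
    have h2 : ((n + n : ℕ) : Cardinal.{u}) ≤ Cardinal.mk K := Cardinal.natCast_lt_aleph0.le.trans h0
    simpa [h0] using h2
  rw [Cardinal.mk_sigma]
  refine (Cardinal.sum_le_sum _ (fun _ => Cardinal.mk K) h1).trans ?_
  simp [h0]

theorem mk_iUnion_finite_lt {α β : Type u} [Infinite β] {A : Set α} (hA : Cardinal.mk A < Cardinal.mk β)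
    {Θ : Type u} {S : α → Set Θ} (hS : ∀ a, (S a).Finite) :
    Cardinal.mk (⋃ a : A, S a : Set Θ) < Cardinal.mk β := by
  by_cases hf : A.Finite
  · have _ : Finite A := hf
    exact (Set.finite_iUnion fun a : A => hS a).lt_aleph0.trans_le (Cardinal.aleph0_le_mk β)
  · have h0 : Cardinal.aleph0 ≤ Cardinal.mk A := Cardinal.infinite_iff.1 (infinite_coe_iff.2 hf)
    refine lt_of_le_of_lt ?_ hA
    refine (Cardinal.mk_iUnion_le _).trans ?_
    refine (mul_le_mul_right (ciSup_le' fun a : A => (hS a).lt_aleph0.le) _).trans ?_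
    exact (Cardinal.mul_aleph0_eq h0).le

variable {F K : Type u} [Field F] [Field K] [CharZero K] [Algebra F K] {t : Gens F → K}

theorem exists_level_coeff_mem (ht : IsTranscendenceBasis F t) {σ : Type*}
    (T : Finset (MvPolynomial σ K)) :
    ∃ n, ∀ f ∈ T, ∀ d, f.coeff d ∈ fieldAt F t {θ | θ.level < n} := by
  choose rk hrk using exists_mem_fieldAt_level (F := F) (K := K) ht
  have hfin : (⋃ f ∈ T, (fun d => rk (MvPolynomial.coeff d f)) '' (f.support : Set (σ →₀ ℕ))).Finite :=
    T.finite_toSet.biUnion fun f _ => f.support.finite_toSet.image _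
  obtain ⟨n, hn⟩ := hfin.bddAbove
  refine ⟨n, fun f hf d => ?_⟩
  by_cases hd : d ∈ f.support
  · have hle : rk (f.coeff d) ≤ n := hn (mem_biUnion hf (mem_image_of_mem _ hd))
    exact fieldAt_mono (fun θ hθ => lt_of_lt_of_le hθ hle) (hrk (f.coeff d))
  · rw [MvPolynomial.notMem_support_iff.1 hd]
    exact zero_mem _

theorem exists_slot_points [IsAlgClosed K] (ht : IsTranscendenceBasis F t)
    (code : F → Σ n, Finset (MvPolynomial (Fin n ⊕ Fin n) K)) :
    ∃ q : ℕ × F → Σ n, (Fin n ⊕ Fin n → K), ∀ v, IsFreePoint (fieldAt F t (Gens.slot v)ᶜ)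
      (fieldAt F t ({θ | θ.level < v.1} ∪ Gens.slot v)) (q v).2 ∧
      ∀ N T, code v.2 = ⟨N, T⟩ → ∀ V, IsCodedBy (fieldAt F t {θ | θ.level < v.1}) T V →
        ∃ p, q v = ⟨N, p⟩ ∧ IsGenericIn p V (fieldAt F t (Gens.slot v)ᶜ : Set K) := by
  suffices h : ∀ v : ℕ × F, ∃ q : Σ n, (Fin n ⊕ Fin n → K),
      IsFreePoint (fieldAt F t (Gens.slot v)ᶜ)
        (fieldAt F t ({θ | θ.level < v.1} ∪ Gens.slot v)) q.2 ∧
      ∀ V, IsCodedBy (fieldAt F t {θ | θ.level < v.1}) (code v.2).2 V →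
        ∃ p, q = ⟨(code v.2).1, p⟩ ∧ IsGenericIn p V (fieldAt F t (Gens.slot v)ᶜ : Set K) by
    choose q hq hq' using h
    refine ⟨q, fun v => ⟨hq v, fun N T hNT => ?_⟩⟩
    have := hq' v
    rw [hNT] at this
    exact this
  refine fun v => exists_isFreePoint_of_code (fieldAt_mono ?_)
    (τ := fun m => t (.inl (v, m))) ?_ ?_ (code v.2)
  · intro θ hθ hv
    exact absurd (Gens.level_of_mem_slot hv) (ne_of_lt hθ)
  · exact algebraicIndependent_fieldAt ht.1
      (fun a b h => congrArg Prod.snd (Sum.inl_injective h)) fun m h => h ⟨m, rfl⟩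
  · have hr : (range fun m => t (.inl (v, m))) = t '' Gens.slot v := range_comp t _
    rw [hr]
    exact acl_union_le_fieldAt subset_union_left subset_union_right

/-- By Hilbert's basis theorem `V` has a finite code, whose coefficients all appear below some level
`n`. The parameters lie in the field of fewer than `|F|` generators, and a slot of level `n` with
this code avoiding them has a point generic over them. -/
theorem cardSEAC_of_slot_points {e : AddChar K K} (ht : IsTranscendenceBasis F t)
    {code : F → Σ n, Finset (MvPolynomial (Fin n ⊕ Fin n) K)}
    (hcode : ∀ T, ∃ g : F → F, Function.Injective g ∧ ∀ s, code (g s) = T)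
    {q : ℕ × F → Σ n, (Fin n ⊕ Fin n → K)}
    (hq : ∀ v N T, code v.2 = ⟨N, T⟩ → ∀ V, IsCodedBy (fieldAt F t {θ | θ.level < v.1}) T V →
      ∃ p, q v = ⟨N, p⟩ ∧ IsGenericIn p V (fieldAt F t (Gens.slot v)ᶜ : Set K))
    (he : ∀ v i, e ((q v).2 (.inl i)) = (q v).2 (.inr i)) : CardSEAC e (Cardinal.mk F) := by
  intro N V hirr hrot hadd hmul _ A hA
  have _ : CharZero F := (algebraMap F K).charZero
  have _ : Infinite F := Infinite.of_injective ((↑) : ℕ → F) Nat.cast_injective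
  obtain ⟨T, hT⟩ := (isNoetherianRing_iff_ideal_fg _).1
    (inferInstance : IsNoetherianRing (MvPolynomial (Fin N ⊕ Fin N) K))
    (MvPolynomial.vanishingIdeal K V)
  obtain ⟨n, hn⟩ := exists_level_coeff_mem (F := F) ht T
  obtain ⟨g, hg, hcg⟩ := hcode ⟨N, T⟩
  choose S hSfin hS using exists_finite_mem_fieldAt (F := F) (K := K) ht
  have hlt := mk_iUnion_finite_lt hA hSfin
  -- Distinct slots are disjoint; if each met the generators of `A`, choosing common elements would
  -- inject `F` into a smaller set.
  obtain ⟨s, hs⟩ : ∃ s, Disjoint (⋃ a : A, S a) (Gens.slot (n, g s)) := by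
    by_contra! hcon
    simp only [not_disjoint_iff] at hcon
    choose f hf hf' using hcon
    refine hlt.not_ge (Cardinal.mk_le_of_injective (f := fun s => (⟨f s, hf s⟩ : ⋃ a : A, S a))
      fun a b hab => hg ?_)
    have h1 : f a = f b := congrArg Subtype.val hab
    exact congrArg Prod.snd (Gens.eq_of_mem_slot (hf' a) (h1 ▸ hf' b))
  obtain ⟨p, hqp, hp⟩ := hq (n, g s) N T (hcg s) V ⟨hirr, hrot, hadd, hmul, hT.symm, hn⟩
  have hep := he (n, g s)
  rw [hqp] at hep
  refine ⟨fun i => p (.inl i), ?_⟩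
  have hpt : expPoint e (fun i => p (.inl i)) = p := by
    ext (i | i)
    · rfl
    · exact hep i
  rw [hpt]
  refine hp.mono ?_
  rw [IntermediateField.adjoin_self]
  intro a ha
  exact fieldAt_mono (fun θ hθ => disjoint_left.1 hs (mem_iUnion.2 ⟨⟨a, ha⟩, hθ⟩)) (hS a)

theorem coe_span_range_algebraMap (F K : Type*) [Field F] [Field K] [CharZero K] [Algebra F K] :
    (Submodule.span ℚ (range (algebraMap F K)) : Set K) = range (algebraMap F K) := by
  refine Subset.antisymm (fun x hx => ?_) Submodule.subset_span
  rw [← adjoin_range_algebraMap]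
  exact Submodule.span_le (p := (IntermediateField.adjoin ℚ
    (range (algebraMap F K))).toSubmodule).2 (IntermediateField.subset_adjoin ℚ _) hx

theorem IsBlockSystem.expIndep {e : AddChar K K} {ι U : Type*} {bl : ι → Σ n, (Fin n → K)}
    {supp : ι → Set (Gens F)} {lvl : ι → ℕ}
    (h : IsBlockSystem F t Gens.level e bl supp lvl)
    (he : ∀ x : F, e (algebraMap F K x) ∈ range (algebraMap F K)) {j : U → ι} {u : U → K}
    (hu : Function.Injective u) (hlvl : ∀ α, lvl (j α) = 0)
    (hbl : ∀ α, bl (j α) = ⟨1, fun _ => u α⟩)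
    (h2 : ∀ α, 2 ≤ relRank (fieldAt F t (supp (j α))ᶜ : Set K) {u α, e (u α)}) :
    ExpIndep e (range u) := by
  have hmem : ∀ α, ∃ k, (bl (j α)).2 k = u α := fun α => by
    rw [hbl]
    exact ⟨0, rfl⟩
  have hmem' : ∀ α k, (bl (j α)).2 k = u α := fun α => by
    rw [hbl]
    exact fun _ => rfl
  have hinj : ∀ α β, j α = j β → α = β := fun α β hαβ => hu (by
    obtain ⟨k, hk⟩ := hmem α
    rw [← hk]
    revert k
    rw [hαβ]
    exact fun k _ => hmem' β k)
  have hset : {x | ∃ i ∈ range j, ∃ k, (bl i).2 k = x} = range u := by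
    ext x
    constructor
    · rintro ⟨_, ⟨α, rfl⟩, k, rfl⟩
      exact ⟨α, (hmem' α k).symm⟩
    · rintro ⟨α, rfl⟩
      exact ⟨j α, ⟨α, rfl⟩, hmem α⟩
  refine expIndep_of_isStrong (X := range (algebraMap F K)) ?_ ?_
  · rw [← hset]
    refine h.isStrong he ?_
    rintro _ ⟨α, rfl⟩
    exact hlvl α
  · rintro _ ⟨α, rfl⟩
    refine (h2 α).trans (relRank_anti ?_ _)
    rw [expHull_subset_acl_iff]
    rintro x (⟨y, rfl⟩ | ⟨⟨β, rfl⟩, hne⟩)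
    · rw [SetLike.mem_coe, ExpFld.mem_expCore, acl_fieldAt]
      obtain ⟨z, hz⟩ := he y
      exact ⟨algebraMap_mem_fieldAt _ _, hz ▸ algebraMap_mem_fieldAt _ _⟩
    · obtain ⟨k, hk⟩ := hmem β
      rw [← hk]
      refine h.mem_expCore (fun hβα => hne ?_) (by rw [hlvl, hlvl]) k
      rw [hinj _ _ hβα]
      rfl

theorem exists_saturated_extension (e : AddChar F F) [CharZero F] (hF : IsELA e) :
    ∃ (K : Type u) (_ : Field K) (_ : CharZero K) (_ : Algebra F K) (e' : AddChar K K),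
      IsELA e' ∧ (∀ x, e' (algebraMap F K x) = algebraMap F K (e x)) ∧
      (∀ x, e' x = 1 → x ∈ range (algebraMap F K)) ∧ IsStrong e' (range (algebraMap F K)) ∧
      Cardinal.mk K = Cardinal.mk F ∧ SaturatedOverKernel e' := by
  have _ : Infinite F := Infinite.of_injective ((↑) : ℕ → F) Nat.cast_injective
  obtain ⟨K, iK, iC, iA, t, hKc, ht, hcard⟩ := exists_field_extension F (Gens F) Gens.mk_eq.le
  have hcc : Cardinal.mk (F × Σ n, Finset (MvPolynomial (Fin n ⊕ Fin n) K)) = Cardinal.mk F := by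
    rw [Cardinal.mk_prod, Cardinal.lift_id, Cardinal.lift_id]
    refine Cardinal.mul_eq_left (Cardinal.aleph0_le_mk F) ((mk_code_le K).trans hcard.le) ?_
    exact Cardinal.mk_ne_zero_iff.2 ⟨⟨0, ∅⟩⟩
  -- Indexing by `F × codes` repeats every code `|F|` times.
  obtain ⟨ε⟩ := Cardinal.eq.1 hcc
  obtain ⟨q, hq⟩ := exists_slot_points ht fun s => (ε.symm s).2
  obtain ⟨e', heF, hek, hes, heq, ι, bl, supp, lvl, U, j, u, hsys, hU, hu, hj⟩ :=
    exists_exponential ht hF hcard fun v => (hq v).1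
  have heF' : ∀ x : F, e' (algebraMap F K x) ∈ range (algebraMap F K) :=
    fun x => ⟨e x, (heF x).symm⟩
  have hstrong : IsStrong e' (range (algebraMap F K)) := by
    have h := hsys.isStrong heF' (P := ∅) fun i hi => hi.elim
    have hempty : {x | ∃ i ∈ (∅ : Set ι), ∃ k, (bl i).2 k = x} = ∅ := by simp
    rwa [hempty, union_empty, coe_span_range_algebraMap] at h
  have hetd : Cardinal.mk K ≤ etd e' := by
    refine le_trans ?_ (mk_le_etd (hsys.expIndep heF' hu (fun α => (hj α).1)
      (fun α => (hj α).2.1) fun α => (hj α).2.2))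
    rw [Cardinal.mk_range_eq u hu, hU, hcard]
  have hseac : CardSEAC e' (Cardinal.mk K) := by
    rw [hcard]
    refine cardSEAC_of_slot_points ht (code := fun s => (ε.symm s).2) (fun T => ?_) (fun v => (hq v).2) heq
    exact ⟨fun f => ε (f, T), fun a b h => congrArg Prod.fst (ε.injective h), fun s => by simp⟩
  exact ⟨K, iK, iC, iA, e', ⟨hKc, hes⟩, heF, hek, hstrong, hcard, hetd, hseac⟩

end Saturation

end ExpFld

namespace ExpFld

open AlgebraicIndependent Set Module

/-! ### The kernel and its stabilizer are unchanged -/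

section Kernel

variable {F K : Type u} [Field F] [Field K] [Algebra F K]

theorem image_expHull {e : AddChar F F} {e' : AddChar K K}
    (he : ∀ x, e' (algebraMap F K x) = algebraMap F K (e x)) (Y : Set F) :
    algebraMap F K '' expHull e Y = expHull e' (algebraMap F K '' Y) := by
  simp only [expHull, image_union, image_image, he]

theorem image_ker {e : AddChar F F} {e' : AddChar K K}
    (he : ∀ x, e' (algebraMap F K x) = algebraMap F K (e x))
    (hk : ∀ x, e' x = 1 → x ∈ range (algebraMap F K)) : algebraMap F K '' ker e = ker e' := by
  ext x
  constructor
  · rintro ⟨y, hy, rfl⟩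
    exact (he y).trans (by rw [show e y = 1 from hy, map_one])
  · intro hx
    obtain ⟨y, rfl⟩ := hk x hx
    refine ⟨y, (algebraMap F K).injective ?_, rfl⟩
    rw [← he, map_one]
    exact hx

theorem algebraMap_mem_ker_iff {e : AddChar F F} {e' : AddChar K K}
    (he : ∀ x, e' (algebraMap F K x) = algebraMap F K (e x))
    (hk : ∀ x, e' x = 1 → x ∈ range (algebraMap F K)) {x : F} : algebraMap F K x ∈ ker e' ↔ x ∈ ker e := by
  rw [← image_ker he hk]
  exact (algebraMap F K).injective.mem_set_image

theorem algebraMap_mem_zStab_iff {e : AddChar F F} {e' : AddChar K K}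
    (he : ∀ x, e' (algebraMap F K x) = algebraMap F K (e x))
    (hk : ∀ x, e' x = 1 → x ∈ range (algebraMap F K)) {r : F} : algebraMap F K r ∈ zStab e' ↔ r ∈ zStab e := by
  constructor
  · intro hr x hx
    have := hr _ ((algebraMap_mem_ker_iff he hk).2 hx)
    rwa [← map_mul, algebraMap_mem_ker_iff he hk] at this
  · intro hr x hx
    rw [← image_ker he hk] at hx
    obtain ⟨y, hy, rfl⟩ := hx
    rw [← map_mul, algebraMap_mem_ker_iff he hk]
    exact hr y hy

/-- A stabilizing element is a quotient of two kernel elements, and these lie in `F`. -/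
theorem mem_range_of_mem_zStab {e : AddChar F F} {e' : AddChar K K}
    (he : ∀ x, e' (algebraMap F K x) = algebraMap F K (e x))
    (hk : ∀ x, e' x = 1 → x ∈ range (algebraMap F K))
    (hne : ∃ k ∈ ker e, k ≠ 0) {r : K} (hr : r ∈ zStab e') :
    r ∈ range (algebraMap F K) := by
  obtain ⟨k, hk1, hk0⟩ := hne
  have := hr _ ((algebraMap_mem_ker_iff he hk).2 hk1)
  rw [← image_ker he hk] at this
  obtain ⟨y, -, hy⟩ := this
  refine ⟨y / k, ?_⟩
  rw [map_div₀, hy, mul_div_cancel_right₀]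
  exact (map_ne_zero _).2 hk0

theorem exists_zStab_equiv {e : AddChar F F} {e' : AddChar K K}
    (he : ∀ x, e' (algebraMap F K x) = algebraMap F K (e x))
    (hk : ∀ x, e' x = 1 → x ∈ range (algebraMap F K))
    (hne : ∃ k ∈ ker e, k ≠ 0) :
    ∃ f : zStab e ≃+* zStab e', ∀ r, (f r : K) = algebraMap F K r := by
  let f : zStab e →+* zStab e' := ((algebraMap F K).comp (zStab e).subtype).codRestrict (zStab e')
    fun r => (algebraMap_mem_zStab_iff he hk).2 r.2
  have hf : ∀ r, (f r : K) = algebraMap F K r := fun _ => rfl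
  refine ⟨RingEquiv.ofBijective f ⟨fun a b h => ?_, fun r => ?_⟩, fun r => rfl⟩
  · have h' := congrArg (Subtype.val : zStab e' → K) h
    rw [hf, hf] at h'
    exact Subtype.ext ((algebraMap F K).injective h')
  · obtain ⟨y, hy⟩ := mem_range_of_mem_zStab he hk hne r.2
    exact ⟨⟨y, (algebraMap_mem_zStab_iff he hk).1 (hy ▸ r.2)⟩, Subtype.ext hy⟩

end Kernel

/-! ### Transfer of the axioms to the extension -/

section Transfer

variable {F K : Type u} [Field F] [CharZero F] [Field K] [CharZero K] [Algebra F K]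

theorem mem_acl_of_algebraMap_mem {S : Set F} {x : F}
    (h : algebraMap F K x ∈ acl (algebraMap F K '' S)) : x ∈ acl S := by
  rw [mem_acl] at h ⊢
  let Θ : F →ₐ[ℚ] K := (algebraMap F K).toRatAlgHom
  have hmap : (IntermediateField.adjoin ℚ S).map Θ =
      IntermediateField.adjoin ℚ (algebraMap F K '' S) := IntermediateField.adjoin_map ℚ S Θ
  have hm : ∀ y : IntermediateField.adjoin ℚ S,
      algebraMap F K y ∈ IntermediateField.adjoin ℚ (algebraMap F K '' S) := fun y => by
    rw [← hmap]
    exact ⟨y, y.2, rfl⟩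
  let f : IntermediateField.adjoin ℚ S →+* IntermediateField.adjoin ℚ (algebraMap F K '' S) :=
    ((algebraMap F K).comp (algebraMap (IntermediateField.adjoin ℚ S) F)).codRestrict
      (IntermediateField.adjoin ℚ (algebraMap F K '' S)) hm
  refine IsAlgebraic.of_ringHom_of_comp_eq f (algebraMap F K) h ?_ (algebraMap F K).injective rfl
  rintro ⟨y, hy⟩
  rw [← hmap] at hy
  obtain ⟨z, hz, rfl⟩ := hy
  exact ⟨⟨z, hz⟩, rfl⟩

theorem relRank_le_relRank_image (X Y : Set F) :
    relRank X Y ≤ relRank (algebraMap F K '' X) (algebraMap F K '' Y) := by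
  obtain ⟨I, hIY, hI, hc⟩ := Matroid.le_eRk_iff.1 (le_refl (relRank X Y))
  refine Matroid.le_eRk_iff.2 ⟨algebraMap F K '' I, image_mono hIY, ?_, ?_⟩
  · rw [contract_indep_iff_notMem_acl] at hI ⊢
    rintro _ ⟨i, hi, rfl⟩ hm
    refine hI i hi (mem_acl_of_algebraMap_mem (K := K) ?_)
    rw [image_union, image_sdiff (algebraMap F K).injective, image_singleton]
    exact hm
  · rw [(algebraMap F K).injective.encard_image, hc]

/-- Transitivity of strong embeddings. -/
theorem IsStrong.image_algebraMap {e : AddChar F F} {e' : AddChar K K}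
    (he : ∀ x, e' (algebraMap F K x) = algebraMap F K (e x)) {X : Set F} (hX : IsStrong e X)
    (hF : IsStrong e' (range (algebraMap F K))) : IsStrong e' (algebraMap F K '' X) := by
  let Θ : F →ₗ[ℚ] K := (algebraMap F K).toRatAlgHom.toLinearMap
  have hΘ : ∀ x, Θ x = algebraMap F K x := fun _ => rfl
  rw [isStrong_iff] at hX hF ⊢
  intro A hA
  have hFA := hF A hA
  set D := Submodule.span ℚ X with hD
  set D₁ := Submodule.span ℚ (range (algebraMap F K)) with hD₁
  have hD₀ : Submodule.span ℚ (algebraMap F K '' X) = D.map Θ := (Submodule.map_span Θ X).symm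
  rw [hD₀]
  have hD₁r : D₁ = LinearMap.range Θ :=
    SetLike.coe_injective ((coe_span_range_algebraMap F K).trans rfl)
  have hle : D.map Θ ≤ D₁ := hD₁r ▸ LinearMap.map_le_range
  -- The part of `A` inside `F` is estimated by strongness of `X` in `F`, the remainder by
  -- strongness of `F` in `K`.
  let B := (A ⊓ D₁).comap Θ
  have hBA : B.map Θ = A ⊓ D₁ := by
    rw [Submodule.map_comap_eq, ← hD₁r]
    exact inf_eq_right.2 inf_le_right
  have hBfg : B.FG := by
    refine Submodule.fg_of_fg_map_injective Θ (algebraMap F K).injective ?_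
    rw [hBA]
    have _ : FiniteDimensional ℚ A := Module.Finite.iff_fg.2 hA
    exact Module.Finite.iff_fg.1 (Submodule.finiteDimensional_of_le (inf_le_left : A ⊓ D₁ ≤ A))
  have hFB := hX B hBfg
  have h1 : finrank ℚ ((A ⊓ D₁).map (D.map Θ).mkQ) ≤ finrank ℚ (B.map D.mkQ) := by
    have hm : (A ⊓ D₁).map (D.map Θ).mkQ =
        (B.map D.mkQ).map (D.mapQ (D.map Θ) Θ (Submodule.le_comap_map Θ D)) := by
      rw [← hBA, ← Submodule.map_comp, ← Submodule.map_comp]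
      rfl
    rw [hm]
    have _ : FiniteDimensional ℚ (B.map D.mkQ) := Module.Finite.iff_fg.2 (hBfg.map _)
    exact Submodule.finrank_map_le _ _
  have h2 : relRank (expHull e D) (expHull e B) ≤
      relRank (expHull e' (D.map Θ)) (expHull e' (A ⊓ D₁ : Submodule ℚ K)) := by
    refine (relRank_le_relRank_image (K := K) _ _).trans ?_
    rw [image_expHull he, image_expHull he, ← hBA]
    exact le_rfl
  have h3 := relRank_add_le (X := expHull e' (D.map Θ))
    (Y := expHull e' (A ⊓ D₁ : Submodule ℚ K)) (X' := expHull e' D₁) (Y' := expHull e' A)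
    (union_subset ((expHull_mono e' hle).trans (subset_acl _))
      ((expHull_mono e' (inf_le_right : A ⊓ D₁ ≤ D₁)).trans (subset_acl _)))
  rw [union_eq_self_of_subset_left (expHull_mono e' (inf_le_left : A ⊓ D₁ ≤ A))] at h3
  calc (finrank ℚ (A.map (D.map Θ).mkQ) : ℕ∞)
      ≤ ((finrank ℚ ((A ⊓ D₁).map (D.map Θ).mkQ) + finrank ℚ (A.map D₁.mkQ) : ℕ) : ℕ∞) :=
        Nat.cast_le.2 (finrank_map_mkQ_le hA hle)
    _ ≤ relRank (expHull e' (D.map Θ)) (expHull e' (A ⊓ D₁ : Submodule ℚ K)) +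
          relRank (expHull e' D₁) (expHull e' A) := by
        rw [Nat.cast_add]
        exact add_le_add ((Nat.cast_le.2 h1).trans (hFB.trans h2)) hFA
    _ ≤ _ := h3

theorem ModelsTrueArithmetic.of_ringEquiv {R S : Type u} [CommRing R] [CommRing S] (f : R ≃+* S)
    (h : ModelsTrueArithmetic R) : ModelsTrueArithmetic S := by
  let _ := FirstOrder.Ring.compatibleRingOfRing R
  let _ := FirstOrder.Ring.compatibleRingOfRing S
  let _ := FirstOrder.Ring.compatibleRingOfRing ℤ
  have h1 : FirstOrder.Language.ElementarilyEquivalent FirstOrder.Language.ring ℤ R := h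
  have h2 : FirstOrder.Language.ElementarilyEquivalent FirstOrder.Language.ring R S :=
    FirstOrder.Language.StrongHomClass.elementarilyEquivalent
      (FirstOrder.Ring.languageEquivEquivRingEquiv.symm f)
  exact h1.trans h2

/-- Twice a logarithm of `-1`. -/
theorem exists_ne_zero_mem_ker {e : AddChar F F} (hF : IsELA e) : ∃ k ∈ ker e, k ≠ 0 := by
  obtain ⟨x, hx⟩ := hF.2 (-1) (neg_ne_zero.2 one_ne_zero)
  refine ⟨x + x, ?_, fun h => ?_⟩
  · change e (x + x) = 1
    rw [AddChar.map_add_eq_mul, hx, neg_mul_neg, one_mul]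
  · have hx0 : x = 0 := add_self_eq_zero.1 h
    rw [hx0, AddChar.map_zero_eq_one] at hx
    exact (neg_ne_self.2 (one_ne_zero (α := F))) hx.symm

theorem CardSEAC.seac {e : AddChar K K} (h : CardSEAC e (Cardinal.mk K)) : SEAC e := by
  have _ : Infinite K := Infinite.of_injective ((↑) : ℕ → K) Nat.cast_injective
  exact fun n V h1 h2 h3 h4 h5 r a => h n V h1 h2 h3 h4 h5 _
    ((finite_range a).lt_aleph0.trans_le (Cardinal.aleph0_le_mk K))

theorem IsECFStrK.of_extension {e : AddChar F F} {e' : AddChar K K} (hF : IsECFStrK e)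
    (hela : IsELA e') (he : ∀ x, e' (algebraMap F K x) = algebraMap F K (e x))
    (hk : ∀ x, e' x = 1 → x ∈ range (algebraMap F K))
    (hs : IsStrong e' (range (algebraMap F K))) (hseac : SEAC e') : IsECFStrK e' := by
  have hne := exists_ne_zero_mem_ker hF.ela
  obtain ⟨f, hf⟩ := exists_zStab_equiv he hk hne
  refine ⟨hela, ?_, ?_, hF.true_arithmetic.of_ringEquiv f, ?_, hseac⟩
  · obtain ⟨c, hc, hgen⟩ := hF.cyclic_kernel
    refine ⟨algebraMap F K c, (algebraMap_mem_ker_iff he hk).2 hc, fun k hkk => ?_⟩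
    rw [← image_ker he hk] at hkk
    obtain ⟨y, hy, rfl⟩ := hkk
    obtain ⟨r, hr, rfl⟩ := hgen y hy
    exact ⟨algebraMap F K r, (algebraMap_mem_zStab_iff he hk).2 hr, map_mul _ _ _⟩
  · intro k hkk hk0
    rw [← image_ker he hk] at hkk
    obtain ⟨y, hy, rfl⟩ := hkk
    have hy0 : y ≠ 0 := fun h => hk0 (by rw [h, map_zero])
    exact (hF.kernel_transcendental y hy hy0).ringHom_of_comp_eq f (algebraMap F K) f.surjective
      (algebraMap F K).injective (RingHom.ext hf)
  · rw [← image_ker he hk]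
    exact hF.strong_kernel.image_algebraMap he hs

end Transfer

end ExpFld

theorem mainTheorem12 {F : Type u} [Field F] [CharZero F] (e : AddChar F F)
    (hF : ExpFld.IsECFStrK e) :
    ∃ (F' : Type u) (_ : Field F') (_ : CharZero F') (e' : AddChar F' F') (θ : F →+* F'),
      (∀ x, θ (e x) = e' (θ x)) ∧
      θ '' ExpFld.ker e = ExpFld.ker e' ∧
      ExpFld.IsStrong e' (Set.range θ) ∧
      ExpFld.IsECFStrK e' ∧
      Cardinal.mk F' = Cardinal.mk F ∧
      ExpFld.SaturatedOverKernel e' := by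
  obtain ⟨K, iK, iC, iA, e', hela, he, hk, hs, hcard, hsat⟩ :=
    ExpFld.exists_saturated_extension e hF.ela
  exact ⟨K, iK, iC, e', algebraMap F K, fun x => (he x).symm, ExpFld.image_ker he hk, hs,
    hF.of_extension hela he hk hs (hsat.2.seac), hcard, hsat⟩
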